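/- Let $k$ be a field of characteristic $0$ and let $\mathcal C$ be a nontrivial conjugacy class of $G=S_5$. Let $\Lambda^1=k\mathcal C$ be the vector space with basis $\{e_a\}_{a\in\mathcal C}$ and $G$-action $g\cdot e_a=e_{gag^{-1}}$, let $\Psi(e_a\otimes e_b)=e_{aba^{-1}}\otimes e_a$ on $\Lambda^1\otimes\Lambda^1$, let $\Lambda_{quad}$ be the quotient of the tensor algebra $T\Lambda^1$ by the two-sided ideal generated by $\ker(\mathrm{id}-\Psi)$, let $\theta=\sum_{a\in\mathcal C}e_a$, and let $\theta_i$ be the sum of the $e_a$ over the $a\in\mathcal C$ that do not fix $i$. For a connection with constant coefficients $\alpha\in\Lambda^1$ put $d\alpha=\theta\alpha+\alpha\theta$ and $F(\alpha)=d\alpha+\alpha^2\in\Lambda_{quad}$; it is flat if $F(\alpha)=0$. Let $F_n=F_n(\mathcal C)$ be the set of all $\phi\in\Lambda^1$ with all coefficients in $\{0,1\}$ and exactly $n$ coefficients equal to $1$ such that $\alpha=\phi-\theta$ is flat, let $kF_n\subseteq\Lambda^1$ be its span, and, if $\theta\in kF_n$, let $V_n=kF_n/k\theta$ as a representation of $S_5$.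 Write $\mathrm{fund}$ for the standard $4$-dimensional representation, $\mathrm{sign}$ for the sign representation, and $5$, resp. $\bar 5$, for the $5$-dimensional irreducible representation whose character at $(12)$ is $1$, resp. $-1$. Brackets in labels of $e$ are suppressed, e.g. $e_{12,34}=e_{(12)(34)}$. The nontrivial conjugacy classes of $S_5$ are those of $(12)$, $(12)(34)$, $(123)$, $(123)(45)$, $(1234)$ and $(12345)$. For each of them $F_0=\{0\}$, $F_1=\{e_a\mid a\in\mathcal C\}$ and $F_{|\mathcal C|}=\{\theta\}$. The other nonempty strata are exactly the following, and for the submaximal one (the largest $n<|\mathcal C|$ with $F_n\neq\emptyset$) $\theta\in kF_n$ and $V_n$ is as stated. 1. $\mathcal C\ni(12)$, $|\mathcal C|=10$: $F_6=\{\theta-\theta_i\mid 1\le i\le 5\}$ ($5$ elements), $|F_4|=10$, $|F_3|=10$, $|F_2|=15$; $V_6\cong\mathrm{fund}$. 2. $\mathcal C\ni(12)(34)$, $|\mathcal C|=15$: $F_5$ consists of the six distinct elements $$\begin{aligned} &e_{14,23}+e_{12,35}+e_{13,45}+e_{25,34}+e_{15,24},\quad e_{14,23}+e_{13,25}+e_{24,35}+e_{15,34}+e_{12,45},\\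 &e_{13,24}+e_{12,35}+e_{14,25}+e_{15,34}+e_{23,45},\quad e_{13,24}+e_{15,23}+e_{25,34}+e_{12,45}+e_{14,35},\\ &e_{12,34}+e_{13,25}+e_{23,45}+e_{15,24}+e_{14,35},\quad e_{12,34}+e_{15,23}+e_{24,35}+e_{14,25}+e_{13,45}, \end{aligned}$$ and $|F_3|=15$, $|F_2|=15$; $V_5\cong\bar 5$. 3. $\mathcal C\ni(123)$, $|\mathcal C|=20$: $F_8=\{\theta-\theta_i\mid 1\le i\le 5\}$ ($5$ elements), $|F_4|=10$, $|F_2|=10$; $V_8\cong\mathrm{fund}$. 4. $\mathcal C\ni(123)(45)$, $|\mathcal C|=20$: $F_2=\{e_{xyz,uv}+e_{xzy,uv}\mid \{x,y,z,u,v\}=\{1,2,3,4,5\}\}$ ($10$ elements, one for each $2$-cycle $(uv)$); $V_2\cong\mathrm{fund}\oplus 5$. 5. $\mathcal C\ni(1234)$, $|\mathcal C|=30$: $F_{10}$ consists of the six distinct elements $$\begin{aligned} &e_{1234}+e_{1523}+e_{2435}+e_{2534}+e_{1245}+e_{1542}+e_{1354}+e_{1453}+e_{1432}+e_{1325},\\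 &e_{1234}+e_{1253}+e_{2453}+e_{2354}+e_{1524}+e_{1425}+e_{1345}+e_{1543}+e_{1432}+e_{1352},\\ &e_{1235}+e_{1243}+e_{1342}+e_{1354}+e_{1425}+e_{1453}+e_{1524}+e_{1532}+e_{2345}+e_{2543},\\ &e_{1523}+e_{2453}+e_{2354}+e_{1243}+e_{1452}+e_{1254}+e_{1534}+e_{1435}+e_{1342}+e_{1325},\\ &e_{1532}+e_{2435}+e_{2534}+e_{1452}+e_{1254}+e_{1345}+e_{1324}+e_{1543}+e_{1423}+e_{1235},\\ &e_{1253}+e_{2345}+e_{2543}+e_{1245}+e_{1542}+e_{1534}+e_{1435}+e_{1324}+e_{1423}+e_{1352}, \end{aligned}$$ $F_6=\{\theta-\theta_i\mid 1\le i\le 5\}$ ($5$ elements), $|F_5|=12$, $|F_2|=15$; $V_{10}\cong\bar 5$. 6. $\mathcal C\ni(12345)$, $|\mathcal C|=24$: $F_{12}$ consists of two elements, the sum of the $e_{1abcd}$ over all even permutations $abcd$ of $2345$ and the sum over all odd ones; $|F_4|=6$, $|F_3|=24$, $|F_2|=36$; $V_{12}\cong\mathrm{sign}$. -/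

import Mathlib

open scoped TensorProduct

namespace NCGeom

noncomputable section

variable (k : Type*) [Field k] {G : Type*} [Group G]

/-- The space `Λ¹ = k𝒞` of left-invariant 1-forms on `G` for the bicovariant calculus given by the
conjugacy class `𝒞`: the vector space with basis `e_a`, `a ∈ 𝒞`. The value `φ a` of `φ : Lam1 k C`
is the coefficient of `e_a`. In the free left `k(G)`-module `Ω¹(G) = k(G) ⊗ Λ¹`, these are exactly
the 1-forms with constant coefficients. -/
abbrev Lam1 (C : ConjClasses G) : Type _ := C.carrier → k

/-- `Ad_g a = g a g⁻¹` on the conjugacy class. -/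
def conjBy (C : ConjClasses G) (g : G) (a : C.carrier) : C.carrier :=
  ⟨g * a * g⁻¹, by
    have h := a.2
    rw [ConjClasses.mem_carrier_iff_mk_eq] at h ⊢
    exact (ConjClasses.mk_eq_mk_iff_isConj.2 (isConj_iff.2 ⟨g, rfl⟩).symm).trans h⟩

@[simp] theorem conjBy_coe (C : ConjClasses G) (g : G) (a : C.carrier) :
    (conjBy C g a : G) = g * a * g⁻¹ := rfl

theorem conjBy_one (C : ConjClasses G) (a : C.carrier) : conjBy C 1 a = a :=
  Subtype.ext (by simp)

theorem conjBy_mul (C : ConjClasses G) (g h : G) (a : C.carrier) :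
    conjBy C (g * h) a = conjBy C g (conjBy C h a) :=
  Subtype.ext (by simp [mul_assoc])

theorem conjBy_conjBy (C : ConjClasses G) (g : G) (a b : C.carrier) :
    conjBy C g (conjBy C a b) = conjBy C (conjBy C g a) (conjBy C g b) :=
  Subtype.ext (by simp [mul_assoc])

theorem conjBy_inv_apply (C : ConjClasses G) (g : G) (a : C.carrier) :
    conjBy C g (conjBy C g⁻¹ a) = a := by
  rw [← conjBy_mul, mul_inv_cancel, conjBy_one]

theorem conjBy_apply_inv (C : ConjClasses G) (g : G) (a : C.carrier) :
    conjBy C g⁻¹ (conjBy C g a) = a := by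
  rw [← conjBy_mul, inv_mul_cancel, conjBy_one]

theorem conjBy_injective (C : ConjClasses G) (g : G) : Function.Injective (conjBy C g) :=
  Function.LeftInverse.injective (conjBy_apply_inv C g)

variable [Finite G]

open Classical in
/-- The basis 1-form `e_a`. -/
def e (C : ConjClasses G) (a : C.carrier) : Lam1 k C := Pi.single a 1

theorem basisFun_tensorProduct_apply (C : ConjClasses G) (a b : C.carrier) :
    ((Pi.basisFun k C.carrier).tensorProduct (Pi.basisFun k C.carrier)) (a, b) =
      e k C a ⊗ₜ[k] e k C b := by
  classical
  rw [Module.Basis.tensorProduct_apply, Pi.basisFun_apply, Pi.basisFun_apply]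
  unfold e
  congr!

/-- The braiding `Ψ : Λ¹ ⊗ Λ¹ → Λ¹ ⊗ Λ¹`, `Ψ(e_a ⊗ e_b) = e_{aba⁻¹} ⊗ e_a`. -/
def braiding (C : ConjClasses G) : Lam1 k C ⊗[k] Lam1 k C →ₗ[k] Lam1 k C ⊗[k] Lam1 k C :=
  ((Pi.basisFun k C.carrier).tensorProduct (Pi.basisFun k C.carrier)).constr k
    fun p => e k C (conjBy C p.1 p.2) ⊗ₜ[k] e k C p.1

theorem braiding_e_tmul_e (C : ConjClasses G) (a b : C.carrier) :
    braiding k C (e k C a ⊗ₜ[k] e k C b) = e k C (conjBy C a b) ⊗ₜ[k] e k C a := by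
  rw [← basisFun_tensorProduct_apply, braiding, Module.Basis.constr_basis]

/-- The product `Λ¹ ⊗ Λ¹ → T²Λ¹ ⊆ TΛ¹` in the tensor algebra. -/
def tensorMul (C : ConjClasses G) : Lam1 k C ⊗[k] Lam1 k C →ₗ[k] TensorAlgebra k (Lam1 k C) :=
  TensorProduct.lift ((LinearMap.mul k (TensorAlgebra k (Lam1 k C))).compl₁₂
    (TensorAlgebra.ι k) (TensorAlgebra.ι k))

@[simp] theorem tensorMul_tmul (C : ConjClasses G) (x y : Lam1 k C) :
    tensorMul k C (x ⊗ₜ[k] y) = TensorAlgebra.ι k x * TensorAlgebra.ι k y := by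
  simp [tensorMul]

/-- The relations of the quadratic exterior algebra: every element of `ker (id - Ψ)` is zero. -/
def QuadRel (C : ConjClasses G) (x y : TensorAlgebra k (Lam1 k C)) : Prop :=
  ∃ t : Lam1 k C ⊗[k] Lam1 k C,
    t ∈ LinearMap.ker ((LinearMap.id : _ →ₗ[k] _) - braiding k C) ∧
      x = tensorMul k C t ∧ y = 0

/-- The quadratic exterior algebra `Λ_quad = TΛ¹ / ker (id - Ψ)` of left-invariant forms. -/
abbrev LamQuad (C : ConjClasses G) : Type _ := RingQuot (QuadRel k C)

/-- The inclusion `Λ¹ → Λ_quad`. -/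
def incl (C : ConjClasses G) : Lam1 k C →ₗ[k] LamQuad k C :=
  (RingQuot.mkAlgHom k (QuadRel k C)).toLinearMap ∘ₗ TensorAlgebra.ι k

/-- The action of `G` on `Λ¹`, `g • e_a = e_{gag⁻¹}`. -/
def conjRep (C : ConjClasses G) : Representation k G (Lam1 k C) where
  toFun g := LinearMap.funLeft k k (conjBy C g⁻¹)
  map_one' := by
    ext
    simp [LinearMap.funLeft_apply, conjBy_one]
  map_mul' g h := by
    ext
    simp [LinearMap.funLeft_apply, conjBy_mul]

theorem conjRep_apply (C : ConjClasses G) (g : G) (φ : Lam1 k C) (a : C.carrier) :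
    conjRep k C g φ a = φ (conjBy C g⁻¹ a) := rfl

theorem conjRep_e (C : ConjClasses G) (g : G) (a : C.carrier) :
    conjRep k C g (e k C a) = e k C (conjBy C g a) := by
  classical
  ext b
  rw [conjRep_apply]
  have : conjBy C g⁻¹ b = a ↔ b = conjBy C g a :=
    ⟨fun h => by rw [← h, conjBy_inv_apply], fun h => by rw [h, conjBy_apply_inv]⟩
  simp [e, Pi.single_apply, this]

/-- The 1-form `∑_{a ∈ 𝒞 ∩ S} e_a`, for a set `S` of group elements. -/
def formOn (C : ConjClasses G) (S : Set G) : Lam1 k C :=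
  fun a => S.indicator (fun _ => (1 : k)) a

/-- `θ = ∑_{a ∈ 𝒞} e_a`. -/
def theta (C : ConjClasses G) : Lam1 k C := formOn k C Set.univ

/-- The exterior derivative on invariant 1-forms, `dα = θα + αθ`. -/
def extD (C : ConjClasses G) (α : Lam1 k C) : LamQuad k C :=
  incl k C (theta k C) * incl k C α + incl k C α * incl k C (theta k C)

/-- The curvature `F(α) = dα + α²` of the connection `α`. -/
def curvature (C : ConjClasses G) (α : Lam1 k C) : LamQuad k C :=
  extD k C α + incl k C α * incl k C α

/-- The stratum `F_n`: the 1-forms `φ` with all coefficients in `{0,1}`, exactly `n` of which are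
nonzero, such that the connection `α = φ - θ` is flat. -/
def stratum (C : ConjClasses G) (n : ℕ) : Set (Lam1 k C) :=
  {φ | (∀ a, φ a = 0 ∨ φ a = 1) ∧ curvature k C (φ - theta k C) = 0 ∧ {a | φ a ≠ 0}.ncard = n}

theorem conjRep_theta (C : ConjClasses G) (g : G) :
    conjRep k C g (theta k C) = theta k C := by
  ext a
  rw [conjRep_apply]
  simp [theta, formOn]

theorem braiding_conjRep (C : ConjClasses G) (g : G) (t : Lam1 k C ⊗[k] Lam1 k C) :
    braiding k C (TensorProduct.map (conjRep k C g) (conjRep k C g) t) =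
      TensorProduct.map (conjRep k C g) (conjRep k C g) (braiding k C t) := by
  have h : braiding k C ∘ₗ TensorProduct.map (conjRep k C g) (conjRep k C g) =
      TensorProduct.map (conjRep k C g) (conjRep k C g) ∘ₗ braiding k C := by
    refine ((Pi.basisFun k C.carrier).tensorProduct (Pi.basisFun k C.carrier)).ext ?_
    rintro ⟨a, b⟩
    rw [basisFun_tensorProduct_apply]
    simp only [LinearMap.comp_apply, TensorProduct.map_tmul, conjRep_e, braiding_e_tmul_e,
      conjBy_conjBy]
  exact LinearMap.congr_fun h t

/-- The algebra endomorphism of `Λ_quad` extending the action of `g` on `Λ¹`. -/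
def conjAlg (C : ConjClasses G) (g : G) : LamQuad k C →ₐ[k] LamQuad k C :=
  RingQuot.liftAlgHom k ⟨TensorAlgebra.lift k (incl k C ∘ₗ conjRep k C g), by
    rintro x y ⟨t, ht, rfl, rfl⟩
    have key : ∀ s : Lam1 k C ⊗[k] Lam1 k C,
        TensorAlgebra.lift k (incl k C ∘ₗ conjRep k C g) (tensorMul k C s) =
          RingQuot.mkAlgHom k (QuadRel k C)
            (tensorMul k C (TensorProduct.map (conjRep k C g) (conjRep k C g) s)) := by
      intro s
      induction s using TensorProduct.induction_on with
      | zero => simp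
      | tmul x y => simp [incl]
      | add x y hx hy => simp only [map_add, hx, hy]
    rw [key, map_zero, ← map_zero (RingQuot.mkAlgHom k (QuadRel k C))]
    refine RingQuot.mkAlgHom_rel k ⟨_, ?_, rfl, rfl⟩
    have ht' : t = braiding k C t := by
      simpa [sub_eq_zero] using ht
    simp [braiding_conjRep, ← ht']⟩

theorem conjAlg_incl (C : ConjClasses G) (g : G) (α : Lam1 k C) :
    conjAlg k C g (incl k C α) = incl k C (conjRep k C g α) := by
  simp only [conjAlg, incl, LinearMap.comp_apply, AlgHom.toLinearMap_apply,
    RingQuot.liftAlgHom_mkAlgHom_apply, TensorAlgebra.lift_ι_apply]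

theorem curvature_conjRep (C : ConjClasses G) (g : G) (α : Lam1 k C) :
    curvature k C (conjRep k C g α) = conjAlg k C g (curvature k C α) := by
  simp [curvature, extD, conjAlg_incl, conjRep_theta]

theorem conjRep_mem_stratum (C : ConjClasses G) (n : ℕ) (g : G) {φ : Lam1 k C}
    (h : φ ∈ stratum k C n) : conjRep k C g φ ∈ stratum k C n := by
  obtain ⟨h1, h2, h3⟩ := h
  refine ⟨fun a => ?_, ?_, ?_⟩
  · rw [conjRep_apply]
    exact h1 _
  · have : conjRep k C g φ - theta k C = conjRep k C g (φ - theta k C) := by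
      rw [map_sub, conjRep_theta]
    rw [this, curvature_conjRep, h2, map_zero]
  · have : {a | conjRep k C g φ a ≠ 0} = conjBy C g '' {a | φ a ≠ 0} := by
      ext a
      constructor
      · intro ha
        exact ⟨conjBy C g⁻¹ a, ha, conjBy_inv_apply C g a⟩
      · rintro ⟨b, hb, rfl⟩
        simpa [conjRep_apply, conjBy_apply_inv] using hb
    rw [this, Set.ncard_image_of_injective _ (conjBy_injective C g), h3]

/-- The span `kF_n ⊆ Λ¹` of the stratum `F_n`. -/
def kF (C : ConjClasses G) (n : ℕ) : Submodule k (Lam1 k C) :=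
  Submodule.span k (stratum k C n)

theorem kF_le_comap (C : ConjClasses G) (n : ℕ) (g : G) :
    kF k C n ≤ (kF k C n).comap (conjRep k C g) :=
  Submodule.span_le.2 fun _ hφ => Submodule.subset_span (conjRep_mem_stratum k C n g hφ)

/-- The line `kθ`, as a subspace of `kF_n` (when `θ ∈ kF_n`). -/
def thetaLine (C : ConjClasses G) (n : ℕ) : Submodule k (kF k C n) :=
  (Submodule.span k {theta k C}).comap (kF k C n).subtype

theorem thetaLine_le_comap (C : ConjClasses G) (n : ℕ) (g : G) :
    thetaLine k C n ≤ (thetaLine k C n).comap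
      ((conjRep k C).subrepresentation (kF k C n) (kF_le_comap k C n) g) := by
  intro v hv
  obtain ⟨c, hc⟩ := Submodule.mem_span_singleton.1 (Submodule.mem_comap.1 hv)
  refine Submodule.mem_span_singleton.2 ⟨c, ?_⟩
  change c • theta k C = conjRep k C g (v : Lam1 k C)
  rw [show (v : Lam1 k C) = c • theta k C from hc.symm, map_smul, conjRep_theta]

/-- The representation `V_n = kF_n / kθ` of `G`. -/
def V (C : ConjClasses G) (n : ℕ) : Representation k G (kF k C n ⧸ thetaLine k C n) :=
  ((conjRep k C).subrepresentation (kF k C n) (kF_le_comap k C n)).quotient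
    (thetaLine k C n) (thetaLine_le_comap k C n)

/-! ### Some representations of symmetric groups -/

/-- The permutation representation of `S_N` on `k^N`: `(σ • f) i = f (σ⁻¹ i)`. -/
def permRep (N : ℕ) : Representation k (Equiv.Perm (Fin N)) (Fin N → k) where
  toFun σ := LinearMap.funLeft k k (σ⁻¹ : Equiv.Perm (Fin N))
  map_one' := by ext; simp [LinearMap.funLeft]
  map_mul' σ τ := by ext; simp [LinearMap.funLeft]

/-- The fundamental (standard) representation of `S_N`: the vectors of `k^N` with coordinate
sum zero. -/
def fund (N : ℕ) : Subrepresentation (permRep k N) where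
  toSubmodule := LinearMap.ker (∑ i, LinearMap.proj (R := k) (φ := fun _ : Fin N => k) i)
  apply_mem_toSubmodule σ := fun v hv => by
    have hv' : ∑ i, v i = 0 := by simpa using hv
    have : ∑ i, v ((σ⁻¹ : Equiv.Perm (Fin N)) i) = 0 := by
      rw [Equiv.sum_comp (σ⁻¹ : Equiv.Perm (Fin N)) v, hv']
    simpa [permRep, LinearMap.funLeft] using this

/-- The sign representation of `S_N` on `k`. -/
def signRep (N : ℕ) : Representation k (Equiv.Perm (Fin N)) k where
  toFun σ := ((Equiv.Perm.sign σ : ℤ) : k) • LinearMap.id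
  map_one' := by ext; simp
  map_mul' σ τ := by ext; simp [mul_comm]

/-- `ρ` is the 5-dimensional irreducible representation of `S_5` denoted `5`, whose character at a
transposition is positive, namely `1`. -/
def IsFive {W : Type*} [AddCommGroup W] [Module k W]
    (ρ : Representation k (Equiv.Perm (Fin 5)) W) : Prop :=
  ρ.IsIrreducible ∧ Module.finrank k W = 5 ∧ ρ.character (Equiv.swap 1 2) = 1

/-- `ρ` is the 5-dimensional irreducible representation of `S_5` denoted `5̄`, whose character at a
transposition is negative, namely `-1`. -/
def IsFiveBar {W : Type*} [AddCommGroup W] [Module k W]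
    (ρ : Representation k (Equiv.Perm (Fin 5)) W) : Prop :=
  ρ.IsIrreducible ∧ Module.finrank k W = 5 ∧ ρ.character (Equiv.swap 1 2) = -1

/-- The form `θ_i`, the sum of the `e_a` over the cycles `a ∈ 𝒞` containing `i`. -/
def thetaAt {N : ℕ} (C : ConjClasses (Equiv.Perm (Fin N))) (i : Fin N) : Lam1 k C :=
  formOn k C {a | a i ≠ i}

end

/-- Six sets of five elements of the class of `(12)(34)`; the points `1, 2, 3, 4, 5` are written as
such in `Fin 5` (so that `5` is the element `0`). -/
def doubleTranspositionSets : Set (Set (Equiv.Perm (Fin 5))) := {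
  {c[1, 4] * c[2, 3], c[1, 2] * c[3, 5], c[1, 3] * c[4, 5], c[2, 5] * c[3, 4], c[1, 5] * c[2, 4]},
  {c[1, 4] * c[2, 3], c[1, 3] * c[2, 5], c[2, 4] * c[3, 5], c[1, 5] * c[3, 4], c[1, 2] * c[4, 5]},
  {c[1, 3] * c[2, 4], c[1, 2] * c[3, 5], c[1, 4] * c[2, 5], c[1, 5] * c[3, 4], c[2, 3] * c[4, 5]},
  {c[1, 3] * c[2, 4], c[1, 5] * c[2, 3], c[2, 5] * c[3, 4], c[1, 2] * c[4, 5], c[1, 4] * c[3, 5]},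
  {c[1, 2] * c[3, 4], c[1, 3] * c[2, 5], c[2, 3] * c[4, 5], c[1, 5] * c[2, 4], c[1, 4] * c[3, 5]},
  {c[1, 2] * c[3, 4], c[1, 5] * c[2, 3], c[2, 4] * c[3, 5], c[1, 4] * c[2, 5], c[1, 3] * c[4, 5]}}

/-- Six sets of ten 4-cycles; the points `1, 2, 3, 4, 5` are written as such in `Fin 5` (so that
`5` is the element `0`). -/
def fourCycleSets : Set (Set (Equiv.Perm (Fin 5))) := {
  {c[1, 2, 3, 4], c[1, 5, 2, 3], c[2, 4, 3, 5], c[2, 5, 3, 4], c[1, 2, 4, 5],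
    c[1, 5, 4, 2], c[1, 3, 5, 4], c[1, 4, 5, 3], c[1, 4, 3, 2], c[1, 3, 2, 5]},
  {c[1, 2, 3, 4], c[1, 2, 5, 3], c[2, 4, 5, 3], c[2, 3, 5, 4], c[1, 5, 2, 4],
    c[1, 4, 2, 5], c[1, 3, 4, 5], c[1, 5, 4, 3], c[1, 4, 3, 2], c[1, 3, 5, 2]},
  {c[1, 2, 3, 5], c[1, 2, 4, 3], c[1, 3, 4, 2], c[1, 3, 5, 4], c[1, 4, 2, 5],
    c[1, 4, 5, 3], c[1, 5, 2, 4], c[1, 5, 3, 2], c[2, 3, 4, 5], c[2, 5, 4, 3]},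
  {c[1, 5, 2, 3], c[2, 4, 5, 3], c[2, 3, 5, 4], c[1, 2, 4, 3], c[1, 4, 5, 2],
    c[1, 2, 5, 4], c[1, 5, 3, 4], c[1, 4, 3, 5], c[1, 3, 4, 2], c[1, 3, 2, 5]},
  {c[1, 5, 3, 2], c[2, 4, 3, 5], c[2, 5, 3, 4], c[1, 4, 5, 2], c[1, 2, 5, 4],
    c[1, 3, 4, 5], c[1, 3, 2, 4], c[1, 5, 4, 3], c[1, 4, 2, 3], c[1, 2, 3, 5]},
  {c[1, 2, 5, 3], c[2, 3, 4, 5], c[2, 5, 4, 3], c[1, 2, 4, 5], c[1, 5, 4, 2],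
    c[1, 5, 3, 4], c[1, 4, 3, 5], c[1, 3, 2, 4], c[1, 4, 2, 3], c[1, 3, 5, 2]}}

/-- The twelve 5-cycles `(1 a b c d)` for which `a b c d` is a permutation of `2 3 4 5` of sign
`ε`. -/
def fiveCycleSet (ε : ℤˣ) : Set (Equiv.Perm (Fin 5)) :=
  {a | ∃ σ : Equiv.Perm (Fin 5), σ 1 = 1 ∧ Equiv.Perm.sign σ = ε ∧
    a = [1, σ 2, σ 3, σ 4, σ 5].formPerm}

end NCGeom

/-! Completing the square turns flatness into combinatorics. Since `θ² = 0`, the curvature of `φ -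
θ` is `φ²`, and `φ²` vanishes in `Λ_quad` exactly when `φ ⊗ φ` is fixed by the braiding. In
coordinates this reads `φ(aba⁻¹) φ(a) = φ(a) φ(b)`. For coefficients in `{0,1}` it says that the
support of `φ` is closed under conjugation by its own elements (`mem_stratum_iff`). So `F_n` is the
set of `n`-element subsets of the class closed under `(a, b) ↦ aba⁻¹`.

These subsets are listed by a depth-first search on bit masks over a conjugation table. The search
is proved complete (`mem_search`) and its output is filtered for closedness, so the kernel's
evaluation of it for each of the six classes gives every stratum (`Enumeration.stratum_eq`).
Cardinalities, explicit descriptions and empty strata are then finite checks on lists of numbers.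

For the representations, `G` permutes `F_n`, and the sum of an invariant family in `F_n` is a
nonzero multiple of `θ`, because a class is a single orbit. Hence `V_n` is a quotient of the
sum-zero functions on `F_n`. If the action is 2-transitive these functions form an irreducible
representation, and the quotient map is nonzero, so it is an isomorphism (`nonempty_equiv_V`). This
covers the action on five points (`fund`), the exotic action on six points, where a transposition
has no fixed point and so has character `0 - 1`, and the action on two points through the sign.

The class of `(123)(45)` is different: its `F_2` is indexed by the ten edges of the complete graph
on five points, and this action is not 2-transitive. Edge weights split into constants, weights `c i
+ c j` with `∑ c i = 0`, which give `fund`, and weights with zero sum at every vertex. The last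
piece is five-dimensional and irreducible (`isIrreducible_balanced`) and has character `1` at a
transposition. -/

set_option linter.unusedSectionVars false

namespace NCGeom

/-! ### Flatness as closure of the support under conjugation -/

section Flatness

variable (k : Type*) [Field k] {G : Type*} [Group G] [Finite G]

/-- The linear functional `u ⊗ v ↦ u x * v y`, the coefficient of `e_x ⊗ e_y`. -/
noncomputable def coeff (C : ConjClasses G) (x y : C.carrier) :
    Lam1 k C ⊗[k] Lam1 k C →ₗ[k] k :=
  TensorProduct.lift ((LinearMap.mul k k).compl₁₂ (LinearMap.proj x) (LinearMap.proj y))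

theorem coeff_tmul (C : ConjClasses G) (x y : C.carrier) (u v : Lam1 k C) :
    coeff k C x y (u ⊗ₜ[k] v) = u x * v y := by
  simp [coeff]

theorem coeff_eq_repr (C : ConjClasses G) (x y : C.carrier) (t : Lam1 k C ⊗[k] Lam1 k C) :
    coeff k C x y t =
      ((Pi.basisFun k C.carrier).tensorProduct (Pi.basisFun k C.carrier)).repr t (x, y) := by
  induction t using TensorProduct.induction_on with
  | zero => simp
  | tmul u v => simp [coeff_tmul, mul_comm]
  | add s t hs ht => simp [hs, ht]

theorem ext_coeff (C : ConjClasses G) {s t : Lam1 k C ⊗[k] Lam1 k C}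
    (h : ∀ x y, coeff k C x y s = coeff k C x y t) : s = t := by
  refine ((Pi.basisFun k C.carrier).tensorProduct (Pi.basisFun k C.carrier)).ext_elem ?_
  rintro ⟨x, y⟩
  simpa [coeff_eq_repr] using h x y

/-- The braiding permutes the basis tensors along the bijection `(y, b) ↦ (yby⁻¹, y)`, so it
permutes coefficients in the same way. -/
theorem coeff_braiding (C : ConjClasses G) (y b : C.carrier) (u v : Lam1 k C) :
    coeff k C (conjBy C y b) y (braiding k C (u ⊗ₜ[k] v)) = u y * v b := by
  classical
  have h : coeff k C (conjBy C y b) y ∘ₗ braiding k C = coeff k C y b := by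
    refine ((Pi.basisFun k C.carrier).tensorProduct (Pi.basisFun k C.carrier)).ext ?_
    rintro ⟨a, c⟩
    rw [basisFun_tensorProduct_apply, LinearMap.comp_apply, braiding_e_tmul_e, coeff_tmul,
      coeff_tmul]
    by_cases hy : y = a
    · subst hy
      have : conjBy C y b = conjBy C y c ↔ b = c := (conjBy_injective C y).eq_iff
      simp [e, Pi.single_apply, this]
    · simp [e, Pi.single_apply, hy]
  rw [← coeff_tmul, ← h]
  rfl

theorem braiding_tmul_self_iff (C : ConjClasses G) (φ : Lam1 k C) :
    braiding k C (φ ⊗ₜ[k] φ) = φ ⊗ₜ[k] φ ↔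
      ∀ a b : C.carrier, φ (conjBy C a b) * φ a = φ a * φ b := by
  constructor
  · intro h a b
    have := coeff_braiding k C a b φ φ
    rwa [h, coeff_tmul] at this
  · intro h
    refine ext_coeff k C fun x y => ?_
    obtain ⟨b, rfl⟩ : ∃ b, conjBy C y b = x := ⟨conjBy C (y : G)⁻¹ x, conjBy_inv_apply C _ _⟩
    rw [coeff_braiding, coeff_tmul, h]

/-- The space `k ⊕ Λ¹ ⊕ Λ¹ ⊗ Λ¹`, on which `Λ_quad` acts with the relations of degree two acting
faithfully. -/
abbrev TriSpace (C : ConjClasses G) : Type _ := k × Lam1 k C × (Lam1 k C ⊗[k] Lam1 k C)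

/-- The operator `(c, x, t) ↦ (0, c • v, (id - Ψ) (v ⊗ x))`. -/
noncomputable def triOp (C : ConjClasses G) : Lam1 k C →ₗ[k] Module.End k (TriSpace k C) where
  toFun v := LinearMap.prod 0 (LinearMap.prod
    ((LinearMap.fst k _ _).smulRight v)
    ((LinearMap.id - braiding k C) ∘ₗ TensorProduct.mk k _ _ v ∘ₗ LinearMap.fst k _ _ ∘ₗ
      LinearMap.snd k _ _))
  map_add' u v := by
    refine LinearMap.ext fun p => ?_
    simp [smul_add]
    abel
  map_smul' c v := by
    refine LinearMap.ext fun p => ?_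
    simp [smul_comm c, smul_sub]

theorem triOp_apply (C : ConjClasses G) (v : Lam1 k C) (p : TriSpace k C) :
    triOp k C v p = (0, p.1 • v, v ⊗ₜ[k] p.2.1 - braiding k C (v ⊗ₜ[k] p.2.1)) := by
  simp [triOp]

/-- Each generator raises the degree by one, and the twist by `id - Ψ` sits in the second step only.
A degree-two element therefore acts through `(id - Ψ) t`: the relations act as zero and every other
degree-two tensor acts nontrivially. -/
theorem lift_triOp_tensorMul (C : ConjClasses G) (t : Lam1 k C ⊗[k] Lam1 k C)
    (p : TriSpace k C) :
    TensorAlgebra.lift k (triOp k C) (tensorMul k C t) p =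
      (0, 0, p.1 • (t - braiding k C t)) := by
  induction t using TensorProduct.induction_on with
  | zero => simp [Prod.ext_iff]
  | tmul u v => simp [triOp_apply, smul_sub]
  | add s t hs ht =>
    simp only [map_add, LinearMap.add_apply, hs, ht, Prod.mk_add_mk, add_zero, ← smul_add]
    congr 3
    abel

/-- The representation of `Λ_quad` on `k ⊕ Λ¹ ⊕ Λ¹ ⊗ Λ¹`. -/
noncomputable def triRep (C : ConjClasses G) : LamQuad k C →ₐ[k] Module.End k (TriSpace k C) :=
  RingQuot.liftAlgHom k ⟨TensorAlgebra.lift k (triOp k C), by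
    rintro x y ⟨t, ht, rfl, rfl⟩
    have ht' : t - braiding k C t = 0 := by simpa using ht
    refine LinearMap.ext fun p => ?_
    rw [lift_triOp_tensorMul, ht']
    simp⟩

/-- The nontrivial direction says that the two-sided ideal contains nothing in degree two beyond
`ker (id - Ψ)`. Applying `triRep` to the vector `(1, 0, 0)` recovers `t - Ψ t`, which must then
vanish. -/
theorem mkAlgHom_tensorMul_eq_zero_iff (C : ConjClasses G) (t : Lam1 k C ⊗[k] Lam1 k C) :
    RingQuot.mkAlgHom k (QuadRel k C) (tensorMul k C t) = 0 ↔ braiding k C t = t := by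
  constructor
  · intro h
    have h1 := congrArg (triRep k C) h
    rw [triRep, RingQuot.liftAlgHom_mkAlgHom_apply, map_zero] at h1
    have h2 := LinearMap.congr_fun h1 (1, 0, 0)
    rw [lift_triOp_tensorMul] at h2
    have h3 : t - braiding k C t = 0 := by simpa using h2
    exact (sub_eq_zero.1 h3).symm
  · intro h
    rw [← map_zero (RingQuot.mkAlgHom k (QuadRel k C))]
    exact RingQuot.mkAlgHom_rel k ⟨t, by simp [h], rfl, rfl⟩

theorem incl_mul_self_eq_zero_iff (C : ConjClasses G) (φ : Lam1 k C) :
    incl k C φ * incl k C φ = 0 ↔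
      ∀ a b : C.carrier, φ (conjBy C a b) * φ a = φ a * φ b := by
  rw [← braiding_tmul_self_iff, ← mkAlgHom_tensorMul_eq_zero_iff]
  simp [incl]

/-- With `α = φ - θ`, expanding `(α + θ)²` gives `F(α) + θ²`, and `θ² = 0` because `θ` has constant
coefficients. -/
theorem curvature_sub_theta (C : ConjClasses G) (φ : Lam1 k C) :
    curvature k C (φ - theta k C) = incl k C φ * incl k C φ := by
  have h : incl k C (theta k C) * incl k C (theta k C) = 0 := by
    rw [incl_mul_self_eq_zero_iff]
    simp [theta, formOn]
  rw [curvature, extD, map_sub]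
  simp only [mul_sub, sub_mul, h]
  abel

variable {k}

/-- The equation for `φ² = 0` asks that `b` lie in the support if and only if `aba⁻¹` does, for
every `a` in the support. One implication suffices: conjugation by `a` is injective and the support
is finite, so a self-map of it is onto. -/
theorem mem_stratum_iff (C : ConjClasses G) (n : ℕ) (φ : Lam1 k C) :
    φ ∈ stratum k C n ↔ (∀ a, φ a = 0 ∨ φ a = 1) ∧
      (∀ a b : C.carrier, φ a ≠ 0 → φ b ≠ 0 → φ (conjBy C a b) ≠ 0) ∧
      {a | φ a ≠ 0}.ncard = n := by
  refine and_congr_right fun h01 => and_congr_left fun _ => ?_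
  rw [curvature_sub_theta, incl_mul_self_eq_zero_iff]
  constructor
  · intro h a b ha hb hab
    have := h a b
    rw [hab, zero_mul] at this
    exact mul_ne_zero ha hb this.symm
  · intro h a b
    rw [mul_comm]
    rcases eq_or_ne (φ a) 0 with ha | ha
    · simp [ha]
    congr 1
    have hmaps : Set.MapsTo (conjBy C (a : G)) {b | φ b ≠ 0} {b | φ b ≠ 0} :=
      fun b hb => h a b ha hb
    have hsurj := ((Set.toFinite {b | φ b ≠ 0}).injOn_iff_bijOn_of_mapsTo hmaps).1
      (conjBy_injective C (a : G)).injOn |>.surjOn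
    have hiff : φ (conjBy C a b) ≠ 0 ↔ φ b ≠ 0 := by
      refine ⟨fun hb => ?_, fun hb => h a b ha hb⟩
      obtain ⟨c, hc, hcb⟩ := hsurj hb
      rwa [← conjBy_injective C _ hcb]
    rcases h01 b with hb | hb <;> rcases h01 (conjBy C a b) with hc | hc <;>
      simp [hb, hc] at hiff ⊢

theorem formOn_apply (C : ConjClasses G) (S : Set G) [DecidablePred (· ∈ S)] (a : C.carrier) :
    formOn k C S a = if (a : G) ∈ S then 1 else 0 := by
  simp [formOn, Set.indicator_apply]

theorem theta_sub_formOn (C : ConjClasses G) (S : Set G) : theta k C - formOn k C S = formOn k C Sᶜ := by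
  classical
  ext a
  rw [Pi.sub_apply, theta, formOn_apply, formOn_apply, formOn_apply]
  by_cases h : (a : G) ∈ S <;> simp [h]

theorem stratum_zero (C : ConjClasses G) : stratum k C 0 = {0} := by
  ext φ
  rw [mem_stratum_iff, Set.ncard_eq_zero, Set.mem_singleton_iff]
  constructor
  · rintro ⟨-, -, h⟩
    ext a
    by_contra ha
    exact (h ▸ ha : a ∈ (∅ : Set C.carrier))
  · rintro rfl
    simp

theorem stratum_one (C : ConjClasses G) :
    stratum k C 1 = {φ | ∃ a ∈ C.carrier, φ = formOn k C {a}} := by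
  classical
  ext φ
  rw [mem_stratum_iff, Set.ncard_eq_one]
  constructor
  · rintro ⟨h01, -, a, ha⟩
    refine ⟨a, a.2, ?_⟩
    ext b
    have hb : φ b ≠ 0 ↔ b = a := by
      change b ∈ {a | φ a ≠ 0} ↔ _
      rw [ha, Set.mem_singleton_iff]
    simp only [formOn_apply, Set.mem_singleton_iff, Subtype.coe_inj]
    rcases h01 b with h | h <;> simp_all
  · rintro ⟨a, ha, rfl⟩
    refine ⟨fun b => ?_, fun b c hb hc => ?_, ⟨a, ha⟩, ?_⟩
    · rw [formOn_apply]
      split_ifs <;> simp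
    · simp only [formOn_apply, Set.mem_singleton_iff, ne_eq, ite_eq_right_iff, one_ne_zero,
        imp_false, not_not, conjBy_coe] at *
      rw [hb, hc]
      group
    · ext b
      simp [formOn_apply, Subtype.ext_iff]

theorem stratum_card (C : ConjClasses G) : stratum k C (Nat.card C.carrier) = {theta k C} := by
  ext φ
  rw [mem_stratum_iff, Set.mem_singleton_iff]
  constructor
  · rintro ⟨h01, -, h⟩
    have huniv := Set.eq_of_subset_of_ncard_le (Set.subset_univ {a | φ a ≠ 0})
      (by rw [h, Set.ncard_univ])
    ext a
    have ha : a ∈ {a | φ a ≠ 0} := huniv ▸ Set.mem_univ a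
    simpa [theta, formOn] using (h01 a).resolve_left ha
  · rintro rfl
    simp [theta, formOn, Set.ncard_univ]

end Flatness

end NCGeom

namespace NCGeom

/-! ### A complete search for the closed sets of a table -/

section Search

/-- Function application, evaluating the argument first. -/
def evalArg {α : Sort*} (n : ℕ) (f : ℕ → α) : α :=
  Nat.rec (f 0) (fun m _ => f (m + 1)) n

theorem evalArg_eq {α : Sort*} (n : ℕ) (f : ℕ → α) : evalArg n f = f n := by
  cases n <;> rfl

/-- The entry in row `i` and column `j` of a table. -/
def entry (tab : List (List ℕ)) (i j : ℕ) : ℕ := (tab.getD i []).getD j 0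

/-- Closing the set (bit mask) `S` under the rows `gens` of a table, starting with the elements
`todo` still to be inserted. The result is `none` if an element larger than `r` is met. -/
def closeUp (tab : List (List ℕ)) (r : ℕ) (gens : List ℕ) : ℕ → List ℕ → ℕ → Option ℕ
  | 0, _, S => some S
  | _ + 1, [], S => some S
  | fuel + 1, y :: todo, S =>
    -- The recursor makes the kernel reduce `y` to a numeral before the continuation duplicates it;
    -- the same device is used for the mask below.
    evalArg y fun y =>
      if S.testBit y then closeUp tab r gens fuel todo S
      else if r < y then none
      else evalArg (S ||| 1 <<< y) fun S' =>
        closeUp tab r gens fuel (gens.map (fun g => entry tab g y) ++ todo) S'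

/-- Depth-first search for the closed sets containing `S` and contained in `S ∪ {0, …, r - 1}`. -/
def search (tab : List (List ℕ)) : (r : ℕ) → (S : ℕ) → (gens : List ℕ) → List ℕ
  | 0, S, _ => [S]
  | r + 1, S, gens =>
    if S.testBit r then search tab r S gens
    else search tab r S gens ++
      -- The initial list has at most `tab.length` entries and each of the at most `tab.length`
      -- insertions adds `gens.length + 1` more, so this fuel is ample. Correctness does not depend
      -- on it: `closeUp` only prunes, and closedness is tested at the end.
      match closeUp tab r (r :: gens) (tab.length * (gens.length + 3))
        (((List.range tab.length).filter S.testBit).map (entry tab r))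
        (S ||| 1 <<< r) with
      | none => []
      | some S' => search tab r S' (r :: gens)

/-- A set (bit mask) of row numbers is closed under the operation given by a table. -/
def ClosedMask (tab : List (List ℕ)) (S : ℕ) : Prop :=
  S < 2 ^ tab.length ∧ ∀ i < tab.length, S.testBit i = true → ∀ j < tab.length,
    S.testBit j = true → S.testBit (entry tab i j) = true

instance (tab : List (List ℕ)) : DecidablePred (ClosedMask tab) := fun _ => by
  unfold ClosedMask
  infer_instance

/-- The list of all sets (bit masks) closed under the operation given by a table. -/
def closedMasks (tab : List (List ℕ)) : List ℕ :=
  (search tab tab.length 0 []).filter (ClosedMask tab ·)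

variable {tab : List (List ℕ)} {T : ℕ}

theorem ClosedMask.lt_length (hT : ClosedMask tab T) {i : ℕ} (hi : T.testBit i = true) :
    i < tab.length := by
  by_contra h
  rw [Nat.testBit_lt_two_pow
    (hT.1.trans_le (Nat.pow_le_pow_right two_pos (not_lt.1 h)))] at hi
  exact Bool.false_ne_true hi

theorem ClosedMask.testBit_entry (hT : ClosedMask tab T) {i j : ℕ} (hi : T.testBit i = true)
    (hj : T.testBit j = true) : T.testBit (entry tab i j) = true :=
  hT.2 i (hT.lt_length hi) hi j (hT.lt_length hj) hj

theorem testBit_or_shiftLeft_iff (S y i : ℕ) :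
    (S ||| 1 <<< y).testBit i = true ↔ S.testBit i = true ∨ i = y := by
  rw [Nat.testBit_or, Bool.or_eq_true, Nat.one_shiftLeft, Nat.testBit_two_pow, decide_eq_true_iff,
    eq_comm (a := y)]

/-- Everything inserted is forced to lie in any closed `T` that contains the starting data. A
failure would exhibit an element of `T` above `r` missing from `S`, against `hr`. That the result
lies between `S` and `T` is all the search needs; it is not claimed to be closed. -/
theorem closeUp_sound (hT : ClosedMask tab T) {r : ℕ} {gens : List ℕ}
    (hg : ∀ g ∈ gens, T.testBit g = true) (fuel : ℕ) (todo : List ℕ) (S : ℕ)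
    (hy : ∀ y ∈ todo, T.testBit y = true) (hS : ∀ i, S.testBit i = true → T.testBit i = true)
    (hr : ∀ i, r < i → T.testBit i = true → S.testBit i = true) :
    ∃ S', closeUp tab r gens fuel todo S = some S' ∧
      (∀ i, S.testBit i = true → S'.testBit i = true) ∧
      (∀ i, S'.testBit i = true → T.testBit i = true) := by
  induction fuel generalizing todo S with
  | zero => exact ⟨S, rfl, fun _ h => h, hS⟩
  | succ fuel ih =>
    cases todo with
    | nil => exact ⟨S, rfl, fun _ h => h, hS⟩
    | cons y todo =>
      rw [List.forall_mem_cons] at hy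
      simp only [closeUp, evalArg_eq]
      split_ifs with h1 h2
      · exact ih todo S hy.2 hS hr
      · exact absurd (hr y h2 hy.1) h1
      · have hy' : ∀ z ∈ gens.map (fun g => entry tab g y) ++ todo, T.testBit z = true := by
          simp only [List.mem_append, List.mem_map]
          rintro _ (⟨g, hgm, rfl⟩ | hz)
          · exact hT.testBit_entry (hg g hgm) hy.1
          · exact hy.2 _ hz
        have hS' : ∀ i, (S ||| 1 <<< y).testBit i = true → T.testBit i = true := by
          intro i hi
          rcases (testBit_or_shiftLeft_iff S y i).1 hi with h | rfl
          · exact hS i h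
          · exact hy.1
        obtain ⟨S', h, hSS', hST⟩ := ih _ _ hy' hS' fun i hi hTi =>
          (testBit_or_shiftLeft_iff S y i).2 (.inl (hr i hi hTi))
        exact ⟨S', h, fun i hi => hSS' i ((testBit_or_shiftLeft_iff S y i).2 (.inl hi)), hST⟩

/-- The invariant is that `S ⊆ T` and that the two agree from index `r` upwards. Whether `r` belongs
to `T` selects the branch that keeps the invariant, and at `r = 0` it forces `S = T`. -/
theorem mem_search (hT : ClosedMask tab T) (r S : ℕ) (gens : List ℕ)
    (hg : ∀ g ∈ gens, T.testBit g = true) (hS : ∀ i, S.testBit i = true → T.testBit i = true)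
    (hr : ∀ i, r ≤ i → T.testBit i = true → S.testBit i = true) :
    T ∈ search tab r S gens := by
  induction r generalizing S gens with
  | zero =>
    rw [search, List.mem_singleton]
    refine Nat.eq_of_testBit_eq fun i => ?_
    rw [Bool.eq_iff_iff]
    exact ⟨hr i (Nat.zero_le i), hS i⟩
  | succ r ih =>
    rw [search]
    have hr' : S.testBit r = T.testBit r → ∀ i, r ≤ i → T.testBit i = true →
        S.testBit i = true := fun h i hi hTi => by
      rcases hi.eq_or_lt with rfl | hi
      · rwa [h]
      · exact hr i hi hTi
    split_ifs with h1
    · exact ih S gens hg hS (hr' (by rw [h1, hS r h1]))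
    · rw [List.mem_append]
      by_cases h2 : T.testBit r = true
      · right
        have hy : ∀ y ∈ ((List.range tab.length).filter S.testBit).map (entry tab r),
            T.testBit y = true := by
          intro y hy
          simp only [List.mem_map, List.mem_filter] at hy
          obtain ⟨j, ⟨-, hj⟩, rfl⟩ := hy
          exact hT.testBit_entry h2 (hS j hj)
        have hST : ∀ i, (S ||| 1 <<< r).testBit i = true → T.testBit i = true := by
          intro i hi
          rcases (testBit_or_shiftLeft_iff S r i).1 hi with h | rfl
          · exact hS i h
          · exact h2
        have hg' : ∀ g ∈ r :: gens, T.testBit g = true := List.forall_mem_cons.2 ⟨h2, hg⟩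
        obtain ⟨S', h, hSS', hS'⟩ := closeUp_sound hT hg' (tab.length * (gens.length + 3)) _ _ hy
          hST fun i hi hTi => (testBit_or_shiftLeft_iff S r i).2 (.inl (hr i hi hTi))
        rw [h]
        refine ih S' _ hg' hS' fun i hi hTi => hSS' i ?_
        rw [testBit_or_shiftLeft_iff]
        rcases hi.eq_or_lt with rfl | hi
        · exact .inr rfl
        · exact .inl (hr i hi hTi)
      · left
        exact ih S gens hg hS (hr' (by rw [Bool.not_eq_true] at h1 h2; rw [h1, h2]))

/-- Completeness comes from the search, correctness from the filter. -/
theorem mem_closedMasks_iff : T ∈ closedMasks tab ↔ ClosedMask tab T := by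
  rw [closedMasks, List.mem_filter, decide_eq_true_iff, and_iff_right_iff_imp]
  refine fun hT => mem_search hT _ _ _ (by simp) (by simp) fun i hi hTi => ?_
  exact absurd (hT.lt_length hTi) (not_lt.2 hi)

end Search

end NCGeom

namespace NCGeom

/-! ### From closed bit masks to strata -/

section Masks

variable {G : Type*} [Group G]

/-- `tab` is the table of the conjugation action of the elements of the list `els` on the list:
the entry in row `a` and column `b` is the index of `a b a⁻¹`. -/
def IsConjTable (els : List G) (tab : List (List ℕ)) : Prop :=
  tab.length = els.length ∧ ∀ i < els.length, ∀ j < els.length, entry tab i j < els.length ∧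
    els.getD (entry tab i j) 1 * els.getD i 1 = els.getD i 1 * els.getD j 1

instance [DecidableEq G] (els : List G) (tab : List (List ℕ)) : Decidable (IsConjTable els tab) := by
  unfold IsConjTable
  infer_instance

/-- The bit mask of the elements of a list that satisfy `p`. -/
def maskOf {α : Type*} (p : α → Bool) : List α → ℕ
  | [] => 0
  | a :: l => 2 * maskOf p l + (p a).toNat

theorem testBit_maskOf {α : Type*} (p : α → Bool) (l : List α) (i : ℕ) (h : i < l.length) :
    (maskOf p l).testBit i = p l[i] := by
  induction l generalizing i with
  | nil => simp at h
  | cons a l ih =>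
    cases i with
    | zero => cases h' : p a <;> simp [maskOf, h', Nat.testBit_zero]
    | succ i =>
      rw [List.length_cons, Nat.succ_lt_succ_iff] at h
      rw [List.getElem_cons_succ, ← ih i h, Nat.testBit_succ, maskOf]
      congr 1
      cases p a
      · simp
      · simp
        omega

theorem maskOf_lt {α : Type*} (p : α → Bool) (l : List α) : maskOf p l < 2 ^ l.length := by
  induction l with
  | nil => simp [maskOf]
  | cons a l ih =>
    rw [maskOf, List.length_cons, pow_succ]
    cases p a <;> simp <;> omega

/-- The number of elements among `0, …, n - 1` of a set (bit mask). -/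
def popCount (n x : ℕ) : ℕ := (List.range n).countP x.testBit

/-- The list `els` enumerates the conjugacy class `C`, its conjugation table is `tab`, and `masks`
is the list of all subsets of `C` closed under conjugation. -/
structure Enumeration (C : ConjClasses G) (els : List G) (tab : List (List ℕ))
    (masks : List ℕ) : Prop where
  nodup : els.Nodup
  mem_iff : ∀ g, g ∈ els ↔ g ∈ C.carrier
  isConjTable : IsConjTable els tab
  closedMasks_eq : closedMasks tab = masks

variable (k : Type*) [Field k] [DecidableEq G]

/-- The form `∑ e_a` over the elements `a` whose index in the list `els` belongs to the set (bit
mask) `x`. -/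
noncomputable def formMask (C : ConjClasses G) (els : List G) (x : ℕ) : Lam1 k C :=
  fun a => if x.testBit (els.idxOf (a : G)) then 1 else 0

namespace Enumeration

variable {C : ConjClasses G} {els : List G} {tab : List (List ℕ)} {masks : List ℕ}
  (D : Enumeration C els tab masks)

include D

theorem idxOf_lt (a : C.carrier) : els.idxOf (a : G) < els.length :=
  List.idxOf_lt_length_iff.2 ((D.mem_iff a).2 a.2)

/-- The element of the class with a given index. -/
def elem (i : ℕ) (h : i < els.length) : C.carrier := ⟨els[i], (D.mem_iff _).1 (els.getElem_mem h)⟩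

theorem idxOf_elem (i : ℕ) (h : i < els.length) : els.idxOf (D.elem i h : G) = i :=
  D.nodup.idxOf_getElem i h

theorem elem_idxOf (a : C.carrier) : D.elem (els.idxOf (a : G)) (D.idxOf_lt a) = a :=
  Subtype.ext (List.getElem_idxOf (D.idxOf_lt a))

theorem length_tab : tab.length = els.length := D.isConjTable.1

theorem natCard_carrier : Nat.card C.carrier = els.length := by
  have : C.carrier = (els.toFinset : Set G) := by
    ext g
    simp [D.mem_iff]
  rw [Nat.card_coe_set_eq, this, Set.ncard_coe_finset, List.toFinset_card_of_nodup D.nodup]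

theorem entry_idxOf (a b : C.carrier) :
    entry tab (els.idxOf (a : G)) (els.idxOf (b : G)) = els.idxOf (conjBy C a b : G) := by
  obtain ⟨h1, h2⟩ := D.isConjTable.2 _ (D.idxOf_lt a) _ (D.idxOf_lt b)
  rw [List.getD_eq_getElem _ _ h1, List.getD_eq_getElem _ _ (D.idxOf_lt a),
    List.getD_eq_getElem _ _ (D.idxOf_lt b), List.getElem_idxOf, List.getElem_idxOf] at h2
  rw [conjBy_coe, ← h2, mul_inv_cancel_right, D.nodup.idxOf_getElem]

theorem eq_of_testBit_eq {x y : ℕ} (hx : x < 2 ^ els.length) (hy : y < 2 ^ els.length)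
    (h : ∀ a : C.carrier, x.testBit (els.idxOf (a : G)) = y.testBit (els.idxOf (a : G))) :
    x = y := by
  refine Nat.eq_of_testBit_eq fun i => ?_
  by_cases hi : i < els.length
  · simpa only [D.idxOf_elem] using h (D.elem i hi)
  · have := Nat.pow_le_pow_right two_pos (not_lt.1 hi)
    rw [Nat.testBit_lt_two_pow (hx.trans_le this), Nat.testBit_lt_two_pow (hy.trans_le this)]

omit D in
theorem formMask_eq_zero_or_one (x : ℕ) (a : C.carrier) :
    formMask k C els x a = 0 ∨ formMask k C els x a = 1 := by
  unfold formMask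
  split_ifs <;> simp

omit D in
theorem formMask_ne_zero_iff (x : ℕ) (a : C.carrier) :
    formMask k C els x a ≠ 0 ↔ x.testBit (els.idxOf (a : G)) = true := by
  simp [formMask]

theorem formMask_inj {x y : ℕ} (hx : x < 2 ^ els.length) (hy : y < 2 ^ els.length) :
    formMask k C els x = formMask k C els y ↔ x = y := by
  refine ⟨fun h => D.eq_of_testBit_eq hx hy fun a => ?_, fun h => h ▸ rfl⟩
  rw [Bool.eq_iff_iff, ← formMask_ne_zero_iff k, ← formMask_ne_zero_iff k, h]

theorem testBit_maskOf_idxOf (p : G → Bool) (a : C.carrier) :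
    (maskOf p els).testBit (els.idxOf (a : G)) = p a := by
  rw [testBit_maskOf _ _ _ (D.idxOf_lt a), List.getElem_idxOf]

theorem closedMask_iff {x : ℕ} : ClosedMask tab x ↔ x < 2 ^ els.length ∧
    ∀ a b : C.carrier, x.testBit (els.idxOf (a : G)) = true →
      x.testBit (els.idxOf (b : G)) = true →
      x.testBit (els.idxOf (conjBy C a b : G)) = true := by
  rw [ClosedMask, D.length_tab]
  refine and_congr_right fun _ => ⟨fun h a b ha hb => ?_, fun h i hi hxi j hj hxj => ?_⟩
  · rw [← D.entry_idxOf]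
    exact h _ (D.idxOf_lt a) ha _ (D.idxOf_lt b) hb
  · have := h (D.elem i hi) (D.elem j hj)
    rw [← D.entry_idxOf, D.idxOf_elem, D.idxOf_elem] at this
    exact this hxi hxj

theorem ncard_formMask (x : ℕ) :
    {a | formMask k C els x a ≠ 0}.ncard = popCount els.length x := by
  have h : {a | formMask k C els x a ≠ 0}.ncard =
      (((List.range els.length).filter x.testBit).toFinset : Set ℕ).ncard := by
    refine Set.ncard_congr (fun a _ => els.idxOf (a : G)) ?_ ?_ ?_
    · intro a ha
      simpa [D.idxOf_lt a] using (formMask_ne_zero_iff k x a).1 ha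
    · intro a b _ _ hab
      rw [← D.elem_idxOf a, ← D.elem_idxOf b]
      congr 1
    · intro i hi
      simp only [List.coe_toFinset, List.mem_filter, List.mem_range, Set.mem_ofPred_eq] at hi
      refine ⟨D.elem i hi.1, ?_, D.idxOf_elem i hi.1⟩
      rw [Set.mem_ofPred_eq, formMask_ne_zero_iff, D.idxOf_elem]
      exact hi.2
  rw [h, Set.ncard_coe_finset, List.toFinset_card_of_nodup (List.nodup_range.filter _), popCount,
    List.countP_eq_length_filter]

variable [Finite G]

theorem formOn_eq_formMask (S : Set G) (p : G → Bool) (h : ∀ a ∈ els, p a = true ↔ a ∈ S) :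
    formOn k C S = formMask k C els (maskOf p els) := by
  classical
  ext a
  rw [formOn_apply, formMask, D.testBit_maskOf_idxOf]
  simp only [h a ((D.mem_iff a).2 a.2)]

/-- A form with coefficients in `{0,1}` is the same as its support, hence as a mask over `els`.
Under this dictionary the closure condition of `mem_stratum_iff` is `ClosedMask` and the size of the
support is `popCount`. -/
theorem stratum_eq (n : ℕ) : stratum k C n =
    formMask k C els '' ↑(masks.filter (popCount els.length · = n)).toFinset := by
  classical
  ext φ
  simp only [List.coe_toFinset, List.mem_filter, decide_eq_true_eq, ← D.closedMasks_eq,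
    mem_closedMasks_iff, D.closedMask_iff, mem_stratum_iff, Set.mem_image, Set.mem_ofPred_eq,
    ← D.ncard_formMask k, ← formMask_ne_zero_iff k]
  constructor
  · rintro ⟨h01, hcl, hn⟩
    let p : G → Bool := fun g => decide (∃ h : g ∈ C.carrier, φ ⟨g, h⟩ ≠ 0)
    have hp : formMask k C els (maskOf p els) = φ := by
      ext a
      rw [formMask, D.testBit_maskOf_idxOf]
      rcases h01 a with h | h <;> simp [p, h]
    exact ⟨maskOf p els, by rw [hp]; exact ⟨⟨maskOf_lt p els, hcl⟩, hn⟩, hp⟩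
  · rintro ⟨x, ⟨⟨-, hcl⟩, hn⟩, rfl⟩
    exact ⟨formMask_eq_zero_or_one k x, hcl, hn⟩

theorem lt_of_mem {x : ℕ} (hx : x ∈ masks) : x < 2 ^ els.length := by
  rw [← D.closedMasks_eq, mem_closedMasks_iff, ClosedMask, D.length_tab] at hx
  exact hx.1

theorem ncard_stratum (n : ℕ) : (stratum k C n).ncard =
    (masks.filter (popCount els.length · = n)).toFinset.card := by
  rw [D.stratum_eq k, Set.InjOn.ncard_image, Set.ncard_coe_finset]
  intro x hx y hy h
  simp only [List.coe_toFinset, List.mem_filter, Set.mem_ofPred_eq] at hx hy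
  exact (D.formMask_inj k (D.lt_of_mem hx.1) (D.lt_of_mem hy.1)).1 h

theorem stratum_eq_empty {l : List ℕ} (h : ∀ x ∈ masks, popCount els.length x ∈ l) {n : ℕ}
    (hn : n ∉ l) : stratum k C n = ∅ := by
  rw [D.stratum_eq k, Set.image_eq_empty, Finset.coe_eq_empty, List.toFinset_eq_empty_iff,
    List.filter_eq_nil_iff]
  intro x hx hxn
  exact hn (of_decide_eq_true hxn ▸ h x hx)

end Enumeration

end Masks

end NCGeom

/-! ### Enumeration of the six classes and of their closed subsets -/

namespace NCGeom

/-- The adjacent transpositions generate the symmetric group already as a monoid, so invariance need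
only be checked on these involutions. -/
theorem conj_mem_of_forall_swap {N : ℕ} {l : List (Equiv.Perm (Fin (N + 1)))}
    (h : ∀ i : Fin N, ∀ a ∈ l, Equiv.swap i.castSucc i.succ * a * Equiv.swap i.castSucc i.succ ∈ l)
    (g : Equiv.Perm (Fin (N + 1))) {a : Equiv.Perm (Fin (N + 1))} (ha : a ∈ l) :
    g * a * g⁻¹ ∈ l := by
  have hg : g ∈ Submonoid.closure
      (Set.range fun i : Fin N => Equiv.swap i.castSucc i.succ) := by
    rw [Equiv.Perm.mclosure_swap_castSucc_succ]
    trivial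
  induction hg using Submonoid.closure_induction generalizing a with
  | mem _ hx =>
    obtain ⟨i, rfl⟩ := hx
    rw [Equiv.swap_inv]
    exact h i a ha
  | one => simpa
  | mul x y _ _ hx hy =>
    have := hx (hy ha)
    rwa [mul_inv_rev, ← mul_assoc, mul_assoc x, mul_assoc x]

/-- The conjugators `cs` certify that `l` lies in the class; invariance under adjacent
transpositions certifies that `l` is all of it. Both are cheap to decide. -/
theorem mem_iff_mem_carrier {N : ℕ} {l cs : List (Equiv.Perm (Fin (N + 1)))}
    {g : Equiv.Perm (Fin (N + 1))} (hg : g ∈ l) (hcs : l = cs.map fun c => c * g * c⁻¹)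
    (h : ∀ i : Fin N, ∀ a ∈ l, Equiv.swap i.castSucc i.succ * a * Equiv.swap i.castSucc i.succ ∈ l)
    (a : Equiv.Perm (Fin (N + 1))) : a ∈ l ↔ a ∈ (ConjClasses.mk g).carrier := by
  rw [ConjClasses.mem_carrier_iff_mk_eq, ConjClasses.mk_eq_mk_iff_isConj]
  constructor
  · rw [hcs, List.mem_map]
    rintro ⟨c, -, rfl⟩
    exact (isConj_iff.2 ⟨c, rfl⟩).symm
  · intro ha
    obtain ⟨c, rfl⟩ := isConj_iff.1 ha.symm
    exact conj_mem_of_forall_swap h c hg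

/-- The transpositions in `S_5`. -/
def transpositions : List (Equiv.Perm (Fin 5)) := [
    c[1, 2], c[1, 3], c[1, 4], c[1, 5], c[2, 3], c[2, 4], c[2, 5], c[3, 4], c[3, 5], c[4, 5]]

/-- Permutations conjugating `(1, 2)` to the elements of `transpositions`. -/
def transpositionsConj : List (Equiv.Perm (Fin 5)) := [
    1, c[2, 3], c[2, 4], c[2, 5], c[1, 3], c[1, 4], c[1, 5], c[1, 3] * c[2, 4],
    c[1, 3] * c[2, 5], c[1, 4] * c[2, 5]]

/-- The conjugation table of `transpositions`. -/
def transpositionsTable : List (List ℕ) := [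
    [0, 4, 5, 6, 1, 2, 3, 7, 8, 9], [4, 1, 7, 8, 0, 5, 6, 2, 3, 9],
    [5, 7, 2, 9, 4, 0, 6, 1, 8, 3], [6, 8, 9, 3, 4, 5, 0, 7, 1, 2],
    [1, 0, 2, 3, 4, 7, 8, 5, 6, 9], [2, 1, 0, 3, 7, 5, 9, 4, 8, 6],
    [3, 1, 2, 0, 8, 9, 6, 7, 4, 5], [0, 2, 1, 3, 5, 4, 6, 7, 9, 8],
    [0, 3, 2, 1, 6, 5, 4, 9, 8, 7], [0, 1, 3, 2, 4, 6, 5, 8, 7, 9]]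

/-- The subsets of `transpositions` that are closed under conjugation. -/
def transpositionsMasks : List ℕ := [
    0, 1, 2, 4, 8, 16, 19, 20, 24, 32, 34, 37, 40, 64, 66, 68, 73, 128, 129, 134, 136, 176, 183,
    184, 192, 198, 201, 256, 257, 260, 266, 288, 293, 298, 336, 340, 347, 512, 513, 514, 524,
    528, 531, 540, 608, 610, 621, 896, 897, 910, 1008, 1023]

theorem enumeration_transpositions : Enumeration (ConjClasses.mk (c[1, 2])) transpositions
    transpositionsTable transpositionsMasks where
  nodup := by decide +kernel
  mem_iff := mem_iff_mem_carrier (cs := transpositionsConj) (by decide +kernel) (by decide +kernel)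
    (by decide +kernel)
  isConjTable := by decide +kernel
  -- This evaluates the whole search; the other fields validate the list and the table it runs on.
  closedMasks_eq := by decide +kernel

/-- The double transpositions in `S_5`. -/
def doubleTranspositions : List (Equiv.Perm (Fin 5)) := [
    c[1, 2] * c[3, 4], c[1, 2] * c[3, 5], c[1, 2] * c[4, 5], c[1, 3] * c[2, 4],
    c[1, 3] * c[2, 5], c[1, 3] * c[4, 5], c[1, 4] * c[2, 3], c[1, 4] * c[2, 5],
    c[1, 4] * c[3, 5], c[1, 5] * c[2, 3], c[1, 5] * c[2, 4], c[1, 5] * c[3, 4],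
    c[2, 3] * c[4, 5], c[2, 4] * c[3, 5], c[2, 5] * c[3, 4]]

/-- Permutations conjugating `(1, 2) * (3, 4)` to the elements of `doubleTranspositions`. -/
def doubleTranspositionsConj : List (Equiv.Perm (Fin 5)) := [
    1, c[4, 5], c[3, 5], c[1, 4], c[1, 5, 4], c[2, 3, 5], c[1, 3], c[1, 5, 3], c[2, 4, 5],
    c[2, 5, 4], c[2, 5, 3], c[2, 5], c[1, 3, 5], c[1, 4, 5], c[1, 5]]

/-- The conjugation table of `doubleTranspositions`. -/
def doubleTranspositionsTable : List (List ℕ) := [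
    [0, 2, 1, 3, 10, 13, 6, 9, 12, 7, 4, 14, 8, 5, 11],
    [2, 1, 0, 7, 4, 14, 10, 3, 13, 9, 6, 12, 11, 8, 5],
    [1, 0, 2, 9, 6, 12, 4, 7, 14, 3, 10, 13, 5, 11, 8],
    [0, 11, 14, 3, 5, 4, 6, 12, 9, 8, 13, 1, 7, 10, 2],
    [8, 1, 13, 5, 4, 3, 11, 14, 0, 9, 12, 6, 10, 2, 7],
    [9, 6, 12, 4, 3, 5, 1, 13, 8, 0, 14, 11, 2, 7, 10],
    [0, 14, 11, 3, 13, 10, 6, 8, 7, 12, 5, 2, 9, 4, 1],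
    [5, 12, 2, 11, 14, 0, 8, 7, 6, 13, 10, 3, 1, 9, 4],
    [10, 13, 3, 2, 12, 5, 7, 6, 8, 14, 0, 11, 4, 1, 9],
    [13, 1, 8, 14, 4, 7, 12, 5, 2, 9, 11, 10, 6, 0, 3],
    [12, 5, 2, 13, 8, 1, 14, 7, 4, 11, 10, 9, 0, 3, 6],
    [14, 7, 4, 12, 2, 5, 13, 1, 8, 10, 9, 11, 3, 6, 0],
    [4, 3, 5, 1, 0, 2, 9, 11, 10, 6, 8, 7, 12, 13, 14],
    [7, 8, 6, 10, 11, 9, 2, 0, 1, 5, 3, 4, 12, 13, 14],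
    [11, 10, 9, 8, 7, 6, 5, 4, 3, 2, 1, 0, 12, 13, 14]]

/-- The subsets of `doubleTranspositions` that are closed under conjugation. -/
def doubleTranspositionsMasks : List ℕ := [
    0, 1, 2, 4, 7, 8, 9, 16, 18, 32, 56, 64, 65, 72, 73, 128, 132, 256, 288, 448, 512, 514, 528,
    530, 1024, 1028, 1152, 1156, 2048, 2080, 2304, 2336, 3584, 4096, 4132, 4672, 5393, 6282,
    8192, 8450, 8865, 9224, 10324, 12288, 16384, 16528, 17164, 17506, 18433, 20480, 24576, 28672,
    32767]

theorem enumeration_doubleTranspositions : Enumeration (ConjClasses.mk (c[1, 2] * c[3, 4])) doubleTranspositions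
    doubleTranspositionsTable doubleTranspositionsMasks where
  nodup := by decide +kernel
  mem_iff := mem_iff_mem_carrier (cs := doubleTranspositionsConj) (by decide +kernel) (by decide +kernel)
    (by decide +kernel)
  isConjTable := by decide +kernel
  closedMasks_eq := by decide +kernel

/-- The 3-cycles in `S_5`. -/
def threeCycles : List (Equiv.Perm (Fin 5)) := [
    c[1, 2, 3], c[1, 2, 4], c[1, 2, 5], c[1, 3, 2], c[1, 3, 4], c[1, 3, 5], c[1, 4, 2],
    c[1, 4, 3], c[1, 4, 5], c[1, 5, 2], c[1, 5, 3], c[1, 5, 4], c[2, 3, 4], c[2, 3, 5],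
    c[2, 4, 3], c[2, 4, 5], c[2, 5, 3], c[2, 5, 4], c[3, 4, 5], c[3, 5, 4]]

/-- Permutations conjugating `(1, 2, 3)` to the elements of `threeCycles`. -/
def threeCyclesConj : List (Equiv.Perm (Fin 5)) := [
    1, c[3, 4], c[3, 5], c[1, 2], c[1, 4, 2], c[1, 5, 2], c[1, 4, 3], c[2, 4], c[2, 4] * c[3, 5],
    c[1, 5, 3], c[2, 5], c[2, 5] * c[3, 4], c[1, 4], c[1, 5], c[1, 2, 4], c[1, 5] * c[3, 4],
    c[1, 2, 5], c[1, 4] * c[3, 5], c[1, 4] * c[2, 5], c[1, 5] * c[2, 4]]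

/-- The conjugation table of `threeCycles`. -/
def threeCyclesTable : List (List ℕ) := [
    [0, 12, 13, 3, 6, 9, 14, 1, 15, 16, 2, 17, 7, 10, 4, 18, 5, 19, 8, 11],
    [14, 1, 15, 12, 0, 13, 6, 3, 9, 17, 16, 2, 7, 19, 4, 11, 18, 8, 10, 5],
    [16, 17, 2, 13, 12, 0, 15, 14, 1, 9, 3, 6, 18, 10, 19, 11, 5, 8, 4, 7],
    [0, 7, 10, 3, 14, 16, 4, 12, 18, 5, 13, 19, 1, 2, 6, 8, 9, 11, 15, 17],
    [14, 3, 16, 12, 4, 18, 0, 7, 10, 13, 19, 5, 1, 15, 6, 9, 17, 2, 11, 8],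
    [16, 14, 3, 13, 19, 5, 12, 18, 4, 0, 10, 7, 17, 2, 15, 1, 9, 6, 11, 8],
    [4, 1, 11, 7, 14, 19, 6, 12, 17, 8, 18, 15, 3, 5, 0, 2, 10, 9, 16, 13],
    [6, 12, 17, 1, 4, 11, 14, 7, 19, 15, 8, 18, 3, 9, 0, 13, 2, 16, 5, 10],
    [12, 17, 6, 14, 19, 7, 15, 18, 8, 1, 4, 11, 13, 0, 16, 2, 3, 9, 5, 10],
    [5, 8, 2, 10, 18, 16, 11, 19, 17, 9, 13, 15, 4, 3, 7, 6, 0, 1, 12, 14],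
    [9, 15, 13, 2, 8, 5, 17, 11, 19, 16, 10, 18, 6, 3, 1, 14, 0, 12, 7, 4],
    [13, 9, 15, 16, 10, 18, 2, 5, 8, 17, 19, 11, 0, 12, 3, 6, 14, 1, 7, 4],
    [4, 3, 5, 7, 6, 8, 0, 1, 2, 10, 11, 9, 12, 18, 14, 16, 19, 13, 17, 15],
    [5, 4, 3, 10, 11, 9, 7, 8, 6, 0, 2, 1, 19, 13, 18, 12, 16, 14, 17, 15],
    [6, 7, 8, 1, 0, 2, 4, 3, 5, 11, 9, 10, 12, 17, 14, 19, 15, 18, 13, 16],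
    [7, 8, 6, 4, 5, 3, 11, 10, 9, 1, 0, 2, 19, 14, 18, 15, 12, 17, 13, 16],
    [9, 11, 10, 2, 1, 0, 8, 6, 7, 5, 3, 4, 15, 13, 17, 19, 16, 18, 14, 12],
    [10, 9, 11, 5, 3, 4, 2, 0, 1, 8, 7, 6, 16, 18, 13, 15, 19, 17, 14, 12],
    [1, 2, 0, 6, 8, 7, 9, 11, 10, 3, 4, 5, 15, 14, 17, 16, 12, 13, 18, 19],
    [2, 0, 1, 9, 10, 11, 3, 5, 4, 6, 8, 7, 16, 17, 13, 12, 15, 14, 18, 19]]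

/-- The subsets of `threeCycles` that are closed under conjugation. -/
def threeCyclesMasks : List ℕ := [
    0, 1, 2, 4, 8, 9, 16, 32, 64, 66, 128, 144, 256, 512, 516, 1024, 1056, 2048, 2304, 4096,
    4234, 8192, 9228, 16384, 16465, 20480, 20699, 32768, 34884, 65536, 66081, 73728, 75309,
    131072, 131842, 163840, 166726, 262144, 264352, 417792, 524288, 525584, 626688, 786432,
    789936, 1044480, 1048575]

theorem enumeration_threeCycles : Enumeration (ConjClasses.mk (c[1, 2, 3])) threeCycles
    threeCyclesTable threeCyclesMasks where
  nodup := by decide +kernel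
  mem_iff := mem_iff_mem_carrier (cs := threeCyclesConj) (by decide +kernel) (by decide +kernel)
    (by decide +kernel)
  isConjTable := by decide +kernel
  closedMasks_eq := by decide +kernel

/-- The products of a 3-cycle and a disjoint 2-cycle in `S_5`. -/
def sixCycles : List (Equiv.Perm (Fin 5)) := [
    c[1, 2, 3] * c[4, 5], c[1, 2, 4] * c[3, 5], c[1, 2, 5] * c[3, 4], c[1, 3, 2] * c[4, 5],
    c[1, 3, 4] * c[2, 5], c[1, 3, 5] * c[2, 4], c[1, 4, 2] * c[3, 5], c[1, 4, 3] * c[2, 5],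
    c[1, 4, 5] * c[2, 3], c[1, 5, 2] * c[3, 4], c[1, 5, 3] * c[2, 4], c[1, 5, 4] * c[2, 3],
    c[2, 3, 4] * c[1, 5], c[2, 3, 5] * c[1, 4], c[2, 4, 3] * c[1, 5], c[2, 4, 5] * c[1, 3],
    c[2, 5, 3] * c[1, 4], c[2, 5, 4] * c[1, 3], c[3, 4, 5] * c[1, 2], c[3, 5, 4] * c[1, 2]]

/-- Permutations conjugating `(1, 2, 3) * (4, 5)` to the elements of `sixCycles`. -/
def sixCyclesConj : List (Equiv.Perm (Fin 5)) := [
    1, c[3, 4], c[3, 5], c[1, 2], c[1, 4, 2], c[1, 5, 2], c[1, 4, 3], c[2, 4], c[2, 4] * c[3, 5],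
    c[1, 5, 3], c[2, 5], c[2, 5] * c[3, 4], c[1, 4], c[1, 5], c[1, 2, 4], c[1, 5] * c[3, 4],
    c[1, 2, 5], c[1, 4] * c[3, 5], c[1, 4] * c[2, 5], c[1, 5] * c[2, 4]]

/-- The conjugation table of `sixCycles`. -/
def sixCyclesTable : List (List ℕ) := [
    [0, 13, 12, 3, 9, 6, 16, 2, 17, 14, 1, 15, 10, 7, 5, 19, 4, 18, 11, 8],
    [15, 1, 14, 17, 2, 16, 6, 9, 3, 12, 13, 0, 8, 18, 11, 4, 19, 7, 5, 10],
    [17, 16, 2, 15, 14, 1, 13, 12, 0, 9, 6, 3, 19, 11, 18, 10, 8, 5, 7, 4],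
    [0, 10, 7, 3, 16, 14, 5, 13, 19, 4, 12, 18, 2, 1, 9, 11, 6, 8, 17, 15],
    [19, 5, 13, 18, 4, 12, 10, 7, 0, 16, 14, 3, 11, 17, 8, 2, 15, 9, 1, 6],
    [18, 12, 4, 19, 13, 5, 14, 16, 3, 7, 10, 0, 15, 8, 17, 6, 11, 1, 9, 2],
    [11, 1, 4, 8, 15, 18, 6, 17, 12, 7, 19, 14, 9, 10, 2, 0, 5, 3, 13, 16],
    [8, 18, 15, 11, 4, 1, 19, 7, 14, 17, 6, 12, 5, 2, 10, 16, 9, 13, 3, 0],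
    [14, 19, 7, 12, 17, 6, 18, 15, 8, 4, 1, 11, 16, 3, 13, 5, 0, 10, 2, 9],
    [8, 5, 2, 11, 19, 17, 10, 18, 16, 9, 15, 13, 7, 6, 4, 3, 1, 0, 14, 12],
    [11, 17, 19, 8, 2, 5, 15, 9, 13, 18, 10, 16, 1, 4, 6, 12, 7, 14, 0, 3],
    [16, 10, 18, 13, 9, 15, 5, 2, 8, 19, 17, 11, 3, 14, 0, 7, 12, 4, 6, 1],
    [18, 16, 10, 19, 17, 11, 13, 15, 9, 5, 8, 2, 12, 4, 14, 3, 7, 0, 6, 1],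
    [19, 7, 14, 18, 8, 15, 4, 11, 1, 12, 17, 6, 5, 13, 10, 0, 16, 3, 2, 9],
    [17, 19, 11, 15, 13, 9, 18, 16, 10, 8, 2, 5, 12, 6, 14, 7, 1, 4, 0, 3],
    [4, 18, 12, 7, 10, 0, 19, 5, 13, 14, 3, 16, 11, 1, 8, 15, 6, 17, 9, 2],
    [15, 8, 18, 17, 6, 12, 11, 1, 4, 19, 14, 7, 9, 13, 2, 5, 16, 10, 3, 0],
    [5, 13, 19, 10, 0, 7, 16, 3, 14, 18, 4, 12, 2, 8, 9, 15, 11, 17, 1, 6],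
    [6, 9, 3, 1, 15, 14, 2, 17, 16, 0, 12, 13, 8, 7, 11, 10, 4, 5, 18, 19],
    [9, 3, 6, 2, 16, 17, 0, 13, 12, 1, 15, 14, 10, 11, 5, 4, 8, 7, 18, 19]]

/-- The subsets of `sixCycles` that are closed under conjugation. -/
def sixCyclesMasks : List ℕ := [
    0, 1, 2, 4, 8, 9, 16, 32, 64, 66, 128, 144, 256, 512, 516, 1024, 1056, 2048, 2304, 4096,
    8192, 16384, 20480, 32768, 65536, 73728, 131072, 163840, 262144, 524288, 786432, 1048575]

theorem enumeration_sixCycles : Enumeration (ConjClasses.mk (c[1, 2, 3] * c[4, 5])) sixCycles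
    sixCyclesTable sixCyclesMasks where
  nodup := by decide +kernel
  mem_iff := mem_iff_mem_carrier (cs := sixCyclesConj) (by decide +kernel) (by decide +kernel)
    (by decide +kernel)
  isConjTable := by decide +kernel
  closedMasks_eq := by decide +kernel

/-- The 4-cycles in `S_5`. -/
def fourCycles : List (Equiv.Perm (Fin 5)) := [
    c[1, 2, 3, 4], c[1, 2, 3, 5], c[1, 2, 4, 3], c[1, 2, 4, 5], c[1, 2, 5, 3], c[1, 2, 5, 4],
    c[1, 3, 2, 4], c[1, 3, 2, 5], c[1, 3, 4, 2], c[1, 3, 4, 5], c[1, 3, 5, 2], c[1, 3, 5, 4],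
    c[1, 4, 2, 3], c[1, 4, 2, 5], c[1, 4, 3, 2], c[1, 4, 3, 5], c[1, 4, 5, 2], c[1, 4, 5, 3],
    c[1, 5, 2, 3], c[1, 5, 2, 4], c[1, 5, 3, 2], c[1, 5, 3, 4], c[1, 5, 4, 2], c[1, 5, 4, 3],
    c[2, 3, 4, 5], c[2, 3, 5, 4], c[2, 4, 3, 5], c[2, 4, 5, 3], c[2, 5, 3, 4], c[2, 5, 4, 3]]

/-- Permutations conjugating `(1, 2, 3, 4)` to the elements of `fourCycles`. -/
def fourCyclesConj : List (Equiv.Perm (Fin 5)) := [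
    1, c[4, 5], c[3, 4], c[3, 4, 5], c[3, 5, 4], c[3, 5], c[2, 3], c[1, 3, 5, 4], c[1, 2],
    c[1, 5, 2], c[1, 2] * c[4, 5], c[2, 3, 5], c[1, 4], c[1, 2, 5, 3], c[1, 3], c[2, 4, 5],
    c[1, 5, 3], c[1, 4] * c[2, 5], c[1, 5, 4], c[2, 5, 3], c[2, 5, 4], c[2, 5],
    c[1, 2] * c[3, 5], c[1, 3, 5, 2], c[1, 5], c[1, 4, 5], c[1, 2, 4, 5], c[1, 3, 4, 5],
    c[1, 2, 5], c[1, 3, 5]]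

/-- The conjugation table of `fourCycles`. -/
def fourCyclesTable : List (List ℕ) := [
    [0, 24, 12, 18, 25, 1, 2, 26, 6, 19, 27, 3, 8, 10, 14, 16, 20, 22, 28, 4, 29, 5, 7, 13, 21, 9, 17, 23, 11, 15],
    [25, 1, 24, 0, 18, 12, 28, 4, 29, 5, 7, 13, 26, 2, 27, 3, 6, 19, 10, 8, 20, 22, 14, 16, 11, 15, 9, 21, 23, 17],
    [6, 19, 2, 26, 3, 27, 14, 16, 8, 10, 22, 20, 0, 24, 12, 18, 25, 1, 5, 29, 13, 7, 28, 4, 11, 21, 23, 15, 9, 17],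
    [26, 2, 27, 3, 6, 19, 24, 0, 25, 1, 12, 18, 29, 5, 28, 4, 13, 7, 14, 16, 8, 10, 22, 20, 15, 23, 17, 9, 11, 21],
    [13, 7, 5, 29, 4, 28, 22, 20, 16, 14, 10, 8, 3, 27, 19, 6, 26, 2, 1, 25, 18, 12, 24, 0, 15, 9, 11, 23, 17, 21],
    [4, 28, 7, 13, 29, 5, 1, 25, 18, 12, 24, 0, 20, 22, 10, 8, 16, 14, 27, 3, 26, 2, 19, 6, 17, 21, 9, 15, 23, 11],
    [8, 28, 0, 21, 24, 9, 6, 27, 14, 20, 29, 7, 12, 17, 2, 4, 23, 18, 25, 11, 26, 10, 15, 1, 22, 13, 5, 19, 16, 3],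
    [26, 10, 25, 11, 1, 15, 29, 7, 27, 6, 20, 14, 24, 9, 28, 8, 21, 0, 18, 23, 4, 2, 17, 12, 19, 16, 22, 5, 3, 13],
    [12, 17, 2, 4, 23, 18, 0, 21, 8, 28, 9, 24, 14, 20, 6, 27, 7, 29, 15, 1, 11, 25, 10, 26, 13, 16, 3, 5, 22, 19],
    [27, 6, 29, 7, 14, 20, 28, 8, 24, 9, 0, 21, 26, 10, 25, 11, 1, 15, 2, 4, 12, 17, 18, 23, 3, 19, 5, 13, 16, 22],
    [23, 18, 17, 12, 4, 2, 15, 1, 11, 25, 10, 26, 21, 0, 9, 24, 8, 28, 20, 14, 7, 29, 6, 27, 22, 19, 16, 13, 5, 3],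
    [7, 29, 20, 14, 27, 6, 10, 26, 1, 15, 25, 11, 4, 2, 18, 23, 12, 17, 28, 8, 24, 9, 0, 21, 13, 5, 22, 16, 3, 19],
    [2, 23, 14, 29, 15, 26, 6, 11, 0, 5, 21, 19, 12, 25, 8, 22, 28, 13, 17, 27, 9, 3, 24, 16, 4, 18, 20, 7, 1, 10],
    [27, 17, 24, 16, 9, 3, 26, 15, 29, 14, 23, 2, 28, 13, 25, 12, 22, 8, 21, 19, 11, 6, 5, 0, 20, 4, 18, 10, 7, 1],
    [0, 5, 6, 11, 19, 21, 8, 22, 12, 25, 13, 28, 2, 23, 14, 29, 15, 26, 3, 9, 16, 24, 17, 27, 1, 4, 7, 10, 18, 20],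
    [28, 13, 25, 12, 22, 8, 24, 16, 27, 17, 3, 9, 29, 14, 26, 15, 2, 23, 5, 0, 19, 21, 6, 11, 4, 7, 1, 18, 20, 10],
    [11, 6, 21, 19, 0, 5, 23, 2, 15, 26, 14, 29, 9, 3, 17, 27, 16, 24, 8, 22, 12, 25, 13, 28, 10, 7, 20, 18, 1, 4],
    [22, 8, 13, 28, 12, 25, 5, 0, 19, 21, 6, 11, 16, 24, 3, 9, 27, 17, 14, 29, 2, 23, 26, 15, 20, 10, 7, 4, 18, 1],
    [17, 4, 21, 28, 20, 27, 9, 7, 15, 13, 1, 3, 23, 29, 11, 5, 25, 22, 18, 24, 10, 16, 26, 19, 12, 2, 0, 8, 14, 6],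
    [23, 29, 11, 5, 25, 22, 21, 28, 17, 4, 27, 20, 15, 13, 9, 7, 3, 1, 26, 19, 24, 18, 16, 10, 2, 14, 6, 0, 12, 8],
    [3, 1, 13, 15, 7, 9, 16, 10, 19, 26, 18, 24, 5, 11, 22, 25, 23, 29, 4, 17, 20, 27, 21, 28, 2, 0, 12, 14, 6, 8],
    [19, 26, 16, 10, 24, 18, 22, 25, 5, 11, 29, 23, 3, 1, 13, 15, 7, 9, 27, 20, 28, 21, 4, 17, 6, 2, 14, 8, 0, 12],
    [7, 9, 1, 3, 15, 13, 4, 17, 20, 27, 21, 28, 10, 16, 18, 24, 19, 26, 11, 5, 23, 29, 22, 25, 6, 8, 0, 2, 14, 12],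
    [10, 16, 18, 24, 19, 26, 1, 3, 7, 9, 13, 15, 20, 27, 4, 17, 28, 21, 22, 25, 5, 11, 29, 23, 8, 14, 12, 0, 6, 2],
    [9, 8, 11, 10, 6, 7, 15, 14, 17, 16, 12, 13, 21, 20, 23, 22, 18, 19, 0, 1, 2, 3, 4, 5, 24, 28, 25, 26, 27, 29],
    [10, 11, 7, 6, 9, 8, 20, 21, 18, 19, 23, 22, 1, 0, 4, 5, 2, 3, 15, 14, 17, 16, 12, 13, 26, 25, 29, 27, 24, 28],
    [17, 16, 15, 14, 13, 12, 23, 22, 21, 20, 19, 18, 9, 8, 11, 10, 6, 7, 3, 2, 5, 4, 0, 1, 27, 24, 26, 29, 28, 25],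
    [13, 12, 16, 17, 14, 15, 3, 2, 5, 4, 0, 1, 22, 23, 19, 18, 21, 20, 8, 9, 6, 7, 11, 10, 28, 25, 24, 27, 29, 26],
    [22, 23, 19, 18, 21, 20, 16, 17, 13, 12, 15, 14, 5, 4, 3, 2, 1, 0, 11, 10, 9, 8, 7, 6, 25, 29, 26, 24, 28, 27],
    [18, 19, 20, 21, 22, 23, 4, 5, 1, 0, 3, 2, 10, 11, 7, 6, 9, 8, 16, 17, 13, 12, 15, 14, 24, 26, 27, 28, 25, 29]]

/-- The subsets of `fourCycles` that are closed under conjugation. -/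
def fourCyclesMasks : List ℕ := [
    0, 1, 2, 4, 8, 16, 32, 64, 128, 256, 260, 512, 1024, 1040, 2048, 4096, 4160, 8192, 16384,
    16385, 20805, 32768, 65536, 65568, 131072, 133120, 262144, 262272, 524288, 532480, 1048576,
    1048578, 1311890, 2097152, 2129920, 4194304, 4194312, 4792360, 8388608, 8389120, 10652160,
    16777216, 17836036, 21004368, 33554432, 34095632, 35717252, 67108864, 68162080, 71434369,
    134217728, 134512928, 142615553, 167772160, 170230180, 176711185, 268435456, 268716040,
    276889666, 335544320, 340150409, 345051746, 536870912, 537526530, 538973192, 553648128,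
    555362566, 559977560, 1056964608, 1073741823]

theorem enumeration_fourCycles : Enumeration (ConjClasses.mk (c[1, 2, 3, 4])) fourCycles
    fourCyclesTable fourCyclesMasks where
  nodup := by decide +kernel
  mem_iff := mem_iff_mem_carrier (cs := fourCyclesConj) (by decide +kernel) (by decide +kernel)
    (by decide +kernel)
  isConjTable := by decide +kernel
  closedMasks_eq := by decide +kernel

/-- The 5-cycles in `S_5`. -/
def fiveCycles : List (Equiv.Perm (Fin 5)) := [
    c[1, 2, 3, 4, 5], c[1, 2, 3, 5, 4], c[1, 2, 4, 3, 5], c[1, 2, 4, 5, 3], c[1, 2, 5, 3, 4],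
    c[1, 2, 5, 4, 3], c[1, 3, 2, 4, 5], c[1, 3, 2, 5, 4], c[1, 3, 4, 2, 5], c[1, 3, 4, 5, 2],
    c[1, 3, 5, 2, 4], c[1, 3, 5, 4, 2], c[1, 4, 2, 3, 5], c[1, 4, 2, 5, 3], c[1, 4, 3, 2, 5],
    c[1, 4, 3, 5, 2], c[1, 4, 5, 2, 3], c[1, 4, 5, 3, 2], c[1, 5, 2, 3, 4], c[1, 5, 2, 4, 3],
    c[1, 5, 3, 2, 4], c[1, 5, 3, 4, 2], c[1, 5, 4, 2, 3], c[1, 5, 4, 3, 2]]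

/-- Permutations conjugating `(1, 2, 3, 4, 5)` to the elements of `fiveCycles`. -/
def fiveCyclesConj : List (Equiv.Perm (Fin 5)) := [
    1, c[4, 5], c[3, 4], c[1, 3, 2], c[1, 2, 5], c[3, 5], c[2, 3], c[1, 3, 5], c[1, 5, 2],
    c[1, 2], c[1, 2, 4, 3], c[1, 4, 3], c[1, 4, 5], c[1, 2, 5, 4], c[2, 4], c[1, 5, 3],
    c[1, 2, 3], c[1, 3], c[1, 5], c[1, 2, 4], c[1, 3, 4], c[2, 5], c[1, 4], c[1, 2] * c[3, 5]]

/-- The conjugation table of `fiveCycles`. -/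
def fiveCyclesTable : List (List ℕ) := [
    [0, 18, 1, 12, 16, 22, 2, 19, 3, 6, 10, 20, 4, 13, 5, 7, 8, 14, 9, 11, 15, 17, 21, 23],
    [12, 1, 22, 16, 0, 18, 13, 4, 8, 14, 5, 7, 11, 9, 21, 23, 15, 17, 2, 19, 3, 6, 10, 20],
    [3, 6, 2, 19, 20, 10, 5, 7, 4, 13, 14, 8, 0, 18, 1, 12, 16, 22, 17, 15, 23, 21, 9, 11],
    [20, 10, 6, 3, 19, 2, 17, 15, 23, 21, 9, 11, 7, 5, 14, 8, 4, 13, 18, 0, 16, 22, 1, 12],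
    [7, 5, 14, 8, 4, 13, 6, 3, 20, 10, 2, 19, 23, 21, 17, 15, 11, 9, 1, 12, 0, 18, 22, 16],
    [8, 14, 13, 4, 7, 5, 21, 23, 11, 9, 17, 15, 12, 1, 22, 16, 0, 18, 6, 3, 20, 10, 2, 19],
    [8, 21, 9, 0, 4, 18, 6, 20, 7, 14, 17, 23, 11, 1, 10, 15, 12, 2, 13, 16, 3, 5, 22, 19],
    [15, 10, 2, 12, 11, 1, 14, 7, 23, 17, 6, 20, 19, 22, 5, 3, 16, 13, 9, 0, 8, 21, 18, 4],
    [11, 1, 10, 15, 12, 2, 9, 0, 8, 21, 18, 4, 7, 14, 6, 20, 23, 17, 22, 19, 16, 13, 5, 3],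
    [16, 13, 22, 19, 3, 5, 18, 4, 0, 9, 21, 8, 12, 2, 1, 11, 15, 10, 17, 23, 20, 6, 14, 7],
    [0, 9, 18, 4, 8, 21, 1, 11, 12, 2, 10, 15, 16, 13, 22, 19, 3, 5, 6, 20, 7, 14, 17, 23],
    [19, 22, 5, 3, 16, 13, 2, 12, 15, 10, 1, 11, 23, 17, 14, 7, 20, 6, 18, 4, 0, 9, 21, 8],
    [15, 2, 14, 23, 19, 5, 17, 3, 16, 9, 6, 0, 12, 22, 13, 8, 11, 21, 10, 7, 20, 18, 1, 4],
    [0, 6, 9, 16, 3, 17, 18, 20, 4, 1, 10, 7, 8, 13, 21, 11, 12, 22, 2, 15, 19, 5, 14, 23],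
    [16, 9, 17, 3, 0, 6, 13, 8, 12, 22, 21, 11, 15, 2, 14, 23, 19, 5, 18, 20, 4, 1, 10, 7],
    [20, 18, 10, 7, 4, 1, 6, 0, 3, 17, 9, 16, 19, 5, 2, 15, 23, 14, 21, 11, 8, 13, 22, 12],
    [19, 5, 2, 15, 23, 14, 10, 7, 20, 18, 1, 4, 3, 17, 6, 0, 16, 9, 22, 12, 11, 21, 13, 8],
    [4, 1, 18, 20, 7, 10, 21, 11, 8, 13, 22, 12, 0, 6, 9, 16, 3, 17, 5, 19, 23, 14, 2, 15],
    [4, 21, 13, 3, 20, 17, 5, 23, 7, 1, 22, 11, 8, 6, 14, 12, 0, 2, 18, 16, 19, 10, 9, 15],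
    [7, 1, 5, 23, 11, 22, 14, 12, 8, 6, 2, 0, 4, 21, 13, 3, 20, 17, 10, 19, 15, 9, 18, 16],
    [11, 22, 1, 7, 23, 5, 10, 19, 15, 9, 18, 16, 12, 14, 2, 0, 8, 6, 21, 4, 20, 17, 13, 3],
    [12, 14, 2, 0, 8, 6, 1, 7, 11, 22, 5, 23, 15, 9, 10, 19, 16, 18, 13, 3, 4, 21, 17, 20],
    [3, 13, 17, 20, 4, 21, 6, 8, 0, 2, 14, 12, 16, 18, 9, 15, 19, 10, 5, 23, 7, 1, 22, 11],
    [0, 2, 6, 8, 12, 14, 9, 15, 16, 18, 10, 19, 3, 13, 17, 20, 4, 21, 1, 7, 11, 22, 5, 23]]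

/-- The subsets of `fiveCycles` that are closed under conjugation. -/
def fiveCyclesMasks : List ℕ := [
    0, 1, 2, 4, 8, 16, 32, 64, 80, 128, 132, 256, 258, 512, 544, 1024, 1025, 2048, 2056, 4096,
    4128, 4608, 4640, 8192, 8193, 9216, 9217, 16384, 16392, 18432, 18440, 32768, 32784, 32832,
    32848, 65536, 65540, 65664, 65668, 131072, 131074, 131328, 131330, 262144, 262152, 264192,
    264200, 278528, 278536, 280576, 280584, 524288, 524290, 524544, 524546, 655360, 655362,
    655616, 655618, 1048576, 1048608, 1049088, 1049120, 1052672, 1052704, 1053184, 1053216,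
    2097152, 2097156, 2097280, 2097284, 2162688, 2162692, 2162816, 2162820, 4194304, 4194320,
    4194368, 4194384, 4227072, 4227088, 4227136, 4227152, 6710886, 8388608, 8388609, 8389632,
    8389633, 8396800, 8396801, 8397824, 8397825, 10066329, 16777215]

theorem enumeration_fiveCycles : Enumeration (ConjClasses.mk (c[1, 2, 3, 4, 5])) fiveCycles
    fiveCyclesTable fiveCyclesMasks where
  nodup := by decide +kernel
  mem_iff := mem_iff_mem_carrier (cs := fiveCyclesConj) (by decide +kernel) (by decide +kernel)
    (by decide +kernel)
  isConjTable := by decide +kernel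
  closedMasks_eq := by decide +kernel

end NCGeom

/-! ### Explicit descriptions of the strata -/

namespace NCGeom

theorem conjClasses_perm_five (C : ConjClasses (Equiv.Perm (Fin 5))) (hC : C ≠ ConjClasses.mk 1) :
    C = ConjClasses.mk c[1, 2] ∨ C = ConjClasses.mk (c[1, 2] * c[3, 4]) ∨
    C = ConjClasses.mk c[1, 2, 3] ∨ C = ConjClasses.mk (c[1, 2, 3] * c[4, 5]) ∨
    C = ConjClasses.mk c[1, 2, 3, 4] ∨ C = ConjClasses.mk c[1, 2, 3, 4, 5] := by
  have key : ∀ g : Equiv.Perm (Fin 5), g = 1 ∨ g ∈ transpositions ∨ g ∈ doubleTranspositions ∨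
      g ∈ threeCycles ∨ g ∈ sixCycles ∨ g ∈ fourCycles ∨ g ∈ fiveCycles := by
    decide +kernel
  obtain ⟨g, rfl⟩ := ConjClasses.mk_surjective C
  rcases key g with rfl | h | h | h | h | h | h
  · exact absurd rfl hC
  · exact .inl (ConjClasses.mem_carrier_iff_mk_eq.1 ((enumeration_transpositions.mem_iff g).1 h))
  · exact .inr (.inl (ConjClasses.mem_carrier_iff_mk_eq.1
      ((enumeration_doubleTranspositions.mem_iff g).1 h)))
  · exact .inr (.inr (.inl (ConjClasses.mem_carrier_iff_mk_eq.1
      ((enumeration_threeCycles.mem_iff g).1 h))))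
  · exact .inr (.inr (.inr (.inl (ConjClasses.mem_carrier_iff_mk_eq.1
      ((enumeration_sixCycles.mem_iff g).1 h)))))
  · exact .inr (.inr (.inr (.inr (.inl (ConjClasses.mem_carrier_iff_mk_eq.1
      ((enumeration_fourCycles.mem_iff g).1 h))))))
  · exact .inr (.inr (.inr (.inr (.inr (ConjClasses.mem_carrier_iff_mk_eq.1
      ((enumeration_fiveCycles.mem_iff g).1 h))))))

variable (k : Type*) [Field k]

section General

variable {G : Type*} [Group G] [DecidableEq G] [Finite G]
  {C : ConjClasses G} {els : List G} {tab : List (List ℕ)} {masks : List ℕ}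

/-- A stratum given by finitely many sets `S i`, from the computation of the corresponding bit
masks. -/
theorem Enumeration.stratum_eq_range (D : Enumeration C els tab masks) {ι : Type*} [Fintype ι]
    (n : ℕ) (S : ι → Set G) (p : ι → G → Bool) (hp : ∀ i, ∀ a ∈ els, p i a = true ↔ a ∈ S i)
    (h : (masks.filter (popCount els.length · = n)).toFinset =
      Finset.univ.image fun i => maskOf (p i) els) :
    stratum k C n = Set.range fun i => formOn k C (S i) := by
  rw [D.stratum_eq k, h, Finset.coe_image, Finset.coe_univ, Set.image_univ, ← Set.range_comp]
  congr 1
  ext1 i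
  exact (D.formOn_eq_formMask k (S i) (p i) (hp i)).symm

end General

theorem theta_sub_thetaAt {N : ℕ} (C : ConjClasses (Equiv.Perm (Fin N))) (i : Fin N) :
    theta k C - thetaAt k C i = formOn k C {a | a i = i} := by
  rw [thetaAt, theta_sub_formOn]
  congr 1
  ext a
  simp

theorem Enumeration.stratum_eq_range_theta_sub {C : ConjClasses (Equiv.Perm (Fin 5))}
    {els : List (Equiv.Perm (Fin 5))} {tab : List (List ℕ)} {masks : List ℕ}
    (D : Enumeration C els tab masks) (n : ℕ)
    (h : (masks.filter (popCount els.length · = n)).toFinset =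
      Finset.univ.image fun i : Fin 5 => maskOf (fun a => decide (a i = i)) els) :
    stratum k C n = Set.range fun i => theta k C - thetaAt k C i := by
  simp only [theta_sub_thetaAt]
  exact D.stratum_eq_range k n _ _ (fun i a _ => by simp) h

theorem stratum_transpositions :
    stratum k (ConjClasses.mk (c[1, 2] : Equiv.Perm (Fin 5))) 6 =
      Set.range fun i => theta k (ConjClasses.mk (c[1, 2] : Equiv.Perm (Fin 5))) - thetaAt k (ConjClasses.mk c[1, 2]) i :=
  enumeration_transpositions.stratum_eq_range_theta_sub k 6 (by decide +kernel)

theorem stratum_threeCycles :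
    stratum k (ConjClasses.mk (c[1, 2, 3] : Equiv.Perm (Fin 5))) 8 =
      Set.range fun i => theta k (ConjClasses.mk (c[1, 2, 3] : Equiv.Perm (Fin 5))) - thetaAt k (ConjClasses.mk c[1, 2, 3]) i :=
  enumeration_threeCycles.stratum_eq_range_theta_sub k 8 (by decide +kernel)

theorem stratum_fourCycles_six :
    stratum k (ConjClasses.mk (c[1, 2, 3, 4] : Equiv.Perm (Fin 5))) 6 =
      Set.range fun i => theta k (ConjClasses.mk (c[1, 2, 3, 4] : Equiv.Perm (Fin 5))) - thetaAt k (ConjClasses.mk c[1, 2, 3, 4]) i :=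
  enumeration_fourCycles.stratum_eq_range_theta_sub k 6 (by decide +kernel)

/-- The six sets of `doubleTranspositionSets` as lists. -/
def doubleTranspositionLists : Fin 6 → List (Equiv.Perm (Fin 5)) := ![
  [c[1, 4] * c[2, 3], c[1, 2] * c[3, 5], c[1, 3] * c[4, 5], c[2, 5] * c[3, 4], c[1, 5] * c[2, 4]],
  [c[1, 4] * c[2, 3], c[1, 3] * c[2, 5], c[2, 4] * c[3, 5], c[1, 5] * c[3, 4], c[1, 2] * c[4, 5]],
  [c[1, 3] * c[2, 4], c[1, 2] * c[3, 5], c[1, 4] * c[2, 5], c[1, 5] * c[3, 4], c[2, 3] * c[4, 5]],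
  [c[1, 3] * c[2, 4], c[1, 5] * c[2, 3], c[2, 5] * c[3, 4], c[1, 2] * c[4, 5], c[1, 4] * c[3, 5]],
  [c[1, 2] * c[3, 4], c[1, 3] * c[2, 5], c[2, 3] * c[4, 5], c[1, 5] * c[2, 4], c[1, 4] * c[3, 5]],
  [c[1, 2] * c[3, 4], c[1, 5] * c[2, 3], c[2, 4] * c[3, 5], c[1, 4] * c[2, 5], c[1, 3] * c[4, 5]]]

/-- The six sets of `fourCycleSets` as lists. -/
def fourCycleLists : Fin 6 → List (Equiv.Perm (Fin 5)) := ![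
  [c[1, 2, 3, 4], c[1, 5, 2, 3], c[2, 4, 3, 5], c[2, 5, 3, 4], c[1, 2, 4, 5],
    c[1, 5, 4, 2], c[1, 3, 5, 4], c[1, 4, 5, 3], c[1, 4, 3, 2], c[1, 3, 2, 5]],
  [c[1, 2, 3, 4], c[1, 2, 5, 3], c[2, 4, 5, 3], c[2, 3, 5, 4], c[1, 5, 2, 4],
    c[1, 4, 2, 5], c[1, 3, 4, 5], c[1, 5, 4, 3], c[1, 4, 3, 2], c[1, 3, 5, 2]],
  [c[1, 2, 3, 5], c[1, 2, 4, 3], c[1, 3, 4, 2], c[1, 3, 5, 4], c[1, 4, 2, 5],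
    c[1, 4, 5, 3], c[1, 5, 2, 4], c[1, 5, 3, 2], c[2, 3, 4, 5], c[2, 5, 4, 3]],
  [c[1, 5, 2, 3], c[2, 4, 5, 3], c[2, 3, 5, 4], c[1, 2, 4, 3], c[1, 4, 5, 2],
    c[1, 2, 5, 4], c[1, 5, 3, 4], c[1, 4, 3, 5], c[1, 3, 4, 2], c[1, 3, 2, 5]],
  [c[1, 5, 3, 2], c[2, 4, 3, 5], c[2, 5, 3, 4], c[1, 4, 5, 2], c[1, 2, 5, 4],
    c[1, 3, 4, 5], c[1, 3, 2, 4], c[1, 5, 4, 3], c[1, 4, 2, 3], c[1, 2, 3, 5]],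
  [c[1, 2, 5, 3], c[2, 3, 4, 5], c[2, 5, 4, 3], c[1, 2, 4, 5], c[1, 5, 4, 2],
    c[1, 5, 3, 4], c[1, 4, 3, 5], c[1, 3, 2, 4], c[1, 4, 2, 3], c[1, 3, 5, 2]]]

theorem range_fin_six {α : Type*} (f : Fin 6 → α) :
    Set.range f = {f 0, f 1, f 2, f 3, f 4, f 5} := by
  ext x
  simp [Fin.exists_fin_succ, eq_comm]

theorem five_eq_setOf_mem {α : Type*} (a b c d e : α) :
    ({a, b, c, d, e} : Set α) = {x | x ∈ [a, b, c, d, e]} := by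
  ext
  simp

theorem ten_eq_setOf_mem {α : Type*} (a b c d e f g h i j : α) :
    ({a, b, c, d, e, f, g, h, i, j} : Set α) = {x | x ∈ [a, b, c, d, e, f, g, h, i, j]} := by
  ext
  simp

theorem doubleTranspositionSets_eq :
    doubleTranspositionSets = Set.range fun i => {a | a ∈ doubleTranspositionLists i} := by
  rw [range_fin_six]
  simp only [doubleTranspositionSets, five_eq_setOf_mem]
  rfl

theorem fourCycleSets_eq :
    fourCycleSets = Set.range fun i => {a | a ∈ fourCycleLists i} := by
  rw [range_fin_six]
  simp only [fourCycleSets, ten_eq_setOf_mem]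
  rfl

theorem stratum_doubleTranspositions :
    stratum k (ConjClasses.mk (c[1, 2] * c[3, 4])) 5 =
      Set.range fun i => formOn k _ {a | a ∈ doubleTranspositionLists i} :=
  enumeration_doubleTranspositions.stratum_eq_range k 5 _
    (fun i a => decide (a ∈ doubleTranspositionLists i)) (fun i a _ => by simp)
    (by decide +kernel)

theorem stratum_fourCycles_ten :
    stratum k (ConjClasses.mk c[1, 2, 3, 4]) 10 =
      Set.range fun i => formOn k _ {a | a ∈ fourCycleLists i} :=
  enumeration_fourCycles.stratum_eq_range k 10 _
    (fun i a => decide (a ∈ fourCycleLists i)) (fun i a _ => by simp) (by decide +kernel)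

/-- The pairs `(xyz)(uv), (xzy)(uv)`. -/
def sixCyclePair (x y z u v : Fin 5) : List (Equiv.Perm (Fin 5)) :=
  [[x, y, z].formPerm * [u, v].formPerm, [x, z, y].formPerm * [u, v].formPerm]

/-- Representatives `xyzuv` for the partitions of `Fin 5` into a 3-element set `{x, y, z}` and a
2-element set `{u, v}`. -/
def splittings : List (Fin 5 × Fin 5 × Fin 5 × Fin 5 × Fin 5) :=
  [(3, 4, 5, 1, 2), (2, 4, 5, 1, 3), (2, 3, 5, 1, 4), (2, 3, 4, 1, 5), (1, 4, 5, 2, 3),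
    (1, 3, 5, 2, 4), (1, 3, 4, 2, 5), (1, 2, 5, 3, 4), (1, 2, 4, 3, 5), (1, 2, 3, 4, 5)]

theorem stratum_sixCycles :
    stratum k (ConjClasses.mk (c[1, 2, 3] * c[4, 5])) 2 =
      {φ | ∃ x y z u v : Fin 5, [x, y, z, u, v].Nodup ∧
        φ = formOn k _ {[x, y, z].formPerm * [u, v].formPerm,
          [x, z, y].formPerm * [u, v].formPerm}} := by
  have hform : ∀ x y z u v : Fin 5, formOn k (ConjClasses.mk (c[1, 2, 3] * c[4, 5]))
      {[x, y, z].formPerm * [u, v].formPerm, [x, z, y].formPerm * [u, v].formPerm} =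
      formMask k _ sixCycles (maskOf (fun a => decide (a ∈ sixCyclePair x y z u v)) sixCycles) :=
    fun x y z u v => enumeration_sixCycles.formOn_eq_formMask k _ _
      (fun a _ => by simp [sixCyclePair])
  -- One representative per 2-cycle keeps this existential search to ten candidates; the converse
  -- `h2` runs over all quintuples.
  have h1 : ∀ s ∈ sixCyclesMasks.filter (popCount sixCycles.length · = 2), ∃ p ∈ splittings,
      s = maskOf (fun a => decide
        (a ∈ sixCyclePair p.1 p.2.1 p.2.2.1 p.2.2.2.1 p.2.2.2.2)) sixCycles := by
    decide +kernel
  have h2 : ∀ x y z u v : Fin 5, [x, y, z, u, v].Nodup →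
      maskOf (fun a => decide (a ∈ sixCyclePair x y z u v)) sixCycles ∈
        sixCyclesMasks.filter (popCount sixCycles.length · = 2) := by
    decide +kernel
  have h3 : ∀ p ∈ splittings, [p.1, p.2.1, p.2.2.1, p.2.2.2.1, p.2.2.2.2].Nodup := by
    decide +kernel
  ext φ
  rw [enumeration_sixCycles.stratum_eq k]
  constructor
  · rintro ⟨s, hs, rfl⟩
    obtain ⟨p, hp, rfl⟩ := h1 s (List.mem_toFinset.1 hs)
    exact ⟨_, _, _, _, _, h3 p hp, (hform _ _ _ _ _).symm⟩
  · rintro ⟨x, y, z, u, v, h, rfl⟩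
    exact ⟨_, List.mem_toFinset.2 (h2 x y z u v h), (hform x y z u v).symm⟩

theorem stratum_fiveCycles :
    stratum k (ConjClasses.mk c[1, 2, 3, 4, 5]) 12 =
      {formOn k _ (fiveCycleSet 1), formOn k _ (fiveCycleSet (-1))} := by
  rw [enumeration_fiveCycles.stratum_eq_range k 12 fiveCycleSet
    (fun ε a => decide (∃ σ : Equiv.Perm (Fin 5), σ 1 = 1 ∧ Equiv.Perm.sign σ = ε ∧
      a = [1, σ 2, σ 3, σ 4, σ 5].formPerm)) (fun ε a _ => by simp [fiveCycleSet])
    (by decide +kernel)]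
  ext φ
  constructor
  · rintro ⟨ε, rfl⟩
    rcases Int.units_eq_one_or ε with rfl | rfl <;> simp
  · rintro (rfl | rfl)
    exacts [⟨1, rfl⟩, ⟨-1, rfl⟩]

end NCGeom

namespace NCGeom

/-! ### Sum-zero functions on a 2-transitive set -/

section PermutationModules

open Module

variable (k : Type*) [Field k] (G : Type*) [Group G] (X : Type*) [Fintype X] [MulAction G X]

/-- The permutation representation of `G` on the functions on a `G`-set. -/
def funRep : Representation k G (X → k) where
  toFun g := LinearMap.funLeft k k fun x => g⁻¹ • x
  map_one' := by
    ext
    simp [LinearMap.funLeft]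
  map_mul' g h := by
    ext
    simp [LinearMap.funLeft, mul_smul]

/-- The functions of sum zero on a `G`-set. -/
def sumZero : Subrepresentation (funRep k G X) where
  toSubmodule := LinearMap.ker (∑ x, LinearMap.proj (R := k) (φ := fun _ : X => k) x)
  apply_mem_toSubmodule g := fun v hv => by
    have hv' : ∑ x, v x = 0 := by simpa using hv
    have : ∑ x, v (g⁻¹ • x) = 0 := by
      rw [← hv', ← Equiv.sum_comp (MulAction.toPerm g⁻¹) v]
      rfl
    simpa [funRep, LinearMap.funLeft] using this

variable {k G X}

theorem funRep_apply (g : G) (v : X → k) (x : X) : funRep k G X g v x = v (g⁻¹ • x) := rfl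

theorem mem_sumZero_iff {v : X → k} : v ∈ (sumZero k G X).toSubmodule ↔ ∑ x, v x = 0 := by
  simp [sumZero]

/-- Averaging `v` over the stabilizer of a point `x` with `v x ≠ 0` gives a vector constant off `x`
by 2-transitivity. Having sum zero, it is proportional to `1 - |X| δ_x`, and the translates of that
vector span the sum-zero functions. -/
theorem mem_of_sum_eq_zero_of_invariant [Finite G] [CharZero k] [MulAction.IsPretransitive G X]
    (h2 : ∀ x y z : X, y ≠ x → z ≠ x → ∃ g : G, g • x = x ∧ g • y = z)
    (S : Submodule k (X → k)) (hS : ∀ g : G, ∀ v ∈ S, funRep k G X g v ∈ S)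
    {v : X → k} (hvS : v ∈ S) (hv : ∑ x, v x = 0) (hv0 : v ≠ 0) {w : X → k}
    (hw : ∑ x, w x = 0) : w ∈ S := by
  classical
  obtain ⟨x, hx⟩ := Function.ne_iff.1 hv0
  rw [Pi.zero_apply] at hx
  have : Fintype (MulAction.stabilizer G x) := Fintype.ofFinite _
  -- All terms agree at `x`, so `u x` is the order of the stabilizer times `v x`, which is nonzero
  -- in characteristic zero.
  let u : X → k := ∑ g : MulAction.stabilizer G x, funRep k G X (g : G) v
  have huS : u ∈ S := S.sum_mem fun g _ => hS _ _ hvS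
  have hu : ∀ y, u y = ∑ g : MulAction.stabilizer G x, v ((g : G)⁻¹ • y) := fun y => by
    simp [u, Finset.sum_apply, funRep_apply]
  have hux : u x ≠ 0 := by
    have : ∀ g : MulAction.stabilizer G x, v ((g : G)⁻¹ • x) = v x := fun g => by
      rw [inv_smul_eq_iff.2 (MulAction.mem_stabilizer_iff.1 g.2).symm]
    rw [hu]
    simp only [this, Finset.sum_const, nsmul_eq_mul]
    exact mul_ne_zero (Nat.cast_ne_zero.2 Fintype.card_ne_zero) hx
  have husum : ∑ y, u y = 0 := by
    simp only [hu]
    rw [Finset.sum_comm]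
    refine Finset.sum_eq_zero fun g _ => ?_
    rw [← hv, ← Equiv.sum_comp (MulAction.toPerm (g : G)⁻¹) v]
    rfl
  obtain ⟨y, hy⟩ : ∃ y, y ≠ x := by
    by_contra! h
    have : ∑ y, u y = u x := Fintype.sum_eq_single x fun y hy => absurd (h y) hy
    exact hux (this ▸ husum)
  have huy : ∀ z, z ≠ x → u z = u y := by
    intro z hz
    obtain ⟨h, hhx, rfl⟩ := h2 x y z hy hz
    rw [hu, hu, ← Equiv.sum_comp (Equiv.mulLeft
      (⟨h, MulAction.mem_stabilizer_iff.2 hhx⟩ : MulAction.stabilizer G x))]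
    refine Finset.sum_congr rfl fun g _ => ?_
    congr 1
    simp [mul_smul]
  have : Nonempty X := ⟨x⟩
  have hN : (Fintype.card X : k) ≠ 0 := Nat.cast_ne_zero.2 Fintype.card_ne_zero
  let d : X → X → k := fun z y => 1 - if y = z then (Fintype.card X : k) else 0
  have hud : ∀ z, u z = u y + (u x - u y) * if z = x then 1 else 0 := by
    intro z
    split_ifs with hz
    · rw [hz]
      ring
    · rw [huy z hz]
      ring
  have hb : u x - u y = -(Fintype.card X * u y) := by
    have h := (Finset.sum_congr rfl fun z _ => (hud z).symm).trans husum
    rw [Finset.sum_add_distrib, ← Finset.mul_sum, Finset.sum_ite_eq' Finset.univ x] at h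
    simp only [Finset.sum_const, Finset.card_univ, nsmul_eq_mul, Finset.mem_univ, if_true,
      mul_one] at h
    linear_combination h
  have huy0 : u y ≠ 0 := by
    intro h
    rw [h, mul_zero, neg_zero, sub_zero] at hb
    exact hux hb
  have hdx : d x = (u y)⁻¹ • u := by
    ext z
    rw [Pi.smul_apply, smul_eq_mul, eq_inv_mul_iff_mul_eq₀ huy0, hud z, hb]
    simp only [d]
    split_ifs <;> ring
  have hd : ∀ z, d z ∈ S := by
    intro z
    obtain ⟨g, rfl⟩ := MulAction.exists_smul_eq G x z
    have : d (g • x) = funRep k G X g (d x) := by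
      ext y
      simp only [funRep_apply, d, inv_smul_eq_iff]
    rw [this, hdx]
    exact hS g _ (S.smul_mem _ huS)
  -- In `∑ w z • d z` the constant part is `∑ w z = 0`, which leaves `-|X| • w`.
  have hwd : w = -(Fintype.card X : k)⁻¹ • ∑ z, w z • d z := by
    ext y
    simp [d, mul_sub, Finset.sum_sub_distrib, hw, mul_comm (w y), hN]
  rw [hwd]
  exact S.smul_mem _ (S.sum_mem fun z _ => S.smul_mem _ (hd z))

theorem exists_mem_sumZero_ne_zero (hX : 1 < Fintype.card X) :
    ∃ v : X → k, v ∈ (sumZero k G X).toSubmodule ∧ v ≠ 0 := by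
  classical
  obtain ⟨x, y, hxy⟩ := Fintype.one_lt_card_iff.1 hX
  refine ⟨Pi.single x 1 - Pi.single y 1, mem_sumZero_iff.2 (by simp), fun h => ?_⟩
  simpa [hxy] using congrFun h x

theorem isIrreducible_sumZero [Finite G] [CharZero k] [MulAction.IsPretransitive G X]
    (h2 : ∀ x y z : X, y ≠ x → z ≠ x → ∃ g : G, g • x = x ∧ g • y = z)
    (hX : 1 < Fintype.card X) : (sumZero k G X).toRepresentation.IsIrreducible := by
  have : Nontrivial (Subrepresentation (sumZero k G X).toRepresentation) := by
    obtain ⟨v, hv, hv0⟩ := exists_mem_sumZero_ne_zero (k := k) (G := G) hX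
    refine ⟨⊥, ⊤, fun h => hv0 ?_⟩
    have : (⟨v, hv⟩ : (sumZero k G X).toSubmodule) ∈
        (⊥ : Subrepresentation (sumZero k G X).toRepresentation).toSubmodule := by
      rw [h]
      exact Submodule.mem_top
    exact congrArg Subtype.val ((Submodule.mem_bot k).1 this)
  refine ⟨fun T => ?_⟩
  by_cases hT : ∃ v ∈ T.toSubmodule, v ≠ 0
  · right
    obtain ⟨v, hvT, hv0⟩ := hT
    refine Subrepresentation.toSubmodule_injective (eq_top_iff.2 fun w _ => ?_)
    have := mem_of_sum_eq_zero_of_invariant h2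
      (T.toSubmodule.map (sumZero k G X).toSubmodule.subtype) (by
        rintro g _ ⟨w, hw, rfl⟩
        exact ⟨_, T.apply_mem_toSubmodule g hw, rfl⟩)
      ⟨v, hvT, rfl⟩ (mem_sumZero_iff.1 v.2) (fun h => hv0 (Subtype.ext h))
      (mem_sumZero_iff.1 w.2)
    obtain ⟨w', hw', h⟩ := this
    rwa [← Subtype.ext h]
  · left
    push Not at hT
    refine Subrepresentation.toSubmodule_injective (eq_bot_iff.2 fun w hw => ?_)
    exact (Submodule.mem_bot k).2 (hT w hw)

/-- The decomposition of the functions on a finite set into functions of sum zero and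
constants. -/
noncomputable def sumZeroProdEquiv [CharZero k] [Nonempty X] :
    ((sumZero k G X).toSubmodule × k) ≃ₗ[k] (X → k) :=
  have hX : (Fintype.card X : k) ≠ 0 := Nat.cast_ne_zero.2 Fintype.card_ne_zero
  { toFun := fun p x => (p.1 : X → k) x + p.2
    map_add' := fun p q => by
      ext x
      simp
      ring
    map_smul' := fun c p => by
      ext x
      simp [mul_add]
    invFun := fun v => (⟨fun x => v x - (∑ y, v y) / Fintype.card X, mem_sumZero_iff.2 (by
        simp [Finset.sum_sub_distrib, mul_div_cancel₀ _ hX])⟩, (∑ y, v y) / Fintype.card X)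
    left_inv := by
      rintro ⟨⟨v, hv⟩, c⟩
      rw [mem_sumZero_iff] at hv
      have : (∑ y, (v y + c)) / Fintype.card X = c := by
        simp [Finset.sum_add_distrib, hv, hX]
      ext <;> simp [this]
    right_inv := fun v => by
      ext x
      simp }

theorem finrank_sumZero [CharZero k] [Nonempty X] :
    finrank k (sumZero k G X).toSubmodule = Fintype.card X - 1 := by
  have := (sumZeroProdEquiv (k := k) (G := G) (X := X)).finrank_eq
  rw [finrank_prod, finrank_self, finrank_fintype_fun_eq_card] at this
  omega

/-- The trace of a permutation matrix counts fixed points, and the complementary line of constants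
contributes `1`. -/
theorem character_sumZero [CharZero k] [Nonempty X] (g : G) :
    (sumZero k G X).toRepresentation.character g =
      (Nat.card {x : X // g • x = x} : k) - 1 := by
  classical
  have h1 : LinearMap.trace k _ (funRep k G X g) = (Nat.card {x : X // g • x = x} : k) := by
    rw [LinearMap.trace_eq_matrix_trace k (Pi.basisFun k X), Matrix.trace]
    simp only [Matrix.diag_apply, LinearMap.toMatrix_apply, Pi.basisFun_apply, Pi.basisFun_repr,
      funRep_apply, Pi.single_apply, inv_smul_eq_iff, eq_comm (b := g • _)]
    simp [Fintype.card_subtype]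
  have h2 : (sumZeroProdEquiv (k := k) (G := G) (X := X)).conj
      (((sumZero k G X).toRepresentation g).prodMap (1 : Module.End k k)) = funRep k G X g := by
    refine LinearMap.ext fun v => ?_
    obtain ⟨p, rfl⟩ := (sumZeroProdEquiv (k := k) (G := G) (X := X)).surjective v
    simp only [LinearEquiv.conj_apply_apply, LinearEquiv.symm_apply_apply]
    rfl
  rw [← h1, ← h2, LinearMap.trace_conj', LinearMap.trace_prodMap', Representation.character]
  simp

end PermutationModules

end NCGeom

namespace NCGeom

/-! ### The representation on a stratum modulo `θ` -/

section StratumRepresentations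

open Module

variable {k : Type*} [Field k] {G : Type*} [Group G] [Finite G] {C : ConjClasses G} {n : ℕ}

/-- The intertwining map to `V_n` induced by an equivariant linear map to `Λ¹` with values in
`kF_n`. -/
noncomputable def toV {A : Type*} [AddCommGroup A] [Module k A] {ρ : Representation k G A}
    (L : A →ₗ[k] Lam1 k C) (hL : ∀ g v, L (ρ g v) = conjRep k C g (L v))
    (hmem : ∀ v, L v ∈ kF k C n) : ρ.IntertwiningMap (V k C n) where
  toLinearMap := (thetaLine k C n).mkQ ∘ₗ L.codRestrict _ hmem
  isIntertwining' g := by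
    refine LinearMap.ext fun v => ?_
    have : L.codRestrict _ hmem (ρ g v) =
        (conjRep k C).subrepresentation (kF k C n) (kF_le_comap k C n) g (L.codRestrict _ hmem v) :=
      Subtype.ext (hL g v)
    rw [LinearMap.comp_apply, LinearMap.comp_apply, this]
    rfl

section toV

variable {A : Type*} [AddCommGroup A] [Module k A] {ρ : Representation k G A}
  (L : A →ₗ[k] Lam1 k C) (hL : ∀ g v, L (ρ g v) = conjRep k C g (L v))
  (hmem : ∀ v, L v ∈ kF k C n)

theorem toV_apply (v : A) :
    toV L hL hmem v = (thetaLine k C n).mkQ (⟨L v, hmem v⟩ : kF k C n) := rfl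

theorem mkQ_eq_iff (φ ψ : kF k C n) : (thetaLine k C n).mkQ φ = (thetaLine k C n).mkQ ψ ↔
    ∃ c : k, c • theta k C = (φ : Lam1 k C) - ψ := by
  rw [Submodule.mkQ_apply, Submodule.mkQ_apply, Submodule.Quotient.eq, thetaLine,
    Submodule.mem_comap, Submodule.mem_span_singleton]
  rfl

theorem toV_eq_zero_iff (v : A) : toV L hL hmem v = 0 ↔ ∃ c : k, c • theta k C = L v := by
  have h0 : (0 : kF k C n ⧸ thetaLine k C n) = (thetaLine k C n).mkQ 0 := (map_zero _).symm
  rw [toV_apply, h0, mkQ_eq_iff]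
  simp

theorem toV_surjective (h : ∀ φ ∈ kF k C n, ∃ v : A, ∃ c : k, c • theta k C = L v - φ) :
    Function.Surjective (toV L hL hmem) := by
  intro w
  obtain ⟨φ, rfl⟩ := Submodule.mkQ_surjective _ w
  obtain ⟨v, hv⟩ := h φ φ.2
  exact ⟨v, (toV_apply L hL hmem v).trans ((mkQ_eq_iff _ _).2 hv)⟩

end toV

theorem exists_conjBy_eq (a b : C.carrier) : ∃ g, conjBy C g a = b := by
  have : IsConj (a : G) b := ConjClasses.mk_eq_mk_iff_isConj.1
    ((ConjClasses.mem_carrier_iff_mk_eq.1 a.2).trans (ConjClasses.mem_carrier_iff_mk_eq.1 b.2).symm)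
  obtain ⟨g, hg⟩ := isConj_iff.1 this
  exact ⟨g, Subtype.ext hg⟩

instance : Nonempty C.carrier := by
  obtain ⟨g, rfl⟩ := ConjClasses.mk_surjective C
  exact ⟨⟨g, ConjClasses.mem_carrier_mk⟩⟩

theorem sum_eq_of_mem_stratum [Fintype C.carrier] {φ : Lam1 k C} (h : φ ∈ stratum k C n) :
    ∑ a, φ a = n := by
  classical
  obtain ⟨h01, -, rfl⟩ := h
  have : ∀ a, φ a = if φ a ≠ 0 then 1 else 0 := fun a => by
    rcases h01 a with h | h <;> simp [h]
  rw [Finset.sum_congr rfl fun a _ => this a, Finset.sum_boole, Set.ncard_eq_toFinset_card']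
  simp

section Family

variable {X : Type*} [Fintype X] [MulAction G X] (f : X → Lam1 k C)
  (hf : ∀ (g : G) (x : X), conjRep k C g (f x) = f (g • x))

include hf

theorem linearCombination_funRep (g : G) (v : X → k) :
    Fintype.linearCombination k f (funRep k G X g v) =
      conjRep k C g (Fintype.linearCombination k f v) := by
  simp only [Fintype.linearCombination_apply, map_sum, map_smul, hf, funRep_apply]
  rw [← Equiv.sum_comp (MulAction.toPerm g)]
  simp

/-- The sum is invariant and the class is one orbit, so its coefficients are all equal. They are
nonzero because their total is `|X| n`. -/
theorem exists_sum_eq_smul_theta [CharZero k] [Nonempty X] (hn : n ≠ 0)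
    (hmem : ∀ x, f x ∈ stratum k C n) : ∃ c : k, c ≠ 0 ∧ ∑ x, f x = c • theta k C := by
  have : Fintype C.carrier := Fintype.ofFinite _
  obtain ⟨a⟩ : Nonempty C.carrier := inferInstance
  have hinv : ∀ g, conjRep k C g (∑ x, f x) = ∑ x, f x := fun g => by
    simp only [map_sum, hf]
    exact Equiv.sum_comp (MulAction.toPerm g) f
  have hc : ∑ x, f x = (∑ x, f x) a • theta k C := by
    ext b
    obtain ⟨g, hg⟩ := exists_conjBy_eq b a
    rw [← hinv g⁻¹, conjRep_apply, inv_inv, hg, hinv]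
    simp [theta, formOn]
  refine ⟨_, fun h0 => ?_, hc⟩
  rw [h0, zero_smul] at hc
  have h1 : ∑ b, (∑ x, f x) b = Fintype.card X * (n : k) := by
    simp only [Finset.sum_apply]
    rw [Finset.sum_comm]
    simp [sum_eq_of_mem_stratum (hmem _)]
  rw [hc] at h1
  simp [hn] at h1

theorem theta_mem_kF [CharZero k] [Nonempty X] (hn : n ≠ 0)
    (hmem : ∀ x, f x ∈ stratum k C n) : theta k C ∈ kF k C n := by
  obtain ⟨c, hc, h⟩ := exists_sum_eq_smul_theta f hf hn hmem
  rw [← inv_smul_smul₀ hc (theta k C), ← h]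
  exact Submodule.smul_mem _ _ (Submodule.sum_mem _ fun x _ => Submodule.subset_span (hmem x))

/-- Constants on `X` map to multiples of `θ`, so sum-zero functions already surject onto `V_n`. The
map is nonzero because `f x - f y` has total coefficient zero and can be a multiple of `θ` only if
`f x = f y`. Irreducibility of the source then gives injectivity, so linear independence of the
family beyond injectivity of `f` need not be checked. -/
theorem nonempty_equiv_V [CharZero k] [MulAction.IsPretransitive G X]
    (h2 : ∀ x y z : X, y ≠ x → z ≠ x → ∃ g : G, g • x = x ∧ g • y = z)
    (hX : 1 < Fintype.card X) (hn : n ≠ 0) (hinj : Function.Injective f)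
    (hrange : stratum k C n = Set.range f) :
    Nonempty ((sumZero k G X).toRepresentation.Equiv (V k C n)) := by
  classical
  have : Fintype C.carrier := Fintype.ofFinite _
  have : Nonempty X := Fintype.card_pos_iff.1 (by omega)
  have hmem : ∀ x, f x ∈ stratum k C n := fun x => hrange ▸ ⟨x, rfl⟩
  have hspan : LinearMap.range (Fintype.linearCombination k f) = kF k C n := by
    rw [Fintype.range_linearCombination, kF, hrange]
  have hLmem : ∀ v, Fintype.linearCombination k f v ∈ kF k C n := fun v => hspan ▸ ⟨v, rfl⟩
  let F : (sumZero k G X).toRepresentation.IntertwiningMap (V k C n) :=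
    toV (Fintype.linearCombination k f ∘ₗ (sumZero k G X).toSubmodule.subtype)
      (fun g v => linearCombination_funRep f hf g v) fun v => hLmem v
  have hsurj : Function.Surjective F := by
    refine toV_surjective _ _ _ fun φ hφ => ?_
    obtain ⟨c, hc, hsum⟩ := exists_sum_eq_smul_theta f hf hn hmem
    obtain ⟨v, rfl⟩ := hspan.symm ▸ hφ
    obtain ⟨⟨w, s⟩, rfl⟩ := (sumZeroProdEquiv (k := k) (G := G) (X := X)).surjective v
    refine ⟨w, -(s * c), ?_⟩
    have : sumZeroProdEquiv (w, s) = (w : X → k) + s • 1 := by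
      ext x
      simp [sumZeroProdEquiv]
    rw [this, map_add, map_smul, LinearMap.comp_apply, Submodule.subtype_apply,
      Fintype.linearCombination_apply k f 1]
    simp [hsum, smul_smul]
  have hF : F ≠ 0 := by
    intro h
    obtain ⟨x, y, hxy⟩ := Fintype.one_lt_card_iff.1 hX
    have hv : Pi.single x 1 - Pi.single y 1 ∈ (sumZero k G X).toSubmodule :=
      mem_sumZero_iff.2 (by simp)
    have h0 : F ⟨_, hv⟩ = 0 := by
      rw [h]
      rfl
    obtain ⟨c, hc⟩ := (toV_eq_zero_iff _ _ _ _).1 h0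
    have hc' : c • theta k C = f x - f y := by
      rw [hc]
      simp [Fintype.linearCombination_apply_single]
    have htot : ∑ a, (c • theta k C) a = 0 := by
      rw [hc']
      simp only [Pi.sub_apply, Finset.sum_sub_distrib, sum_eq_of_mem_stratum (hmem _), sub_self]
    have hc0 : c = 0 := by
      simp only [Pi.smul_apply, theta, formOn, Set.indicator_univ, smul_eq_mul, mul_one,
        Finset.sum_const, Finset.card_univ, nsmul_eq_mul] at htot
      exact (mul_eq_zero.1 htot).resolve_left (Nat.cast_ne_zero.2 Fintype.card_ne_zero)
    rw [hc0, zero_smul] at hc'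
    exact hxy (hinj (sub_eq_zero.1 hc'.symm))
  have := isIrreducible_sumZero (k := k) h2 hX
  exact ⟨F.ofBijective
    ⟨(Representation.IsIrreducible.injective_or_eq_zero F).resolve_right hF, hsurj⟩⟩

end Family

/-- Conjugation acts on the elements of a stratum. -/
instance stratumAction (C : ConjClasses G) (n : ℕ) : MulAction G (stratum k C n) where
  smul g φ := ⟨conjRep k C g φ, conjRep_mem_stratum k C n g φ.2⟩
  one_smul φ := Subtype.ext (by
    change conjRep k C 1 φ = φ
    rw [map_one]
    rfl)
  mul_smul g h φ := Subtype.ext (by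
    change conjRep k C (g * h) φ = conjRep k C g (conjRep k C h φ)
    rw [map_mul]
    rfl)

theorem coe_smul_stratum (g : G) (φ : stratum k C n) :
    ((g • φ : stratum k C n) : Lam1 k C) = conjRep k C g φ := rfl

section Transfer

variable {A B : Type*} [AddCommGroup A] [Module k A] [AddCommGroup B] [Module k B]
  {ρ : Representation k G A} {σ : Representation k G B}

theorem _root_.Representation.Equiv.isIrreducible (F : ρ.Equiv σ) (h : ρ.IsIrreducible) :
    σ.IsIrreducible := by
  have hF := Representation.IntertwiningMap.isIntertwining ρ σ F.toIntertwiningMap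
  let e : Subrepresentation ρ ≃o Subrepresentation σ :=
    { toFun := fun S => ⟨S.toSubmodule.map F.toLinearEquiv.toLinearMap, by
        rintro g _ ⟨v, hv, rfl⟩
        exact ⟨ρ g v, S.apply_mem_toSubmodule g hv, hF g v⟩⟩
      invFun := fun S => ⟨S.toSubmodule.comap F.toLinearEquiv.toLinearMap, by
        intro g v hv
        have := S.apply_mem_toSubmodule g hv
        exact (hF g v ▸ this : F.toIntertwiningMap (ρ g v) ∈ S.toSubmodule)⟩
      left_inv := fun S => Subrepresentation.toSubmodule_injective
        (Submodule.comap_map_eq_of_injective F.toLinearEquiv.injective _)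
      right_inv := fun S => Subrepresentation.toSubmodule_injective
        (Submodule.map_comap_eq_of_surjective F.toLinearEquiv.surjective _)
      map_rel_iff' := fun {S T} => Submodule.map_le_map_iff_of_injective
        F.toLinearEquiv.injective S.toSubmodule T.toSubmodule }
  exact e.isSimpleOrder_iff.1 h

end Transfer

end StratumRepresentations

end NCGeom

namespace NCGeom

/-! ### A criterion for 2-transitivity -/

section Transitivity

variable {G X : Type*} [Group G] [MulAction G X]

theorem isPretransitive_of_forall_zpow (x₀ : X) (s t : G)
    (h : ∀ x, x ≠ x₀ → ∃ i : ℤ, x = (s ^ i * t) • x₀) : MulAction.IsPretransitive G X := by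
  refine (MulAction.isPretransitive_iff_base x₀).2 fun x => ?_
  by_cases hx : x = x₀
  · exact ⟨1, by rw [one_smul, hx]⟩
  · obtain ⟨i, rfl⟩ := h x hx
    exact ⟨_, rfl⟩

/-- Powers of `s` fix `x₀` and act transitively on its complement, the orbit of `t • x₀`;
conjugating by an `a` with `a • x₀ = x` moves this to any base point. -/
theorem exists_stabilizer_smul_eq (x₀ : X) (s t : G) (hs : s • x₀ = x₀)
    (h : ∀ x, x ≠ x₀ → ∃ i : ℤ, x = (s ^ i * t) • x₀) (x y z : X) (hy : y ≠ x) (hz : z ≠ x) :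
    ∃ g : G, g • x = x ∧ g • y = z := by
  have := isPretransitive_of_forall_zpow x₀ s t h
  obtain ⟨a, rfl⟩ := MulAction.exists_smul_eq G x₀ x
  have hne : ∀ w, w ≠ a • x₀ → ∃ i : ℤ, w = (a * s ^ i * t) • x₀ := by
    intro w hw
    obtain ⟨i, hi⟩ := h (a⁻¹ • w) fun h0 => hw (inv_smul_eq_iff.1 h0)
    exact ⟨i, by rw [mul_assoc, mul_smul, ← hi, smul_inv_smul]⟩
  obtain ⟨i, rfl⟩ := hne y hy
  obtain ⟨j, rfl⟩ := hne z hz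
  have hstab : s ^ (j - i) • x₀ = x₀ :=
    MulAction.mem_stabilizer_iff.1 (Subgroup.zpow_mem (MulAction.stabilizer G x₀) hs (j - i))
  refine ⟨a * s ^ (j - i) * a⁻¹, ?_, ?_⟩
  · rw [mul_smul, inv_smul_smul, mul_smul, hstab]
  · rw [← mul_smul, zpow_sub]
    congr 1
    group

end Transitivity

/-! ### Recognizing `fund`, `5̄` and the sign -/

open Module

variable {k : Type*} [Field k]

theorem conjRep_formOn {G : Type*} [Group G] [Finite G] (C : ConjClasses G) (g : G) (S : Set G) :
    conjRep k C g (formOn k C S) = formOn k C {a | g⁻¹ * a * g ∈ S} := by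
  classical
  ext a
  simp [conjRep_apply, formOn_apply]

theorem injective_of_ncard_range {α β : Type*} [Fintype α] {f : α → β}
    (h : (Set.range f).ncard = Fintype.card α) : Function.Injective f := by
  rw [← Set.injOn_univ]
  refine Set.injOn_of_ncard_image_eq ?_
  rw [Set.image_univ, h, Set.ncard_univ, Nat.card_eq_fintype_card]

theorem theta_mem_kF_of_stratum_nonempty [CharZero k] {G : Type*} [Group G] [Finite G]
    {C : ConjClasses G} {n : ℕ} (hn : n ≠ 0) (h : (stratum k C n).ncard ≠ 0) :
    theta k C ∈ kF k C n := by
  have := Set.finite_of_ncard_ne_zero h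
  have : Fintype (stratum k C n) := this.fintype
  have : Nonempty (stratum k C n) := (Set.nonempty_of_ncard_ne_zero h).to_subtype
  exact theta_mem_kF (Subtype.val : stratum k C n → Lam1 k C) (fun g x => rfl) hn fun x => x.2

theorem nonempty_V_equiv_fund [CharZero k] {C : ConjClasses (Equiv.Perm (Fin 5))} {n : ℕ}
    (hn : n ≠ 0) (hcard : (stratum k C n).ncard = 5)
    (h : stratum k C n = Set.range fun i => theta k C - thetaAt k C i) :
    Nonempty ((V k C n).Equiv (fund k 5).toRepresentation) := by
  have hinj : Function.Injective fun i => theta k C - thetaAt k C i :=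
    injective_of_ncard_range (by rw [← h, hcard, Fintype.card_fin])
  have h2 : ∀ x y z : Fin 5, y ≠ x → z ≠ x →
      ∃ g : Equiv.Perm (Fin 5), g • x = x ∧ g • y = z := fun x y z hy hz =>
    ⟨Equiv.swap y z, Equiv.swap_apply_of_ne_of_ne hy.symm hz.symm, Equiv.swap_apply_left y z⟩
  obtain ⟨F⟩ := nonempty_equiv_V (fun i => theta k C - thetaAt k C i) (fun g x => by
    rw [theta_sub_thetaAt, theta_sub_thetaAt, conjRep_formOn]
    congr 1
    ext a
    simp [Equiv.symm_apply_eq, Equiv.Perm.smul_def]) h2 (by simp) hn hinj h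
  -- `fund k 5` and `sumZero` on `Fin 5` unfold to the same representation.
  exact ⟨F.symm⟩

/-- The hypotheses are decidable certificates: `hs` and `hst` say that `s` fixes the set `ls 0` and
that `s ^ m j * t` carries it to `ls j`, whence 2-transitivity on six points; `hswap` says that the
transposition fixes none of the sets, so the character there is `0 - 1`. -/
theorem isFiveBar_V [CharZero k] {C : ConjClasses (Equiv.Perm (Fin 5))} {n : ℕ}
    (hn : n ≠ 0) (hcard : (stratum k C n).ncard = 6) (ls : Fin 6 → List (Equiv.Perm (Fin 5)))
    (hC : ∀ i, ∀ a ∈ ls i, a ∈ C.carrier)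
    (h : stratum k C n = Set.range fun i => formOn k C {a | a ∈ ls i})
    (s t : Equiv.Perm (Fin 5)) (m : Fin 6 → ℕ)
    (hs : (∀ a ∈ ls 0, s⁻¹ * a * s ∈ ls 0) ∧ ∀ a ∈ ls 0, s * a * s⁻¹ ∈ ls 0)
    (hst : ∀ j ≠ 0, (∀ a ∈ ls j, (s ^ m j * t)⁻¹ * a * (s ^ m j * t) ∈ ls 0) ∧
      ∀ a ∈ ls 0, (s ^ m j * t) * a * (s ^ m j * t)⁻¹ ∈ ls j)
    (hswap : ∀ j, ∃ a ∈ ls j, Equiv.swap 1 2 * a * Equiv.swap 1 2 ∉ ls j) :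
    IsFiveBar k (V k C n) := by
  have : Fintype (stratum k C n) := (Set.finite_of_ncard_ne_zero (by omega)).fintype
  have hX : Fintype.card (stratum k C n) = 6 := by
    rw [← hcard, ← Nat.card_coe_set_eq, Nat.card_eq_fintype_card]
  have hX1 : 1 < Fintype.card (stratum k C n) := hX ▸ by norm_num
  have hmem : ∀ i, formOn k C {a | a ∈ ls i} ∈ stratum k C n := fun i => h ▸ ⟨i, rfl⟩
  have hconj : ∀ g i j, (∀ a ∈ ls j, g⁻¹ * a * g ∈ ls i) ∧ (∀ a ∈ ls i, g * a * g⁻¹ ∈ ls j) →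
      g • (⟨_, hmem i⟩ : stratum k C n) = ⟨_, hmem j⟩ := by
    rintro g i j ⟨h1, h2⟩
    refine Subtype.ext ?_
    rw [coe_smul_stratum, conjRep_formOn]
    congr 1
    ext a
    refine ⟨fun ha => ?_, h1 a⟩
    simpa [mul_assoc] using h2 _ ha
  have hzpow : ∀ x, x ≠ (⟨_, hmem 0⟩ : stratum k C n) →
      ∃ i : ℤ, x = (s ^ i * t) • (⟨_, hmem 0⟩ : stratum k C n) := by
    rintro ⟨φ, hφ⟩ hne
    obtain ⟨j, rfl⟩ : ∃ j, formOn k C {a | a ∈ ls j} = φ := by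
      rw [h] at hφ
      exact hφ
    have hj : j ≠ 0 := by
      rintro rfl
      exact hne rfl
    exact ⟨m j, (hconj _ _ _ (by simpa using hst j hj)).symm⟩
  have htrans := isPretransitive_of_forall_zpow _ s t hzpow
  have h2 := exists_stabilizer_smul_eq _ s t (hconj s 0 0 hs) hzpow
  have hfix : IsEmpty {x : stratum k C n // Equiv.swap (1 : Fin 5) 2 • x = x} := by
    refine ⟨fun x => ?_⟩
    obtain ⟨⟨φ, hφ⟩, hx⟩ := x
    obtain ⟨j, rfl⟩ : ∃ j, formOn k C {a | a ∈ ls j} = φ := by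
      rw [h] at hφ
      exact hφ
    obtain ⟨a, ha, hna⟩ := hswap j
    have hx := congrArg Subtype.val hx
    rw [coe_smul_stratum, conjRep_formOn] at hx
    classical
    have := congrFun hx ⟨a, hC j a ha⟩
    change formOn k C _ _ = formOn k C _ _ at this
    rw [formOn_apply, formOn_apply] at this
    simp [ha, hna] at this
  have : Nonempty (stratum k C n) := ⟨⟨_, hmem 0⟩⟩
  obtain ⟨F⟩ := nonempty_equiv_V (Subtype.val : stratum k C n → Lam1 k C) (fun g x => rfl) h2
    hX1 hn Subtype.val_injective Subtype.range_coe.symm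
  refine ⟨F.isIrreducible (isIrreducible_sumZero h2 hX1), ?_, ?_⟩
  · rw [← F.toLinearEquiv.finrank_eq, finrank_sumZero, hX]
  · rw [← Representation.char_iso F, character_sumZero, Nat.card_of_isEmpty]
    simp

/-- Sum-zero functions on two points form a line. Every transposition exchanges the points and so
acts by `-1`, and transpositions generate. -/
theorem nonempty_V_equiv_signRep [CharZero k] {N : ℕ} {C : ConjClasses (Equiv.Perm (Fin N))}
    {n : ℕ} (hn : n ≠ 0) (hcard : (stratum k C n).ncard = 2) (p q : Fin N) (hpq : p ≠ q)
    (hswap : ∀ i j, i ≠ j → ∀ φ ∈ stratum k C n, conjRep k C (Equiv.swap i j) φ ≠ φ) :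
    Nonempty ((V k C n).Equiv (signRep k N)) := by
  classical
  have : Fintype (stratum k C n) := (Set.finite_of_ncard_ne_zero (by omega)).fintype
  have hX : Fintype.card (stratum k C n) = 2 := by
    rw [← hcard, ← Nat.card_coe_set_eq, Nat.card_eq_fintype_card]
  have hX1 : 1 < Fintype.card (stratum k C n) := hX ▸ by norm_num
  have huniv : ∀ x y : stratum k C n, x ≠ y → (Finset.univ : Finset (stratum k C n)) = {x, y} :=
    fun x y hxy => (Finset.eq_univ_of_card _ (by rw [Finset.card_pair hxy, hX])).symm
  have huniq : ∀ x y z : stratum k C n, y ≠ x → z ≠ x → y = z := by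
    intro x y z hy hz
    have : z ∈ (Finset.univ : Finset (stratum k C n)) := Finset.mem_univ z
    rw [huniv y x hy] at this
    simp only [Finset.mem_insert, Finset.mem_singleton, hz, or_false] at this
    exact this.symm
  have hne : ∀ i j, i ≠ j → ∀ x : stratum k C n, Equiv.swap i j • x ≠ x := fun i j hij x h =>
    hswap i j hij x x.2 (congrArg Subtype.val h)
  have htrans : MulAction.IsPretransitive (Equiv.Perm (Fin N)) (stratum k C n) := by
    refine ⟨fun x y => ?_⟩
    by_cases hxy : y = x
    · exact ⟨1, by rw [one_smul, hxy]⟩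
    · exact ⟨Equiv.swap p q, huniq x _ _ (hne p q hpq x) hxy⟩
  obtain ⟨F⟩ := nonempty_equiv_V (Subtype.val : stratum k C n → Lam1 k C) (fun g x => rfl)
    -- Only one point differs from `x`, so the identity already witnesses 2-transitivity.
    (fun x y z hy hz => ⟨1, one_smul _ x, by rw [one_smul, huniq x y z hy hz]⟩)
    hX1 hn Subtype.val_injective Subtype.range_coe.symm
  obtain ⟨x₀⟩ : Nonempty (stratum k C n) := Fintype.card_pos_iff.1 (zero_lt_one.trans hX1)
  have hsum : ∀ v ∈ (sumZero k (Equiv.Perm (Fin N)) (stratum k C n)).toSubmodule,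
      ∀ x y, x ≠ y → v x + v y = 0 := by
    intro v hv x y hxy
    rw [← mem_sumZero_iff.1 hv, huniv x y hxy, Finset.sum_pair hxy]
  have hsign : ∀ (σ : Equiv.Perm (Fin N)) (x : stratum k C n),
      ∀ v ∈ (sumZero k (Equiv.Perm (Fin N)) (stratum k C n)).toSubmodule,
      v (σ⁻¹ • x) = ((Equiv.Perm.sign σ : ℤ) : k) * v x := by
    intro σ
    induction σ using Equiv.Perm.swap_induction_on with
    | one => simp
    | swap_mul f i j hij ih =>
      intro x v hv
      have h1 := hsum v hv _ _ (hne i j hij x)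
      rw [mul_inv_rev, mul_smul, ih _ v hv, Equiv.swap_inv, Equiv.Perm.sign_mul,
        Equiv.Perm.sign_swap hij]
      push_cast
      linear_combination ((Equiv.Perm.sign f : ℤ) : k) * h1
  let y₀ := Equiv.swap p q • x₀
  have hxy : y₀ ≠ x₀ := hne p q hpq x₀
  let E : (sumZero k (Equiv.Perm (Fin N)) (stratum k C n)).toRepresentation.IntertwiningMap
      (signRep k N) :=
    { toLinearMap := LinearMap.proj x₀ ∘ₗ Submodule.subtype _
      isIntertwining' := fun σ => LinearMap.ext fun v => hsign σ x₀ v v.2 }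
  have hE : Function.Bijective E := by
    constructor
    · refine (injective_iff_map_eq_zero E).2 fun v hv => Subtype.ext (funext fun x => ?_)
      have hv' : (v : stratum k C n → k) x₀ = 0 := hv
      by_cases hx : x = x₀
      · rw [hx, hv']
        rfl
      · have := hsum v v.2 x x₀ hx
        rwa [hv', add_zero] at this
    · intro c
      refine ⟨⟨Pi.single x₀ c - Pi.single y₀ c, mem_sumZero_iff.2 (by simp)⟩, ?_⟩
      change (Pi.single x₀ c - Pi.single y₀ c : stratum k C n → k) x₀ = c
      simp [hxy]
  exact ⟨F.symm.trans (E.ofBijective hE)⟩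

end NCGeom

namespace NCGeom

/-! ### Edge weights with zero vertex sums: the representation `5` -/

section EdgeWeights

open Module

variable (k : Type*) [Field k]

/-- The action of `S_N` on the functions of two variables in `Fin N`. -/
def weightRep (N : ℕ) : Representation k (Equiv.Perm (Fin N)) (Fin N → Fin N → k) where
  toFun g :=
    { toFun := fun w i j => w ((g⁻¹ : Equiv.Perm (Fin N)) i) ((g⁻¹ : Equiv.Perm (Fin N)) j)
      map_add' := fun _ _ => rfl
      map_smul' := fun _ _ => rfl }
  map_one' := rfl
  map_mul' _ _ := rfl

/-- The weights on the edges of the complete graph on `Fin N` for which the sum of the weights at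
every vertex is zero. -/
def balanced (N : ℕ) : Subrepresentation (weightRep k N) where
  toSubmodule :=
    { carrier := {w | (∀ i j, w i j = w j i) ∧ (∀ i, w i i = 0) ∧ ∀ i, ∑ j, w i j = 0}
      add_mem' := by
        rintro v w ⟨hv1, hv2, hv3⟩ ⟨hw1, hw2, hw3⟩
        refine ⟨fun i j => ?_, fun i => ?_, fun i => ?_⟩
        · simp [hv1 i j, hw1 i j]
        · simp [hv2, hw2]
        · simp [Finset.sum_add_distrib, hv3, hw3]
      zero_mem' := by simp
      smul_mem' := by
        rintro c w ⟨hw1, hw2, hw3⟩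
        refine ⟨fun i j => ?_, fun i => ?_, fun i => ?_⟩
        · simp [hw1 i j]
        · simp [hw2]
        · simp [← Finset.mul_sum, hw3] }
  apply_mem_toSubmodule g := by
    rintro w ⟨hw1, hw2, hw3⟩
    refine ⟨fun i j => hw1 _ _, fun i => hw2 _, fun i => ?_⟩
    rw [← hw3 ((g⁻¹ : Equiv.Perm (Fin N)) i)]
    exact Equiv.sum_comp (g⁻¹ : Equiv.Perm (Fin N)) _

variable {k}

theorem weightRep_apply {N : ℕ} (g : Equiv.Perm (Fin N)) (w : Fin N → Fin N → k) (i j : Fin N) :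
    weightRep k N g w i j = w ((g⁻¹ : Equiv.Perm (Fin N)) i) ((g⁻¹ : Equiv.Perm (Fin N)) j) := rfl

/-- The weight of an edge. -/
def edgeWeight {N : ℕ} (i j : Fin N) : Fin N → Fin N → k :=
  fun p q => if p = i ∧ q = j ∨ p = j ∧ q = i then 1 else 0

/-- The alternating weight of the 4-cycle `i, l, j, m`. -/
def cycleWeight {N : ℕ} (i j l m : Fin N) : Fin N → Fin N → k :=
  edgeWeight i l - edgeWeight j l - edgeWeight i m + edgeWeight j m

theorem weightRep_cycleWeight {N : ℕ} (g : Equiv.Perm (Fin N)) (i j l m : Fin N) :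
    weightRep k N g (cycleWeight i j l m) = cycleWeight (g i) (g j) (g l) (g m) := by
  ext p q
  simp [weightRep_apply, cycleWeight, edgeWeight, Equiv.symm_apply_eq]

/-- Five vertex conditions on ten edges leave the weights of `12, 14, 24, 01, 02` free; the
coefficients are those needed for five alternating 4-cycles to match them. -/
theorem eq_sum_cycleWeight [CharZero k] {w : Fin 5 → Fin 5 → k}
    (hw : w ∈ (balanced k 5).toSubmodule) :
    w = -w 1 2 • cycleWeight 0 1 2 3 + w 1 4 • cycleWeight 0 1 3 4 + w 2 4 • cycleWeight 0 2 3 4 +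
      w 0 1 • cycleWeight 0 3 1 4 + (w 0 2 + w 1 2) • cycleWeight 0 3 2 4 := by
  obtain ⟨hsym, hdiag, hsum⟩ := hw
  simp only [Fin.sum_univ_five] at hsum
  have h0 := hsum 0
  have h1 := hsum 1
  have h2 := hsum 2
  have h3 := hsum 3
  have h4 := hsum 4
  rw [hdiag] at h0 h1 h2 h3 h4
  rw [hsym 1 0] at h1
  rw [hsym 2 0, hsym 2 1] at h2
  rw [hsym 3 0, hsym 3 1, hsym 3 2] at h3
  rw [hsym 4 0, hsym 4 1, hsym 4 2, hsym 4 3] at h4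
  have e13 : w 1 3 = -w 0 1 - w 1 2 - w 1 4 := by linear_combination h1
  have e23 : w 2 3 = -w 0 2 - w 1 2 - w 2 4 := by linear_combination h2
  have e03 : w 0 3 = w 1 2 + w 1 4 + w 2 4 := by
    linear_combination (1 / 2 : k) * (h0 + h3 - h4 - 2 * e13 - 2 * e23)  + (1/2 : k) * (h1 + h2)
  have e04 : w 0 4 = -w 0 1 - w 0 2 - w 1 2 - w 1 4 - w 2 4 := by linear_combination h0 - e03
  have e34 : w 3 4 = w 0 1 + w 0 2 + w 1 2 := by linear_combination h4 - e04
  ext p q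
  -- Both sides are symmetric, and the solved equations are stated for increasing pairs only.
  wlog hpq : p ≤ q generalizing p q
  · rw [hsym, this q p (le_of_not_ge hpq)]
    simp [cycleWeight, edgeWeight, and_comm, or_comm]
  fin_cases p <;> fin_cases q <;>
    simp [cycleWeight, edgeWeight, hdiag, e13, e23, e03, e04, e34] at hpq ⊢ <;> ring

theorem exists_perm_eq {i j l m : Fin 5} (h : [i, j, l, m].Nodup) :
    ∃ g : Equiv.Perm (Fin 5), g 0 = i ∧ g 1 = j ∧ g 2 = l ∧ g 3 = m := by
  revert i j l m
  decide +kernel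

theorem cycleWeight_mem_balanced {i j l m : Fin 5} (h : [i, j, l, m].Nodup) :
    cycleWeight i j l m ∈ (balanced k 5).toSubmodule := by
  obtain ⟨g, rfl, rfl, rfl, rfl⟩ := exists_perm_eq h
  rw [← weightRep_cycleWeight]
  refine (balanced k 5).apply_mem_toSubmodule g ⟨fun p q => ?_, fun p => ?_, fun p => ?_⟩
  · simp [cycleWeight, edgeWeight, and_comm, or_comm]
  · fin_cases p <;> simp [cycleWeight, edgeWeight]
  · fin_cases p <;> simp [cycleWeight, edgeWeight, Fin.sum_univ_five]

/-- The effect of `(1 - (0 1)) (1 - (2 3))` on a symmetric weight. -/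
theorem exchange_eq_smul_cycleWeight {w : Fin 5 → Fin 5 → k}
    (hw : w ∈ (balanced k 5).toSubmodule) :
    (w - weightRep k 5 (Equiv.swap 2 3) w) -
      weightRep k 5 (Equiv.swap 0 1) (w - weightRep k 5 (Equiv.swap 2 3) w) =
    (w 0 2 - w 1 2 - w 0 3 + w 1 3) • cycleWeight 0 1 2 3 := by
  obtain ⟨hsym, hdiag, -⟩ := hw
  ext p q
  fin_cases p <;> fin_cases q <;>
    simp [weightRep_apply, Equiv.swap_inv, Equiv.swap_apply_def, cycleWeight, edgeWeight, hdiag,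
      hsym 1 0, hsym 2 0, hsym 2 1, hsym 3 0, hsym 3 1, hsym 3 2, hsym 4 0, hsym 4 1, hsym 4 2,
      hsym 4 3] <;>
    ring

/-- Add the six relations with `i = 0`, `l = 2` and `j ≠ m` in `{1, 3, 4}`. The edge `02` appears
six times, and eliminating the other edges by the vertex sums contributes three further multiples `2
w 0 2`, for a total of `12 w 0 2`. -/
theorem apply_zero_two_eq_zero [CharZero k] {w : Fin 5 → Fin 5 → k}
    (hw : w ∈ (balanced k 5).toSubmodule)
    (h : ∀ i j l m : Fin 5, [i, j, l, m].Nodup → w i l - w j l - w i m + w j m = 0) :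
    w 0 2 = 0 := by
  obtain ⟨hsym, hdiag, hsum⟩ := hw
  simp only [Fin.sum_univ_five] at hsum
  linear_combination (1 / 12 : k) * (h 0 1 2 3 (by decide) + h 0 1 2 4 (by decide) +
    h 0 3 2 1 (by decide) + h 0 3 2 4 (by decide) + h 0 4 2 1 (by decide) +
    h 0 4 2 3 (by decide) + 3 * hsum 0 + 3 * hsum 2 - hsum 1 - hsum 3 - hsum 4 + hdiag 1 + hdiag 3 +
    hdiag 4 - 3 * hdiag 0 - 3 * hdiag 2 + 3 * hsym 0 2 + hsym 1 0 + 3 * hsym 1 2 + hsym 3 0 +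
    3 * hsym 3 2 + hsym 4 0 + 3 * hsym 4 2)

theorem eq_zero_of_forall_exchange [CharZero k] {w : Fin 5 → Fin 5 → k}
    (hw : w ∈ (balanced k 5).toSubmodule)
    (h : ∀ g : Equiv.Perm (Fin 5), weightRep k 5 g w 0 2 - weightRep k 5 g w 1 2 -
      weightRep k 5 g w 0 3 + weightRep k 5 g w 1 3 = 0) : w = 0 := by
  have h' : ∀ i j l m : Fin 5, [i, j, l, m].Nodup → w i l - w j l - w i m + w j m = 0 := by
    intro i j l m hn
    obtain ⟨g, rfl, rfl, rfl, rfl⟩ := exists_perm_eq hn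
    simpa [weightRep_apply] using h g⁻¹
  ext i l
  by_cases hil : i = l
  · rw [hil, hw.2.1]
    rfl
  obtain ⟨g, rfl, rfl⟩ : ∃ g : Equiv.Perm (Fin 5), g 0 = i ∧ g 2 = l := by
    revert i l
    decide +kernel
  have := apply_zero_two_eq_zero ((balanced k 5).apply_mem_toSubmodule g⁻¹ hw)
    fun i j l m hn => h' _ _ _ _ (by simpa using hn.map (g⁻¹⁻¹).injective)
  simpa [weightRep_apply] using this

/-- The operator `(1 - (0 1)) (1 - (2 3))` sends any balanced weight to a multiple of one
alternating 4-cycle. For a nonzero weight some translate gives a nonzero multiple, and the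
translates of that 4-cycle span. -/
theorem isIrreducible_balanced [CharZero k] : (balanced k 5).toRepresentation.IsIrreducible := by
  have hcyc : (cycleWeight 0 1 2 3 : Fin 5 → Fin 5 → k) ≠ 0 := fun h => by
    simpa [cycleWeight, edgeWeight] using congrFun (congrFun h 0) 2
  have : Nontrivial (Subrepresentation (balanced k 5).toRepresentation) := by
    refine ⟨⊥, ⊤, fun h => hcyc ?_⟩
    have : (⟨_, cycleWeight_mem_balanced (i := 0) (j := 1) (l := 2) (m := 3) (by decide)⟩ : (balanced k 5).toSubmodule) ∈
        (⊥ : Subrepresentation (balanced k 5).toRepresentation).toSubmodule := by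
      rw [h]
      exact Submodule.mem_top
    exact congrArg Subtype.val ((Submodule.mem_bot k).1 this)
  refine ⟨fun T => ?_⟩
  let S : Submodule k (Fin 5 → Fin 5 → k) := T.toSubmodule.map (balanced k 5).toSubmodule.subtype
  have hS : ∀ g, ∀ w ∈ S, weightRep k 5 g w ∈ S := by
    rintro g _ ⟨w, hw, rfl⟩
    exact ⟨_, T.apply_mem_toSubmodule g hw, rfl⟩
  by_cases hT : ∃ w ∈ T.toSubmodule, w ≠ 0
  · right
    obtain ⟨w, hwT, hw0⟩ := hT
    obtain ⟨g, hg⟩ := not_forall.1 fun h =>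
      hw0 (Subtype.ext (eq_zero_of_forall_exchange w.2 h))
    have hgw : weightRep k 5 g w ∈ S := hS g _ ⟨w, hwT, rfl⟩
    have hc : cycleWeight 0 1 2 3 ∈ S := by
      rw [← S.smul_mem_iff hg,
        ← exchange_eq_smul_cycleWeight ((balanced k 5).apply_mem_toSubmodule g w.2)]
      have h1 := S.sub_mem hgw (hS (Equiv.swap 2 3) _ hgw)
      exact S.sub_mem h1 (hS _ _ h1)
    have hc' : ∀ i j l m : Fin 5, [i, j, l, m].Nodup → cycleWeight i j l m ∈ S := by
      intro i j l m hn
      obtain ⟨g, rfl, rfl, rfl, rfl⟩ := exists_perm_eq hn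
      rw [← weightRep_cycleWeight]
      exact hS g _ hc
    refine Subrepresentation.toSubmodule_injective (eq_top_iff.2 fun v _ => ?_)
    have hv : (v : Fin 5 → Fin 5 → k) ∈ S := by
      rw [eq_sum_cycleWeight v.2]
      refine S.add_mem (S.add_mem (S.add_mem (S.add_mem ?_ ?_) ?_) ?_) ?_ <;>
        exact S.smul_mem _ (hc' _ _ _ _ (by decide))
    obtain ⟨v', hv', h⟩ := hv
    rwa [← Subtype.ext h]
  · left
    push Not at hT
    refine Subrepresentation.toSubmodule_injective (eq_bot_iff.2 fun w hw => ?_)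
    exact (Submodule.mem_bot k).2 (hT w hw)

variable (k) in
/-- Coordinates on the weights with vertex sums zero. -/
noncomputable def balancedEquiv [CharZero k] : (balanced k 5).toSubmodule ≃ₗ[k] (Fin 5 → k) where
  toFun w := ![w.1 1 2, w.1 1 4, w.1 2 4, w.1 0 1, w.1 0 2]
  map_add' v w := by
    ext i
    fin_cases i <;> rfl
  map_smul' c w := by
    ext i
    fin_cases i <;> rfl
  invFun x := ⟨-x 0 • cycleWeight 0 1 2 3 + x 1 • cycleWeight 0 1 3 4 + x 2 • cycleWeight 0 2 3 4 +
      x 3 • cycleWeight 0 3 1 4 + (x 4 + x 0) • cycleWeight 0 3 2 4, by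
    refine Submodule.add_mem _ (Submodule.add_mem _ (Submodule.add_mem _ (Submodule.add_mem _
      ?_ ?_) ?_) ?_) ?_ <;>
      exact Submodule.smul_mem _ _ (cycleWeight_mem_balanced (by decide))⟩
  left_inv w := Subtype.ext (eq_sum_cycleWeight w.2).symm
  right_inv x := by
    ext i
    fin_cases i <;> simp [cycleWeight, edgeWeight]

theorem finrank_balanced [CharZero k] : finrank k (balanced k 5).toSubmodule = 5 := by
  simp [(balancedEquiv k).finrank_eq]

theorem character_balanced [CharZero k] :
    (balanced k 5).toRepresentation.character (Equiv.swap 1 2) = 1 := by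
  -- The transposition fixes the edge `12` and exchanges `14` with `24` and `01` with `02`, so it
  -- permutes the coordinates with one fixed point.
  have h : (balancedEquiv k).conj ((balanced k 5).toRepresentation (Equiv.swap 1 2)) =
      LinearMap.funLeft k k (![0, 2, 1, 4, 3] : Fin 5 → Fin 5) := by
    refine LinearMap.ext fun x => ?_
    obtain ⟨w, rfl⟩ := (balancedEquiv k).surjective x
    rw [LinearEquiv.conj_apply_apply, LinearEquiv.symm_apply_apply]
    have hw : ∀ i j, ((balanced k 5).toRepresentation (Equiv.swap 1 2) w).1 i j =
        w.1 ((Equiv.swap 1 2 : Equiv.Perm (Fin 5))⁻¹ i) ((Equiv.swap 1 2 : Equiv.Perm (Fin 5))⁻¹ j) :=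
      fun i j => rfl
    ext i
    fin_cases i <;> simp [balancedEquiv, hw, Equiv.swap_inv, Equiv.swap_apply_def, w.2.1 2 1]
  rw [Representation.character, ← LinearMap.trace_conj' _ (balancedEquiv k), h,
    LinearMap.trace_eq_matrix_trace k (Pi.basisFun k (Fin 5)), Matrix.trace]
  simp [Fin.sum_univ_five]

end EdgeWeights

end NCGeom

namespace NCGeom

/-! ### The class of `(123)(45)` -/

section SixCycles

open Module

variable (k : Type*) [Field k]

/-- The form `∑ e_a` over the elements of a class in `S_N` that exchange `i` and `j`. -/
noncomputable def exchangeForm {N : ℕ} (C : ConjClasses (Equiv.Perm (Fin N))) (i j : Fin N) :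
    Lam1 k C :=
  formOn k C {a | a i = j ∧ a j = i}

/-- The linear map `w ↦ ∑ w i j • exchangeForm i j`. -/
noncomputable def exchangeMap {N : ℕ} (C : ConjClasses (Equiv.Perm (Fin N))) :
    (Fin N → Fin N → k) →ₗ[k] Lam1 k C where
  toFun w := ∑ i, ∑ j, w i j • exchangeForm k C i j
  map_add' v w := by simp [add_smul, Finset.sum_add_distrib]
  map_smul' c w := by simp [Finset.smul_sum, smul_smul]

theorem exchangeMap_apply {N : ℕ} (C : ConjClasses (Equiv.Perm (Fin N)))
    (w : Fin N → Fin N → k) :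
    exchangeMap k C w = ∑ i, ∑ j, w i j • exchangeForm k C i j := rfl

theorem conjRep_exchangeForm {N : ℕ} (C : ConjClasses (Equiv.Perm (Fin N)))
    (g : Equiv.Perm (Fin N)) (i j : Fin N) :
    conjRep k C g (exchangeForm k C i j) = exchangeForm k C (g i) (g j) := by
  rw [exchangeForm, conjRep_formOn]
  unfold exchangeForm
  congr 1
  ext a
  simp [Equiv.symm_apply_eq]

theorem exchangeMap_weightRep {N : ℕ} (C : ConjClasses (Equiv.Perm (Fin N)))
    (g : Equiv.Perm (Fin N)) (w : Fin N → Fin N → k) :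
    exchangeMap k C (weightRep k N g w) = conjRep k C g (exchangeMap k C w) := by
  simp only [exchangeMap_apply, map_sum, map_smul, conjRep_exchangeForm, weightRep_apply]
  rw [← Equiv.sum_comp g]
  refine Finset.sum_congr rfl fun i _ => ?_
  rw [← Equiv.sum_comp g]
  simp

theorem exchangeMap_apply_apply {N : ℕ} (C : ConjClasses (Equiv.Perm (Fin N)))
    (w : Fin N → Fin N → k) (a : C.carrier) :
    exchangeMap k C w a = ∑ i, if (a : Equiv.Perm (Fin N)) ((a : Equiv.Perm (Fin N)) i) = i
      then w i ((a : Equiv.Perm (Fin N)) i) else 0 := by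
  simp only [exchangeMap_apply, Finset.sum_apply, Pi.smul_apply, exchangeForm, formOn_apply,
    Set.mem_ofPred_eq, smul_eq_mul, mul_ite, mul_one, mul_zero]
  refine Finset.sum_congr rfl fun i _ => ?_
  rw [Fintype.sum_eq_single ((a : Equiv.Perm (Fin N)) i)]
  · simp
  · intro j hj
    simp [hj.symm]

/-- The class of `(123)(45)` in `S_5`. -/
abbrev sixClass : ConjClasses (Equiv.Perm (Fin 5)) := ConjClasses.mk (c[1, 2, 3] * c[4, 5])

theorem exchangeForm_self (i : Fin 5) : exchangeForm k sixClass i i = 0 := by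
  have h : ∀ a ∈ sixCycles, a i ≠ i := by
    revert i
    decide +kernel
  ext a
  rw [exchangeForm, formOn_apply]
  simp [h a ((enumeration_sixCycles.mem_iff _).2 a.2)]

/-- Indexing the stratum by the exchanged pair, rather than by quintuples, makes its span the image
of the edge weights. -/
theorem stratum_sixClass :
    stratum k sixClass 2 = {φ | ∃ i j, i ≠ j ∧ φ = exchangeForm k sixClass i j} := by
  have hform : ∀ i j, exchangeForm k sixClass i j =
      formMask k _ sixCycles (maskOf (fun a => decide (a i = j ∧ a j = i)) sixCycles) :=
    fun i j => enumeration_sixCycles.formOn_eq_formMask k _ _ (fun a _ => by simp)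
  have h1 : ∀ s ∈ sixCyclesMasks.filter (popCount sixCycles.length · = 2), ∃ i j : Fin 5, i ≠ j ∧
      s = maskOf (fun a => decide (a i = j ∧ a j = i)) sixCycles := by
    decide +kernel
  have h2 : ∀ i j : Fin 5, i ≠ j → maskOf (fun a => decide (a i = j ∧ a j = i)) sixCycles ∈
      sixCyclesMasks.filter (popCount sixCycles.length · = 2) := by
    decide +kernel
  ext φ
  rw [enumeration_sixCycles.stratum_eq k]
  constructor
  · rintro ⟨s, hs, rfl⟩
    obtain ⟨i, j, hij, rfl⟩ := h1 s (List.mem_toFinset.1 hs)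
    exact ⟨i, j, hij, (hform i j).symm⟩
  · rintro ⟨i, j, hij, rfl⟩
    exact ⟨_, List.mem_toFinset.2 (h2 i j hij), (hform i j).symm⟩

theorem exchangeMap_mem_kF (w : Fin 5 → Fin 5 → k) :
    exchangeMap k sixClass w ∈ kF k sixClass 2 := by
  rw [exchangeMap_apply]
  refine Submodule.sum_mem _ fun i _ => Submodule.sum_mem _ fun j _ => Submodule.smul_mem _ _ ?_
  by_cases hij : i = j
  · rw [hij, exchangeForm_self]
    exact Submodule.zero_mem _
  · refine Submodule.subset_span ?_
    rw [stratum_sixClass]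
    exact ⟨i, j, hij, rfl⟩

theorem exists_exchangeMap_eq {φ : Lam1 k sixClass} (h : φ ∈ kF k sixClass 2) :
    ∃ w, exchangeMap k sixClass w = φ := by
  have : kF k sixClass 2 ≤ LinearMap.range (exchangeMap k sixClass) := by
    rw [kF, Submodule.span_le, stratum_sixClass]
    rintro _ ⟨i, j, -, rfl⟩
    refine ⟨Pi.single i (Pi.single j 1), ?_⟩
    rw [exchangeMap_apply, Fintype.sum_eq_single i, Fintype.sum_eq_single j]
    · simp
    · intro l hl
      simp [hl]
    · intro l hl
      simp [hl]
  exact this h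

/-- An element whose 2-cycle is `(u v)` has exactly `u` and `v` as the points returned by its
square, so only the two ordered pairs from this edge contribute. -/
theorem exists_exchangeMap_apply_eq {u v : Fin 5} (huv : u ≠ v) :
    ∃ a : sixClass.carrier, ∀ w : Fin 5 → Fin 5 → k,
      exchangeMap k sixClass w a = w u v + w v u := by
  have h : ∃ a ∈ sixCycles, a u = v ∧ a v = u ∧ ∀ i, a (a i) = i ↔ i = u ∨ i = v := by
    revert u v
    decide +kernel
  obtain ⟨a, ha, hau, hav, hai⟩ := h
  refine ⟨⟨a, (enumeration_sixCycles.mem_iff a).1 ha⟩, fun w => ?_⟩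
  rw [exchangeMap_apply_apply]
  simp only [hai]
  rw [← Finset.sum_filter, Finset.filter_or, Finset.filter_eq', Finset.filter_eq']
  simp [Finset.sum_pair huv, hau, hav]

theorem exchangeMap_apply_eq (a : sixClass.carrier) :
    ∃ u v : Fin 5, u ≠ v ∧ ∀ w : Fin 5 → Fin 5 → k,
      exchangeMap k sixClass w a = w u v + w v u := by
  have h : ∀ a ∈ sixCycles, ∃ u v : Fin 5, u ≠ v ∧ a u = v ∧ a v = u ∧
      ∀ i, a (a i) = i ↔ i = u ∨ i = v := by
    decide +kernel
  obtain ⟨u, v, huv, hau, hav, hai⟩ := h a ((enumeration_sixCycles.mem_iff _).2 a.2)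
  refine ⟨u, v, huv, fun w => ?_⟩
  rw [exchangeMap_apply_apply]
  simp only [hai]
  rw [← Finset.sum_filter, Finset.filter_or, Finset.filter_eq', Finset.filter_eq']
  simp [Finset.sum_pair huv, hau, hav]

/-- The linear map sending `c` to the function `c i + c j` of two variables. -/
def pairSum (N : ℕ) : (Fin N → k) →ₗ[k] Fin N → Fin N → k where
  toFun c i j := c i + c j
  map_add' c d := by
    ext
    simp
    ring
  map_smul' c d := by
    ext
    simp [mul_add]

theorem pairSum_apply {N : ℕ} (c : Fin N → k) (i j : Fin N) : pairSum k N c i j = c i + c j := rfl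

theorem mem_fund_iff {N : ℕ} {c : Fin N → k} : c ∈ (fund k N).toSubmodule ↔ ∑ i, c i = 0 := by
  simp [fund]

/-- The map from the standard representation to `V_2`. -/
noncomputable def fundToV : (fund k 5).toRepresentation.IntertwiningMap (V k sixClass 2) :=
  toV (exchangeMap k sixClass ∘ₗ pairSum k 5 ∘ₗ (fund k 5).toSubmodule.subtype)
    (fun g c => exchangeMap_weightRep k sixClass g (pairSum k 5 c))
    fun _ => exchangeMap_mem_kF k _

/-- The map from the weights with vertex sums zero to `V_2`. -/
noncomputable def balancedToV : (balanced k 5).toRepresentation.IntertwiningMap (V k sixClass 2) :=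
  toV (exchangeMap k sixClass ∘ₗ (balanced k 5).toSubmodule.subtype)
    (fun g w => exchangeMap_weightRep k sixClass g w) fun _ => exchangeMap_mem_kF k _

theorem fundToV_apply (c : (fund k 5).toSubmodule) : fundToV k c =
    (thetaLine k sixClass 2).mkQ (⟨_, exchangeMap_mem_kF k (pairSum k 5 c)⟩ : kF k sixClass 2) :=
  rfl

theorem balancedToV_apply (w : (balanced k 5).toSubmodule) : balancedToV k w =
    (thetaLine k sixClass 2).mkQ (⟨_, exchangeMap_mem_kF k w⟩ : kF k sixClass 2) := rfl

variable {k} [CharZero k]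

/-- Every edge satisfies `2 (c i + c j + w i j) = s`. Summing over `j` gives `3 c i = 2 s`, and
summing over `i` gives `s = 0`. -/
theorem eq_zero_of_exchangeMap_eq_smul_theta {c : Fin 5 → k} (hc : ∑ i, c i = 0)
    {w : Fin 5 → Fin 5 → k} (hw : w ∈ (balanced k 5).toSubmodule) {s : k}
    (h : s • theta k sixClass = exchangeMap k sixClass (pairSum k 5 c + w)) :
    c = 0 ∧ w = 0 := by
  obtain ⟨hsym, hdiag, hsum⟩ := hw
  have hval : ∀ i j, i ≠ j → 2 * (c i + c j + w i j) = s := by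
    intro i j hij
    obtain ⟨a, ha⟩ := exists_exchangeMap_apply_eq k hij
    have := ha (pairSum k 5 c + w)
    rw [← h] at this
    simp only [theta, formOn, Pi.smul_apply, Set.indicator_univ, smul_eq_mul, mul_one,
      Pi.add_apply, pairSum_apply] at this
    rw [this, hsym j i]
    ring
  have hci : ∀ i, 3 * c i = 2 * s := by
    intro i
    -- The diagonal term `j = i` contributes `4 c i`, the other four contribute `s` each.
    have h1 : ∑ j, 2 * (c i + c j + w i j) = 4 * s + 4 * c i := by
      rw [← Finset.add_sum_erase _ _ (Finset.mem_univ i), Finset.sum_congr rfl fun j hj =>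
        hval i j (Finset.ne_of_mem_erase hj).symm, hdiag, Finset.sum_const,
        Finset.card_erase_of_mem (Finset.mem_univ i)]
      simp
      ring
    rw [← Finset.mul_sum, Finset.sum_add_distrib, Finset.sum_add_distrib, hc, hsum] at h1
    simp at h1
    linear_combination (1 / 2 : k) * h1
  have hs : s = 0 := by
    have h1 : ∑ i, 3 * c i = ∑ i : Fin 5, 2 * s := Finset.sum_congr rfl fun i _ => hci i
    rw [← Finset.mul_sum, hc] at h1
    simpa using h1
  have hc0 : c = 0 := by
    ext i
    simpa [hs] using hci i
  refine ⟨hc0, ?_⟩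
  ext i j
  by_cases hij : i = j
  · rw [hij, hdiag]
    rfl
  · simpa [hc0, hs] using hval i j hij

theorem exists_eq_pairSum_add (w : Fin 5 → Fin 5 → k) : ∃ c : Fin 5 → k, ∑ i, c i = 0 ∧
    ∃ b ∈ (balanced k 5).toSubmodule, ∃ s : k,
      exchangeMap k sixClass (pairSum k 5 c + b) = exchangeMap k sixClass w + s • theta k sixClass
    := by
  -- `v` symmetrizes `w`, `r` holds its vertex sums and `t` is the mean edge weight, each of the ten
  -- edges being counted twice in `∑ r i`. The vertex sum of `t + c i + c j` is `4 t + 3 c i`, which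
  -- dictates `c`; `b` is the remainder.
  let v : Fin 5 → Fin 5 → k := fun i j => if i = j then 0 else (w i j + w j i) / 2
  let r : Fin 5 → k := fun i => ∑ j, v i j
  let t : k := (∑ i, r i) / 20
  let c : Fin 5 → k := fun i => (r i - 4 * t) / 3
  let b : Fin 5 → Fin 5 → k := fun i j => if i = j then 0 else v i j - t - c i - c j
  have hc : ∑ i, c i = 0 := by
    simp only [c, t, ← Finset.sum_div, Finset.sum_sub_distrib]
    simp
    ring
  have hb : b ∈ (balanced k 5).toSubmodule := by
    refine ⟨fun i j => ?_, fun i => by simp [b], fun i => ?_⟩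
    · simp only [b, v, eq_comm (a := j), add_comm (w j i)]
      split_ifs <;> ring
    · have h1 : ∀ j, b i j = v i j - t - c i - c j + if i = j then t + 2 * c i else 0 := by
        intro j
        by_cases hij : i = j
        · subst hij
          simp [b, v]
          ring
        · simp [b, hij]
      simp only [h1, Finset.sum_add_distrib, Finset.sum_sub_distrib, hc, Finset.sum_ite_eq,
        Finset.mem_univ, if_true, Finset.sum_const, Finset.card_univ, Fintype.card_fin]
      change r i - _ - _ - _ + _ = 0
      simp only [c]
      simp
      ring
  -- The constant weight `t` maps to `2 t • θ`, since both orderings of an edge count.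
  refine ⟨c, hc, b, hb, -(2 * t), ?_⟩
  ext a
  obtain ⟨i, j, hij, ha⟩ := exchangeMap_apply_eq k a
  rw [Pi.add_apply, ha, ha]
  simp [theta, formOn, pairSum_apply, b, v, hij, hij.symm]
  ring

theorem fundToV_add_balancedToV_eq_zero {c : (fund k 5).toSubmodule}
    {w : (balanced k 5).toSubmodule} (h : fundToV k c + balancedToV k w = 0) : c = 0 ∧ w = 0 := by
  have h' : (thetaLine k sixClass 2).mkQ
      (⟨_, exchangeMap_mem_kF k (pairSum k 5 c + w)⟩ : kF k sixClass 2) =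
      (thetaLine k sixClass 2).mkQ 0 := by
    rw [map_zero, ← h, fundToV_apply, balancedToV_apply, ← map_add]
    congr 1
    exact Subtype.ext (map_add _ _ _)
  obtain ⟨s, hs⟩ := (mkQ_eq_iff _ _).1 h'
  have := eq_zero_of_exchangeMap_eq_smul_theta (mem_fund_iff k |>.1 c.2) w.2 (s := s)
    (by simpa using hs)
  exact ⟨Subtype.ext this.1, Subtype.ext this.2⟩

theorem exists_fundToV_add_balancedToV_eq (x : kF k sixClass 2 ⧸ thetaLine k sixClass 2) :
    ∃ c w, fundToV k c + balancedToV k w = x := by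
  obtain ⟨⟨φ, hφ⟩, rfl⟩ := Submodule.mkQ_surjective _ x
  obtain ⟨w, rfl⟩ := exists_exchangeMap_eq k hφ
  obtain ⟨c, hc, b, hb, s, h⟩ := exists_eq_pairSum_add w
  refine ⟨⟨c, (mem_fund_iff k).2 hc⟩, ⟨b, hb⟩, ?_⟩
  rw [fundToV_apply, balancedToV_apply, ← map_add]
  refine (mkQ_eq_iff _ _).2 ⟨s, ?_⟩
  change _ = (exchangeMap k sixClass (pairSum k 5 c) + exchangeMap k sixClass b) -
    exchangeMap k sixClass w
  rw [← map_add, h, add_sub_cancel_left]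

theorem nonempty_equiv_range {G A B : Type*} [Group G] [AddCommGroup A] [Module k A]
    [AddCommGroup B] [Module k B] {ρ : Representation k G A} {σ : Representation k G B}
    (F : ρ.IntertwiningMap σ) (hF : Function.Injective F) :
    Nonempty (ρ.Equiv F.range.toRepresentation) := by
  refine ⟨Representation.Equiv.mk (LinearEquiv.ofInjective F.toLinearMap hF) fun g => ?_⟩
  refine LinearMap.ext fun v => Subtype.ext ?_
  exact Representation.IntertwiningMap.isIntertwining ρ σ F g v

/-- The summands are the images of `fundToV` and `balancedToV`. Independence modulo `θ` gives both
injectivity and trivial intersection; the splitting of an arbitrary edge weight gives the span. -/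
theorem V_sixClass_decomposition : ∃ U W : Subrepresentation (V k sixClass 2), IsCompl U W ∧
    Nonempty (U.toRepresentation.Equiv (fund k 5).toRepresentation) ∧
    IsFive k W.toRepresentation := by
  have hU : Function.Injective (fundToV k) := (injective_iff_map_eq_zero _).2 fun c hc =>
    (fundToV_add_balancedToV_eq_zero (w := 0) (by rw [hc, map_zero, add_zero])).1
  have hW : Function.Injective (balancedToV k) := (injective_iff_map_eq_zero _).2 fun w hw =>
    (fundToV_add_balancedToV_eq_zero (c := 0) (by rw [hw, map_zero, add_zero])).2
  obtain ⟨E⟩ := nonempty_equiv_range _ hU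
  obtain ⟨F⟩ := nonempty_equiv_range _ hW
  refine ⟨(fundToV k).range, (balancedToV k).range, IsCompl.of_eq ?_ ?_, ⟨E.symm⟩,
    F.isIrreducible isIrreducible_balanced, ?_, ?_⟩
  · refine Subrepresentation.toSubmodule_injective (eq_bot_iff.2 ?_)
    rintro _ ⟨⟨c, rfl⟩, ⟨w, hw⟩⟩
    have hw' : balancedToV k w = fundToV k c := hw
    have := fundToV_add_balancedToV_eq_zero (c := c) (w := -w) (by rw [map_neg, hw', add_neg_cancel])
    rw [this.1, map_zero]
    exact Submodule.zero_mem _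
  · refine Subrepresentation.toSubmodule_injective (eq_top_iff.2 fun x _ => ?_)
    obtain ⟨c, w, rfl⟩ := exists_fundToV_add_balancedToV_eq x
    exact Submodule.add_mem_sup ⟨c, rfl⟩ ⟨w, rfl⟩
  · rw [← F.toLinearEquiv.finrank_eq, finrank_balanced]
  · rw [← Representation.char_iso F, character_balanced]

end SixCycles

end NCGeom

/-! ### Certificates for the remaining representations -/

namespace NCGeom

theorem isFiveBar_doubleTranspositions (k : Type*) [Field k] [CharZero k] :
    IsFiveBar k (V k (ConjClasses.mk (c[1, 2] * c[3, 4] : Equiv.Perm (Fin 5))) 5) := by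
  have D := enumeration_doubleTranspositions
  -- The 5-cycle preserves the first set and permutes the other five cyclically, starting from the
  -- image of the first set under `(1 2)`. The vector records the exponents; its entry at `0` plays
  -- no role.
  refine isFiveBar_V (by norm_num) ((D.ncard_stratum k 5).trans (by decide +kernel))
    doubleTranspositionLists ?_ (stratum_doubleTranspositions k) c[1, 2, 3, 4, 5] c[1, 2]
    ![0, 1, 0, 2, 4, 3] (by decide +kernel) (by decide +kernel) (by decide +kernel)
  have h : ∀ i, ∀ a ∈ doubleTranspositionLists i, a ∈ doubleTranspositions := by
    decide +kernel
  exact fun i a ha => (D.mem_iff a).1 (h i a ha)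

theorem isFiveBar_fourCycles (k : Type*) [Field k] [CharZero k] :
    IsFiveBar k (V k (ConjClasses.mk (c[1, 2, 3, 4] : Equiv.Perm (Fin 5))) 10) := by
  have D := enumeration_fourCycles
  -- Same pattern, with a 5-cycle chosen to preserve the first set of 4-cycles.
  refine isFiveBar_V (by norm_num) ((D.ncard_stratum k 10).trans (by decide +kernel))
    fourCycleLists ?_ (stratum_fourCycles_ten k) c[5, 1, 4, 2, 3] c[1, 2]
    ![0, 3, 1, 0, 4, 2] (by decide +kernel) (by decide +kernel) (by decide +kernel)
  have h : ∀ i, ∀ a ∈ fourCycleLists i, a ∈ fourCycles := by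
    decide +kernel
  exact fun i a ha => (D.mem_iff a).1 (h i a ha)

theorem nonempty_V_fiveCycles_equiv (k : Type*) [Field k] [CharZero k] :
    Nonempty ((V k (ConjClasses.mk (c[1, 2, 3, 4, 5] : Equiv.Perm (Fin 5))) 12).Equiv
      (signRep k 5)) := by
  classical
  have D := enumeration_fiveCycles
  refine nonempty_V_equiv_signRep (by norm_num) ((D.ncard_stratum k 12).trans (by decide +kernel))
    0 1 (by decide) fun i j hij φ hφ h => ?_
  rw [stratum_fiveCycles] at hφ
  obtain ⟨ε, rfl⟩ : ∃ ε, φ = formOn k _ (fiveCycleSet ε) := by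
    rcases hφ with rfl | rfl
    exacts [⟨_, rfl⟩, ⟨_, rfl⟩]
  -- A 5-cycle on which membership changes under conjugation shows that the transposition moves the
  -- form.
  have key : ∀ ε : ℤˣ, ∀ i j : Fin 5, i ≠ j → ∃ a ∈ fiveCycles,
      ¬ ((∃ σ : Equiv.Perm (Fin 5), σ 1 = 1 ∧ Equiv.Perm.sign σ = ε ∧
        a = [1, σ 2, σ 3, σ 4, σ 5].formPerm) ↔
      (∃ σ : Equiv.Perm (Fin 5), σ 1 = 1 ∧ Equiv.Perm.sign σ = ε ∧
        Equiv.swap i j * a * Equiv.swap i j = [1, σ 2, σ 3, σ 4, σ 5].formPerm)) := by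
    decide +kernel
  obtain ⟨a, ha, hne⟩ := key ε i j hij
  rw [conjRep_formOn] at h
  have := congrFun h ⟨a, (D.mem_iff a).1 ha⟩
  rw [formOn_apply, formOn_apply] at this
  refine hne ?_
  change a ∈ fiveCycleSet ε ↔ Equiv.swap i j * a * Equiv.swap i j ∈ fiveCycleSet ε
  by_cases h1 : a ∈ fiveCycleSet ε <;>
    by_cases h2 : Equiv.swap i j * a * Equiv.swap i j ∈ fiveCycleSet ε <;>
    simp [h1, h2] at this ⊢

end NCGeom

open NCGeom in
/-- The points `1, 2, 3, 4, 5` are written as such in `Fin 5` (so `5` is the element `0`). -/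
theorem proposition4p4 (k : Type*) [Field k] [CharZero k] :
    -- the six nontrivial conjugacy classes
    (∀ C : ConjClasses (Equiv.Perm (Fin 5)), C ≠ ConjClasses.mk 1 →
      C = ConjClasses.mk c[1, 2] ∨ C = ConjClasses.mk (c[1, 2] * c[3, 4]) ∨
      C = ConjClasses.mk c[1, 2, 3] ∨ C = ConjClasses.mk (c[1, 2, 3] * c[4, 5]) ∨
      C = ConjClasses.mk c[1, 2, 3, 4] ∨ C = ConjClasses.mk c[1, 2, 3, 4, 5]) ∧
    -- in every nontrivial class
    (∀ C : ConjClasses (Equiv.Perm (Fin 5)), C ≠ ConjClasses.mk 1 →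
      stratum k C 0 = {0} ∧
      stratum k C 1 = {φ | ∃ a ∈ C.carrier, φ = formOn k C {a}} ∧
      stratum k C (Nat.card C.carrier) = {theta k C}) ∧
    -- 2-cycles
    (∀ C : ConjClasses (Equiv.Perm (Fin 5)), C = ConjClasses.mk c[1, 2] →
      Nat.card C.carrier = 10 ∧
      stratum k C 6 = Set.range (fun i => theta k C - thetaAt k C i) ∧
      (stratum k C 6).ncard = 5 ∧
      (stratum k C 4).ncard = 10 ∧
      (stratum k C 3).ncard = 10 ∧
      (stratum k C 2).ncard = 15 ∧
      (∀ n ∉ ({0, 1, 2, 3, 4, 6, 10} : Set ℕ), stratum k C n = ∅) ∧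
      theta k C ∈ kF k C 6 ∧
      Nonempty ((V k C 6).Equiv (fund k 5).toRepresentation)) ∧
    -- the class of (12)(34)
    (∀ C : ConjClasses (Equiv.Perm (Fin 5)), C = ConjClasses.mk (c[1, 2] * c[3, 4]) →
      Nat.card C.carrier = 15 ∧
      stratum k C 5 = formOn k C '' doubleTranspositionSets ∧
      (stratum k C 5).ncard = 6 ∧
      (stratum k C 3).ncard = 15 ∧
      (stratum k C 2).ncard = 15 ∧
      (∀ n ∉ ({0, 1, 2, 3, 5, 15} : Set ℕ), stratum k C n = ∅) ∧
      theta k C ∈ kF k C 5 ∧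
      IsFiveBar k (V k C 5)) ∧
    -- 3-cycles
    (∀ C : ConjClasses (Equiv.Perm (Fin 5)), C = ConjClasses.mk c[1, 2, 3] →
      Nat.card C.carrier = 20 ∧
      stratum k C 8 = Set.range (fun i => theta k C - thetaAt k C i) ∧
      (stratum k C 8).ncard = 5 ∧
      (stratum k C 4).ncard = 10 ∧
      (stratum k C 2).ncard = 10 ∧
      (∀ n ∉ ({0, 1, 2, 4, 8, 20} : Set ℕ), stratum k C n = ∅) ∧
      theta k C ∈ kF k C 8 ∧
      Nonempty ((V k C 8).Equiv (fund k 5).toRepresentation)) ∧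
    -- the class of (123)(45)
    (∀ C : ConjClasses (Equiv.Perm (Fin 5)), C = ConjClasses.mk (c[1, 2, 3] * c[4, 5]) →
      Nat.card C.carrier = 20 ∧
      stratum k C 2 = {φ | ∃ x y z u v : Fin 5, [x, y, z, u, v].Nodup ∧
        φ = formOn k C {[x, y, z].formPerm * [u, v].formPerm,
          [x, z, y].formPerm * [u, v].formPerm}} ∧
      (stratum k C 2).ncard = 10 ∧
      (∀ n ∉ ({0, 1, 2, 20} : Set ℕ), stratum k C n = ∅) ∧
      theta k C ∈ kF k C 2 ∧
      ∃ U W : Subrepresentation (V k C 2), IsCompl U W ∧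
        Nonempty (U.toRepresentation.Equiv (fund k 5).toRepresentation) ∧
        IsFive k W.toRepresentation) ∧
    -- 4-cycles
    (∀ C : ConjClasses (Equiv.Perm (Fin 5)), C = ConjClasses.mk c[1, 2, 3, 4] →
      Nat.card C.carrier = 30 ∧
      stratum k C 10 = formOn k C '' fourCycleSets ∧
      (stratum k C 10).ncard = 6 ∧
      stratum k C 6 = Set.range (fun i => theta k C - thetaAt k C i) ∧
      (stratum k C 6).ncard = 5 ∧
      (stratum k C 5).ncard = 12 ∧
      (stratum k C 2).ncard = 15 ∧
      (∀ n ∉ ({0, 1, 2, 5, 6, 10, 30} : Set ℕ), stratum k C n = ∅) ∧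
      theta k C ∈ kF k C 10 ∧
      IsFiveBar k (V k C 10)) ∧
    -- 5-cycles
    (∀ C : ConjClasses (Equiv.Perm (Fin 5)), C = ConjClasses.mk c[1, 2, 3, 4, 5] →
      Nat.card C.carrier = 24 ∧
      stratum k C 12 = {formOn k C (fiveCycleSet 1), formOn k C (fiveCycleSet (-1))} ∧
      (stratum k C 12).ncard = 2 ∧
      (stratum k C 4).ncard = 6 ∧
      (stratum k C 3).ncard = 24 ∧
      (stratum k C 2).ncard = 36 ∧
      (∀ n ∉ ({0, 1, 2, 3, 4, 12, 24} : Set ℕ), stratum k C n = ∅) ∧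
      theta k C ∈ kF k C 12 ∧
      Nonempty ((V k C 12).Equiv (signRep k 5))) := by
  have hc : ∀ {C : ConjClasses (Equiv.Perm (Fin 5))} {els tab masks}
      (_ : Enumeration C els tab masks) (n m : ℕ),
      (masks.filter (popCount els.length · = n)).toFinset.card = m → (stratum k C n).ncard = m :=
    fun D n m h => (D.ncard_stratum k n).trans h
  have D1 := enumeration_transpositions
  have D2 := enumeration_doubleTranspositions
  have D3 := enumeration_threeCycles
  have D4 := enumeration_sixCycles
  have D5 := enumeration_fourCycles
  have D6 := enumeration_fiveCycles
  refine ⟨conjClasses_perm_five, fun C _ => ⟨stratum_zero C, stratum_one C, stratum_card C⟩,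
    ?_, ?_, ?_, ?_, ?_, ?_⟩
  · rintro C rfl
    have h6 := hc D1 6 5 (by decide +kernel)
    exact ⟨D1.natCard_carrier, stratum_transpositions k, h6, hc D1 4 10 (by decide +kernel),
      hc D1 3 10 (by decide +kernel), hc D1 2 15 (by decide +kernel),
      fun n hn => D1.stratum_eq_empty k (l := [0, 1, 2, 3, 4, 6, 10]) (by decide +kernel)
        (by simpa using hn),
      theta_mem_kF_of_stratum_nonempty (by norm_num) (by rw [h6]; norm_num),
      nonempty_V_equiv_fund (by norm_num) h6 (stratum_transpositions k)⟩
  · rintro C rfl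
    have h5 := hc D2 5 6 (by decide +kernel)
    refine ⟨D2.natCard_carrier, ?_, h5, hc D2 3 15 (by decide +kernel),
      hc D2 2 15 (by decide +kernel),
      fun n hn => D2.stratum_eq_empty k (l := [0, 1, 2, 3, 5, 15]) (by decide +kernel)
        (by simpa using hn),
      theta_mem_kF_of_stratum_nonempty (by norm_num) (by rw [h5]; norm_num),
      isFiveBar_doubleTranspositions k⟩
    rw [stratum_doubleTranspositions, doubleTranspositionSets_eq, ← Set.range_comp]
    rfl
  · rintro C rfl
    have h8 := hc D3 8 5 (by decide +kernel)
    exact ⟨D3.natCard_carrier, stratum_threeCycles k, h8, hc D3 4 10 (by decide +kernel),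
      hc D3 2 10 (by decide +kernel),
      fun n hn => D3.stratum_eq_empty k (l := [0, 1, 2, 4, 8, 20]) (by decide +kernel)
        (by simpa using hn),
      theta_mem_kF_of_stratum_nonempty (by norm_num) (by rw [h8]; norm_num),
      nonempty_V_equiv_fund (by norm_num) h8 (stratum_threeCycles k)⟩
  · rintro C rfl
    have h2 := hc D4 2 10 (by decide +kernel)
    exact ⟨D4.natCard_carrier, stratum_sixCycles k, h2,
      fun n hn => D4.stratum_eq_empty k (l := [0, 1, 2, 20]) (by decide +kernel)
        (by simpa using hn),
      theta_mem_kF_of_stratum_nonempty (by norm_num) (by rw [h2]; norm_num),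
      V_sixClass_decomposition⟩
  · rintro C rfl
    have h10 := hc D5 10 6 (by decide +kernel)
    refine ⟨D5.natCard_carrier, ?_, h10, stratum_fourCycles_six k,
      hc D5 6 5 (by decide +kernel), hc D5 5 12 (by decide +kernel),
      hc D5 2 15 (by decide +kernel),
      fun n hn => D5.stratum_eq_empty k (l := [0, 1, 2, 5, 6, 10, 30]) (by decide +kernel)
        (by simpa using hn),
      theta_mem_kF_of_stratum_nonempty (by norm_num) (by rw [h10]; norm_num),
      isFiveBar_fourCycles k⟩
    rw [stratum_fourCycles_ten, fourCycleSets_eq, ← Set.range_comp]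
    rfl
  · rintro C rfl
    have h12 := hc D6 12 2 (by decide +kernel)
    exact ⟨D6.natCard_carrier, stratum_fiveCycles k, h12, hc D6 4 6 (by decide +kernel),
      hc D6 3 24 (by decide +kernel), hc D6 2 36 (by decide +kernel),
      fun n hn => D6.stratum_eq_empty k (l := [0, 1, 2, 3, 4, 12, 24]) (by decide +kernel)
        (by simpa using hn),
      theta_mem_kF_of_stratum_nonempty (by norm_num) (by rw [h12]; norm_num),
      nonempty_V_fiveCycles_equiv k⟩
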